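/- Let $V_8=\mathbb{C}^8$, and consider the grading of length seven of the complex simple Lie algebra $\mathfrak{e}_8$ defined by its simple root $\alpha_2$, $$\mathfrak{e}_8=\mathfrak g_{-3}\oplus\cdots\oplus\mathfrak g_{3}= V_8^\vee \oplus \wedge^2V_8\oplus \wedge^3V_8^\vee \oplus \mathfrak{gl}(V_8)\oplus \wedge^3V_8\oplus \wedge^2V_8^\vee\oplus V_8$$ (a decomposition into $\mathfrak{sl}(V_8)$-modules). For $z\in\mathfrak g_1=\wedge^3V_8$, the operators $\mathrm{ad}(z)^4:\mathfrak g_{-2}\to\mathfrak g_2$ and $\mathrm{ad}(z)^6:\mathfrak g_{-3}\to\mathfrak g_3$ define homogeneous polynomial maps $$P: Sym^4(\wedge^3V_8)\to Hom(\wedge^2V_8,\wedge^2V_8^\vee),\qquad Q: Sym^6(\wedge^3V_8)\to Hom(V_8^\vee,V_8).$$ Let $c:\wedge^2V_8^\vee\otimes V_8\to V_8^\vee$ be the contraction map and $c^t: V_8\to\wedge^2V_8\otimes V_8^\vee$ its dual. Define $$R: Sym^{10}(\wedge^3V_8)\to Hom(V_8,V_8^\vee),\qquad R(z)=c\circ(P(z)\otimes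 Q(z))\circ c^t .$$ Then: 1. $Q(z)$ and $R(z)$ are symmetric for every $z\in\wedge^3V_8$. 2. There is a nonzero $SL(V_8)$-invariant homogeneous polynomial $J_{16}$ of degree $16$ on $\wedge^3V_8$, every $SL(V_8)$-invariant homogeneous polynomial of degree $16$ on $\wedge^3V_8$ is a scalar multiple of it, and for a suitable normalization of $J_{16}$ the pair $(Q,R)$ is a matrix factorization of $J_{16}$: the entries of the matrices of $Q(z)$ and $R(z)$ are homogeneous polynomials in $z$ of degrees $6$ and $10$, and for all $z\in\wedge^3V_8$ $$Q(z)\,R(z)=J_{16}(z)\,\mathrm{Id}_{V_8},\qquad R(z)\,Q(z)=J_{16}(z)\,\mathrm{Id}_{V_8^\vee}.$$ -/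

import Mathlib

noncomputable section
namespace E8Model
open scoped Matrix

/-- The space `Vₙ = ℂⁿ`. Its dual `Vₙ^∨` is written in the dual basis and is represented by the same
coordinate space, the evaluation of a form on a vector being the dot product `φ ⬝ᵥ v`. -/
abbrev Vec (n : ℕ) : Type := Fin n → ℂ

/-- The exterior algebra `∧ Vₙ` (or `∧ Vₙ^∨`). -/
abbrev Ext (n : ℕ) : Type := ExteriorAlgebra ℂ (Vec n)

/-- A vector, as an element of the exterior algebra. -/
abbrev vec {n : ℕ} : Vec n →ₗ[ℂ] Ext n := ExteriorAlgebra.ι ℂ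

/-- The standard basis of `Vₙ` (or the dual basis of `Vₙ^∨`). -/
abbrev e {n : ℕ} (i : Fin n) : Vec n := Pi.single i 1

/-- The contraction `φ ⌋ x` by a linear form `φ`, the antiderivation of `∧ Vₙ` with `φ ⌋ v = φ(v)`. -/
def contrVec (n : ℕ) : Vec n →ₗ[ℂ] Module.End ℂ (Ext n) :=
  (CliffordAlgebra.contractLeft (R := ℂ) (M := Vec n) (Q := 0)) ∘ₗ
    (dotProductEquiv ℂ (Fin n)).toLinearMap

theorem contrVec_apply {n : ℕ} (φ : Vec n) (x : Ext n) :
    contrVec n φ x = CliffordAlgebra.contractLeft (dotProductEquiv ℂ (Fin n) φ) x := rfl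

theorem contrVec_sq {n : ℕ} (φ : Vec n) : contrVec n φ * contrVec n φ = 0 := by
  apply LinearMap.ext
  intro x
  rw [Module.End.mul_apply, contrVec_apply, contrVec_apply,
    CliffordAlgebra.contractLeft_contractLeft, LinearMap.zero_apply]

/-- The contraction of `∧ Vₙ` by `∧ Vₙ^∨` (or the other way round), the action with
`(φ ∧ ψ) ⌋ x = φ ⌋ (ψ ⌋ x)`. -/
def contr {n : ℕ} : Ext n →ₐ[ℂ] Module.End ℂ (Ext n) :=
  ExteriorAlgebra.lift ℂ ⟨contrVec n, contrVec_sq⟩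

theorem contr_vec {n : ℕ} (φ : Vec n) (x : Ext n) :
    contr (vec φ) x = CliffordAlgebra.contractLeft (dotProductEquiv ℂ (Fin n) φ) x := by
  rw [contr, ExteriorAlgebra.lift_ι_apply, contrVec_apply]

theorem contr_vec_mul {n : ℕ} (φ v : Vec n) (x : Ext n) :
    contr (vec φ) (vec v * x) = (φ ⬝ᵥ v) • x - vec v * contr (vec φ) x := by
  rw [contr_vec, contr_vec]
  exact CliffordAlgebra.contractLeft_ι_mul (Q := (0 : QuadraticForm ℂ (Vec n))) _ _ _

theorem contr_vec_one {n : ℕ} (φ : Vec n) : contr (vec φ) (1 : Ext n) = 0 := by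
  rw [contr_vec]; exact CliffordAlgebra.contractLeft_one (Q := (0 : QuadraticForm ℂ (Vec n))) _

theorem contr_vec_vec {n : ℕ} (φ v : Vec n) :
    contr (vec φ) (vec v) = algebraMap ℂ _ (φ ⬝ᵥ v) := by
  have := contr_vec_mul φ v 1
  rw [contr_vec_one] at this
  simpa [Algebra.algebraMap_eq_smul_one] using this

theorem contr_mul {n : ℕ} (a b x : Ext n) : contr (a * b) x = contr a (contr b x) := by
  rw [map_mul]; rfl

/-- Induction by left multiplication with vectors. -/
theorem ext_induction {n : ℕ} {p : Ext n → Prop} (h1 : p 1)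
    (hadd : ∀ x y, p x → p y → p (x + y)) (hs : ∀ (c : ℂ) x, p x → p (c • x))
    (hm : ∀ (v : Vec n) x, p x → p (vec v * x)) (x : Ext n) : p x := by
  induction x using CliffordAlgebra.left_induction with
  | algebraMap r =>
    have := hs r 1 h1
    rwa [← Algebra.algebraMap_eq_smul_one] at this
  | add x y hx hy => exact hadd x y hx hy
  | ι_mul x m hx => exact hm m x hx

/-- The action of the matrix `A` on the exterior algebra as a derivation:
`v₁ ∧ ⋯ ∧ vₖ ↦ ∑ᵢ v₁ ∧ ⋯ ∧ A vᵢ ∧ ⋯ ∧ vₖ`. -/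
def der {n : ℕ} (A : Matrix (Fin n) (Fin n) ℂ) : Module.End ℂ (Ext n) :=
  ∑ i, LinearMap.mulLeft ℂ (vec (A *ᵥ e i)) * contr (vec (e i))

theorem der_apply {n : ℕ} (A : Matrix (Fin n) (Fin n) ℂ) (x : Ext n) :
    der A x = ∑ i, vec (A *ᵥ e i) * contr (vec (e i)) x := by
  simp [der]

theorem vec_anti {n : ℕ} (v w : Vec n) : vec v * vec w = - (vec w * vec v) :=
  eq_neg_of_add_eq_zero_left (ExteriorAlgebra.ι_add_mul_swap v w)

theorem sum_e {n : ℕ} (v : Vec n) : ∑ i, v i • (e i : Vec n) = v := by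
  ext j; simp [Finset.sum_apply, Pi.single_apply]

theorem sum_mulVec_e {n : ℕ} (A : Matrix (Fin n) (Fin n) ℂ) (v : Vec n) :
    ∑ i, v i • (A *ᵥ e i) = A *ᵥ v := by
  conv_rhs => rw [← sum_e v]
  rw [Matrix.mulVec_sum]; simp only [Matrix.mulVec_smul]

theorem der_vec_mul {n : ℕ} (A : Matrix (Fin n) (Fin n) ℂ) (v : Vec n) (x : Ext n) :
    der A (vec v * x) = vec (A *ᵥ v) * x + vec v * der A x := by
  rw [der_apply, der_apply]
  have : ∀ i, vec (A *ᵥ e i) * contr (vec (e i)) (vec v * x)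
      = (v i • vec (A *ᵥ e i)) * x + vec v * (vec (A *ᵥ e i) * contr (vec (e i)) x) := by
    intro i
    rw [contr_vec_mul, mul_sub, ← mul_assoc, vec_anti _ v, ← mul_assoc]
    simp
  rw [Finset.sum_congr rfl fun i _ => this i, Finset.sum_add_distrib, ← Finset.sum_mul,
    ← Finset.mul_sum]
  simp only [← map_smul, ← map_sum, sum_mulVec_e]

theorem der_one {n : ℕ} (A : Matrix (Fin n) (Fin n) ℂ) : der A (1 : Ext n) = 0 := by
  rw [der_apply]; simp [contr_vec_one]

theorem der_vec {n : ℕ} (A : Matrix (Fin n) (Fin n) ℂ) (v : Vec n) :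
    der A (vec v) = vec (A *ᵥ v) := by
  have := der_vec_mul A v 1
  simpa [der_one] using this

theorem der_mul {n : ℕ} (A : Matrix (Fin n) (Fin n) ℂ) (x y : Ext n) :
    der A (x * y) = der A x * y + x * der A y := by
  induction x using ext_induction with
  | h1 => simp [der_one]
  | hadd x z hx hz => simp only [add_mul, map_add, hx, hz]; abel
  | hs c x hx => simp only [smul_mul_assoc, map_smul, hx, smul_add]
  | hm v x hx =>
    rw [mul_assoc, der_vec_mul, hx, der_vec_mul]
    simp only [mul_add, add_mul, mul_assoc]; abel

theorem der_comm {n : ℕ} (A B : Matrix (Fin n) (Fin n) ℂ) (x : Ext n) :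
    der A (der B x) - der B (der A x) = der (A * B - B * A) x := by
  induction x using ext_induction with
  | h1 => simp [der_one]
  | hadd x z hx hz => simp only [map_add, ← hx, ← hz]; abel
  | hs c x hx => simp only [map_smul, ← hx, smul_sub]
  | hm v x hx =>
    simp only [der_vec_mul, map_add, ← hx, Matrix.sub_mulVec, map_sub, sub_mul, mul_sub,
      Matrix.mulVec_mulVec]
    abel

theorem der_contr_vec {n : ℕ} (A : Matrix (Fin n) (Fin n) ℂ) (φ : Vec n) (x : Ext n) :
    der A (contr (vec φ) x) = contr (vec φ) (der A x) - contr (vec (Aᵀ *ᵥ φ)) x := by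
  induction x using ext_induction with
  | h1 => simp [der_one, contr_vec_one]
  | hadd x z hx hz => simp only [map_add, hx, hz]; abel
  | hs c x hx => simp only [map_smul, hx, smul_sub]
  | hm v x hx =>
    simp only [der_vec_mul, map_add, map_sub, map_smul, contr_vec_mul, hx, mul_sub]
    have : (Aᵀ *ᵥ φ) ⬝ᵥ v = φ ⬝ᵥ (A *ᵥ v) := by
      rw [Matrix.mulVec_transpose, Matrix.dotProduct_mulVec]
    rw [this]; abel

theorem der_contr {n : ℕ} (A : Matrix (Fin n) (Fin n) ℂ) (η x : Ext n) :
    der A (contr η x) = contr η (der A x) - contr (der Aᵀ η) x := by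
  induction η using ext_induction generalizing x with
  | h1 => simp [der_one]
  | hadd y z hx hz => simp only [map_add, LinearMap.add_apply, hx, hz]; abel
  | hs c y hx => simp only [map_smul, LinearMap.smul_apply, hx, smul_sub]
  | hm v y hx =>
    simp only [der_vec_mul, map_add, LinearMap.add_apply, contr_mul, der_contr_vec, hx, map_sub]
    abel

/-- The volume element `e₁ ∧ ⋯ ∧ eₙ`. -/
def vol (n : ℕ) : Ext n := ExteriorAlgebra.ιMulti ℂ n e

theorem e_mul_vol {n : ℕ} (i : Fin n) : vec (e i) * vol n = 0 := by
  rw [vol, ExteriorAlgebra.ιMulti_apply]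
  exact ExteriorAlgebra.ι_mul_prod_list e i

theorem vec_mul_vol {n : ℕ} (v : Vec n) : vec v * vol n = 0 := by
  rw [← sum_e v]
  simp [Finset.sum_mul, e_mul_vol]

theorem der_vol {n : ℕ} (A : Matrix (Fin n) (Fin n) ℂ) : der A (vol n) = A.trace • vol n := by
  rw [der_apply, Matrix.trace, Finset.sum_smul]
  refine Finset.sum_congr rfl fun i _ => ?_
  have := contr_vec_mul (e i) (A *ᵥ e i) (vol n)
  rw [vec_mul_vol, map_zero] at this
  rw [← sub_eq_zero.mp this.symm]
  simp

/-- Contraction by a contraction. -/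
theorem contr_contr_vec {n : ℕ} (v : Vec n) (η x : Ext n) :
    contr (contr (vec v) η) x
      = vec v * contr η x - contr (CliffordAlgebra.involute η) (vec v * x) := by
  induction η using ext_induction generalizing x with
  | h1 => simp [contr_vec_one]
  | hadd y z hx hz => simp only [map_add, LinearMap.add_apply, hx, hz, mul_add]; abel
  | hs c y hx => simp only [map_smul, LinearMap.smul_apply, hx, smul_sub, mul_smul_comm]
  | hm φ y hx =>
    have hi : CliffordAlgebra.involute (vec φ : Ext n) = - vec φ := CliffordAlgebra.involute_ι φ
    simp only [contr_vec_mul, map_sub, map_mul, map_smul, LinearMap.sub_apply,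
      LinearMap.smul_apply, Module.End.mul_apply, hx, hi, map_neg, LinearMap.neg_apply]
    rw [dotProduct_comm]
    abel


theorem contr_vec_prod {n : ℕ} (φ : Vec n) (x y : Ext n) :
    contr (vec φ) (x * y) = contr (vec φ) x * y
      + CliffordAlgebra.involute x * contr (vec φ) y := by
  induction x using ext_induction with
  | h1 => simp [contr_vec_one]
  | hadd x z hx hz => simp only [add_mul, map_add, hx, hz]; abel
  | hs c x hx => simp only [smul_mul_assoc, map_smul, hx, smul_add]
  | hm v x hx =>
    have hi : CliffordAlgebra.involute (vec v : Ext n) = - vec v := CliffordAlgebra.involute_ι v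
    rw [mul_assoc, contr_vec_mul, hx, contr_vec_mul, map_mul, hi]
    simp only [mul_add, sub_mul, mul_assoc, smul_mul_assoc, neg_mul]; abel

theorem vec_mem {n : ℕ} (v : Vec n) : vec v ∈ ⋀[ℂ]^1 (Vec n) := by
  rw [ExteriorAlgebra.exteriorPower, pow_one]
  exact LinearMap.mem_range_self _ _

theorem mul_mem {n j k : ℕ} {x y : Ext n} (hx : x ∈ ⋀[ℂ]^j (Vec n)) (hy : y ∈ ⋀[ℂ]^k (Vec n)) :
    x * y ∈ ⋀[ℂ]^(j + k) (Vec n) := by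
  rw [ExteriorAlgebra.exteriorPower, pow_add]
  exact Submodule.mul_mem_mul hx hy

/-- Induction on an exterior power. -/
theorem power_induction {n k : ℕ} {p : ∀ x : Ext n, x ∈ ⋀[ℂ]^(k + 1) (Vec n) → Prop}
    (hadd : ∀ x hx y hy, p x hx → p y hy → p (x + y) (add_mem hx hy))
    (hm : ∀ (v : Vec n) (x : Ext n) (hx : x ∈ ⋀[ℂ]^k (Vec n)),
      p (vec v * x) (by rw [add_comm k 1]; exact mul_mem (vec_mem v) hx))
    {x : Ext n} (hx : x ∈ ⋀[ℂ]^(k + 1) (Vec n)) : p x hx := by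
  have hx' := hx
  rw [ExteriorAlgebra.exteriorPower, pow_succ'] at hx'
  refine Submodule.mul_induction_on' (C := fun x _ => ∀ h, p x h) ?_ ?_ hx' hx
  · rintro m ⟨v, rfl⟩ y hy h
    exact hm v y hy
  · intro x hx y hy ihx ihy h
    have hx1 : x ∈ ⋀[ℂ]^(k + 1) (Vec n) := by
      rw [ExteriorAlgebra.exteriorPower, pow_succ']; exact hx
    have hy1 : y ∈ ⋀[ℂ]^(k + 1) (Vec n) := by
      rw [ExteriorAlgebra.exteriorPower, pow_succ']; exact hy
    exact hadd x hx1 y hy1 (ihx hx1) (ihy hy1)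

theorem involute_mem {n k : ℕ} {x : Ext n} (hx : x ∈ ⋀[ℂ]^k (Vec n)) :
    CliffordAlgebra.involute x = ((-1 : ℂ) ^ k) • x := by
  induction k generalizing x with
  | zero =>
    rw [ExteriorAlgebra.exteriorPower, pow_zero, Submodule.mem_one] at hx
    obtain ⟨c, rfl⟩ := hx
    simp
  | succ k ih =>
    induction hx using power_induction with
    | hadd x _ y _ hx hy => simp only [map_add, hx, hy, smul_add]
    | hm v x hx =>
      have hi : CliffordAlgebra.involute (vec v : Ext n) = - vec v := CliffordAlgebra.involute_ι v
      rw [map_mul, hi, ih hx, pow_succ]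
      simp

theorem der_mem {n k : ℕ} (A : Matrix (Fin n) (Fin n) ℂ) {x : Ext n} (hx : x ∈ ⋀[ℂ]^k (Vec n)) :
    der A x ∈ ⋀[ℂ]^k (Vec n) := by
  induction k generalizing x with
  | zero =>
    rw [ExteriorAlgebra.exteriorPower, pow_zero, Submodule.mem_one] at hx
    obtain ⟨c, rfl⟩ := hx
    rw [Algebra.algebraMap_eq_smul_one, map_smul, der_one, smul_zero]
    exact zero_mem _
  | succ k ih =>
    induction hx using power_induction with
    | hadd x _ y _ hx hy => rw [map_add]; exact add_mem hx hy
    | hm v x hx =>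
      rw [der_vec_mul, add_comm k 1]
      exact add_mem (mul_mem (vec_mem _) hx) (mul_mem (vec_mem _) (ih hx))

theorem contr_vec_mem_zero {n : ℕ} (φ : Vec n) {x : Ext n} (hx : x ∈ ⋀[ℂ]^0 (Vec n)) :
    contr (vec φ) x = 0 := by
  rw [ExteriorAlgebra.exteriorPower, pow_zero, Submodule.mem_one] at hx
  obtain ⟨c, rfl⟩ := hx
  rw [Algebra.algebraMap_eq_smul_one, map_smul, contr_vec_one, smul_zero]

theorem contr_vec_mem {n k : ℕ} (φ : Vec n) {x : Ext n} (hx : x ∈ ⋀[ℂ]^(k + 1) (Vec n)) :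
    contr (vec φ) x ∈ ⋀[ℂ]^k (Vec n) := by
  induction k generalizing x with
  | zero =>
    induction hx using power_induction with
    | hadd x _ y _ hx hy => rw [map_add]; exact add_mem hx hy
    | hm v x hx =>
      rw [contr_vec_mul, contr_vec_mem_zero φ hx, mul_zero, sub_zero]
      exact Submodule.smul_mem _ _ hx
  | succ k ih =>
    induction hx using power_induction with
    | hadd x _ y _ hx hy => rw [map_add]; exact add_mem hx hy
    | hm v x hx =>
      rw [contr_vec_mul]
      refine sub_mem (Submodule.smul_mem _ _ hx) ?_
      rw [add_comm k 1]
      exact mul_mem (vec_mem _) (ih hx)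

theorem contr_mem {n j k : ℕ} {η x : Ext n} (hη : η ∈ ⋀[ℂ]^j (Vec n))
    (hx : x ∈ ⋀[ℂ]^(k + j) (Vec n)) : contr η x ∈ ⋀[ℂ]^k (Vec n) := by
  induction j generalizing k η with
  | zero =>
    rw [ExteriorAlgebra.exteriorPower, pow_zero, Submodule.mem_one] at hη
    obtain ⟨c, rfl⟩ := hη
    rw [Algebra.algebraMap_eq_smul_one, map_smul, map_one]
    exact Submodule.smul_mem _ _ hx
  | succ j ih =>
    induction hη using power_induction with
    | hadd y _ z _ hy hz => rw [map_add]; exact add_mem hy hz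
    | hm v y hy =>
      rw [contr_mul]
      refine contr_vec_mem v (ih hy ?_)
      rwa [add_assoc, add_comm 1 j]

theorem vol_mem (n : ℕ) : vol n ∈ ⋀[ℂ]^n (Vec n) :=
  ExteriorAlgebra.ιMulti_range ℂ n ⟨_, rfl⟩

theorem vec_rep {n : ℕ} {x : Ext n} (hx : x ∈ ⋀[ℂ]^1 (Vec n)) : ∃ v : Vec n, x = vec v := by
  rw [ExteriorAlgebra.exteriorPower, pow_one] at hx
  obtain ⟨c, rfl⟩ := hx
  exact ⟨c, rfl⟩

theorem tri_mem {n : ℕ} (a b c : Vec n) : vec a * (vec b * vec c) ∈ ⋀[ℂ]^3 (Vec n) :=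
  mul_mem (vec_mem _) (mul_mem (vec_mem _) (vec_mem _))

/-- Induction on three-vectors. -/
theorem tri_induction {n : ℕ} {p : ∀ x : Ext n, x ∈ ⋀[ℂ]^3 (Vec n) → Prop}
    (hadd : ∀ x hx y hy, p x hx → p y hy → p (x + y) (add_mem hx hy))
    (hm : ∀ a b c : Vec n, p (vec a * (vec b * vec c)) (tri_mem a b c))
    {x : Ext n} (hx : x ∈ ⋀[ℂ]^3 (Vec n)) : p x hx := by
  induction hx using power_induction with
  | hadd x hx y hy ihx ihy => exact hadd x hx y hy ihx ihy
  | hm a x hx =>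
    revert a
    induction hx using power_induction with
    | hadd x hx y hy ihx ihy =>
      intro a
      have := hadd _ _ _ _ (ihx a) (ihy a)
      simpa only [mul_add] using this
    | hm b x hx =>
      intro a
      obtain ⟨c, rfl⟩ := vec_rep hx
      exact hm a b c

theorem vec_swap {n : ℕ} (a b : Vec n) (x : Ext n) :
    vec a * (vec b * x) = - (vec b * (vec a * x)) := by
  rw [← mul_assoc, vec_anti, neg_mul, mul_assoc]

theorem vec_mul_mem {n k : ℕ} (v : Vec n) {x : Ext n} (hx : x ∈ ⋀[ℂ]^k (Vec n)) :
    vec v * x = (-1 : ℂ) ^ k • (x * vec v) := by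
  induction k generalizing x with
  | zero =>
    rw [ExteriorAlgebra.exteriorPower, pow_zero, Submodule.mem_one] at hx
    obtain ⟨c, rfl⟩ := hx
    rw [pow_zero, one_smul, Algebra.commutes]
  | succ k ih =>
    induction hx using power_induction with
    | hadd x _ y _ hx hy => rw [mul_add, hx, hy, add_mul, smul_add]
    | hm w x hx =>
      rw [vec_swap, ih hx, pow_succ]
      simp [mul_assoc]

theorem mul_comm_mem {n j k : ℕ} {x y : Ext n} (hx : x ∈ ⋀[ℂ]^j (Vec n))
    (hy : y ∈ ⋀[ℂ]^k (Vec n)) : x * y = (-1 : ℂ) ^ (j * k) • (y * x) := by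
  induction j generalizing x with
  | zero =>
    rw [ExteriorAlgebra.exteriorPower, pow_zero, Submodule.mem_one] at hx
    obtain ⟨c, rfl⟩ := hx
    simp [Algebra.commutes]
  | succ j ih =>
    induction hx using power_induction with
    | hadd x _ z _ hx hz => rw [add_mul, mul_add, hx, hz, smul_add]
    | hm w x hx =>
      rw [mul_assoc, ih hx, mul_smul_comm, ← mul_assoc, vec_mul_mem w hy, smul_mul_assoc, smul_smul,
        mul_assoc, add_mul, one_mul, pow_add]

theorem tri_anti {n : ℕ} {x y : Ext n} (hx : x ∈ ⋀[ℂ]^3 (Vec n)) (hy : y ∈ ⋀[ℂ]^3 (Vec n)) :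
    x * y = - (y * x) := by
  have := mul_comm_mem hx hy
  norm_num at this
  exact this

theorem tri_sq {n : ℕ} {x : Ext n} (hx : x ∈ ⋀[ℂ]^3 (Vec n)) : x * x = 0 :=
  by
  have h : (2 : ℂ) • (x * x) = 0 := by
    rw [two_smul]; nth_rewrite 1 [tri_anti hx hx]; exact neg_add_cancel _
  exact (smul_eq_zero.mp h).resolve_left two_ne_zero

/-- The scalar part of the contraction; the invariant pairing of `∧ᵏ Vₙ^∨` with `∧ᵏ Vₙ`. -/
def pairing {n : ℕ} : Ext n →ₗ[ℂ] Ext n →ₗ[ℂ] ℂ :=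
  (contr (n := n)).toLinearMap.compr₂ (ExteriorAlgebra.algebraMapInv (R := ℂ) (M := Vec n)).toLinearMap

theorem pairing_apply {n : ℕ} (x y : Ext n) :
    pairing x y = ExteriorAlgebra.algebraMapInv (contr x y) := rfl

theorem algebraMap_inv_mem {n : ℕ} {x : Ext n} (hx : x ∈ ⋀[ℂ]^0 (Vec n)) :
    algebraMap ℂ (Ext n) (ExteriorAlgebra.algebraMapInv x) = x := by
  rw [ExteriorAlgebra.exteriorPower, pow_zero, Submodule.mem_one] at hx
  obtain ⟨c, rfl⟩ := hx
  rw [ExteriorAlgebra.algebraMap_leftInverse]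

theorem algebraMap_pairing {n k : ℕ} {x y : Ext n} (hx : x ∈ ⋀[ℂ]^k (Vec n))
    (hy : y ∈ ⋀[ℂ]^k (Vec n)) : algebraMap ℂ (Ext n) (pairing x y) = contr x y := by
  rw [pairing_apply, algebraMap_inv_mem]
  exact contr_mem hx (by rwa [zero_add])

theorem contr_lt {n k : ℕ} {η x : Ext n} (hη : η ∈ ⋀[ℂ]^(k + 1) (Vec n))
    (hx : x ∈ ⋀[ℂ]^k (Vec n)) : contr η x = 0 := by
  induction hη using power_induction with
  | hadd y _ z _ hy hz => rw [map_add, LinearMap.add_apply, hy, hz, add_zero]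
  | hm v y hy =>
    rw [contr_mul]
    exact contr_vec_mem_zero v (contr_mem hy (by rwa [zero_add]))

theorem pairing_symm {n : ℕ} {x y : Ext n} (hx : x ∈ ⋀[ℂ]^3 (Vec n))
    (hy : y ∈ ⋀[ℂ]^3 (Vec n)) : contr x y = contr y x := by
  induction hx using tri_induction with
  | hadd x _ z _ hx hz => simp only [map_add, LinearMap.add_apply, hx, hz]
  | hm a b c =>
    induction hy using tri_induction with
    | hadd x _ z _ hx hz => simp only [map_add, LinearMap.add_apply, hx, hz]
    | hm p q r =>
      simp only [contr_mul, contr_vec_mul, contr_vec_vec, map_sub, map_smul, mul_sub, mul_smul_comm,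
        Algebra.algebraMap_eq_smul_one, mul_one, dotProduct_comm p, dotProduct_comm q,
        dotProduct_comm r, smul_sub, smul_smul]
      module

theorem sum_pairing {n : ℕ} {v y : Ext n} (hv : v ∈ ⋀[ℂ]^3 (Vec n)) (hy : y ∈ ⋀[ℂ]^2 (Vec n)) :
    ∑ a, pairing v (vec (e a) * y) • vec (e a) = contr y v := by
  obtain ⟨z, hz⟩ := vec_rep (contr_mem hy (k := 1) hv)
  rw [hz]
  have h : ∀ a, pairing v (vec (e a) * y) = z a := by
    intro a
    rw [pairing_apply, pairing_symm hv (mul_mem (vec_mem _) hy), contr_mul, hz, contr_vec_vec,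
      ExteriorAlgebra.algebraMap_leftInverse]
    simp
  simp only [h]
  conv_rhs => rw [← sum_e z]
  simp only [map_sum, map_smul]

/-- The equivariant map `∧³ Vₙ × ∧³ Vₙ^∨ → gl(Vₙ)`, whose `(a, b)` entry is the pairing of `u` with
`e_a ∧ (e_b ⌋ w)`. -/
def moment {n : ℕ} (u w : Ext n) : Matrix (Fin n) (Fin n) ℂ :=
  Matrix.of fun a b => pairing u (vec (e a) * contr (vec (e b)) w)

theorem der_moment {n : ℕ} {u v w : Ext n} (hv : v ∈ ⋀[ℂ]^3 (Vec n)) (hw : w ∈ ⋀[ℂ]^3 (Vec n)) :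
    der (moment v w) u = ∑ i, contr (contr (vec (e i)) w) v * contr (vec (e i)) u := by
  rw [der_apply]
  refine Finset.sum_congr rfl fun i _ => ?_
  rw [← sum_pairing hv (contr_vec_mem (e i) hw)]
  congr 1
  conv_lhs => rw [← sum_e (moment v w *ᵥ e i)]
  simp [moment]

theorem sum_contr {n : ℕ} (φ : Vec n) (u : Ext n) :
    ∑ i, φ i • contr (vec (e i)) u = contr (vec φ) u := by
  conv_rhs => rw [← sum_e φ]
  simp only [map_sum, map_smul, LinearMap.sum_apply, LinearMap.smul_apply]

theorem der_moment_tri {n : ℕ} {u v : Ext n} (hv : v ∈ ⋀[ℂ]^3 (Vec n)) (a b c : Vec n) :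
    der (moment v (vec a * (vec b * vec c))) u
      = contr (vec b * vec c) v * contr (vec a) u - contr (vec a * vec c) v * contr (vec b) u
        + contr (vec a * vec b) v * contr (vec c) u := by
  rw [der_moment hv (by exact mul_mem (vec_mem _) (mul_mem (vec_mem _) (vec_mem _)))]
  have h : ∀ i, contr (contr (vec (e i)) (vec a * (vec b * vec c))) v * contr (vec (e i)) u
      = contr (vec b * vec c) v * (a i • contr (vec (e i)) u)
        - contr (vec a * vec c) v * (b i • contr (vec (e i)) u)
        + contr (vec a * vec b) v * (c i • contr (vec (e i)) u) := by
    intro i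
    simp only [contr_vec_mul, contr_vec_vec, single_one_dotProduct, mul_sub, mul_smul_comm,
      Algebra.algebraMap_eq_smul_one, mul_one, map_sub, map_smul, LinearMap.sub_apply,
      LinearMap.smul_apply, sub_mul, smul_mul_assoc]
    abel
  rw [Finset.sum_congr rfl fun i _ => h i]
  simp only [Finset.sum_add_distrib, Finset.sum_sub_distrib, ← Finset.mul_sum, sum_contr]

theorem moment_add_right {n : ℕ} (u w w' : Ext n) :
    moment u (w + w') = moment u w + moment u w' := by
  ext a b; simp [moment, mul_add]

theorem moment_add_left {n : ℕ} (u u' w : Ext n) :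
    moment (u + u') w = moment u w + moment u' w := by
  ext a b; simp [moment]

theorem moment_smul_right {n : ℕ} (c : ℂ) (u w : Ext n) : moment u (c • w) = c • moment u w := by
  ext a b; simp [moment]

theorem moment_smul_left {n : ℕ} (c : ℂ) (u w : Ext n) : moment (c • u) w = c • moment u w := by
  ext a b; simp [moment]

theorem der_add {n : ℕ} (A B : Matrix (Fin n) (Fin n) ℂ) (x : Ext n) :
    der (A + B) x = der A x + der B x := by
  simp only [der_apply, Matrix.add_mulVec, map_add, add_mul, Finset.sum_add_distrib]

theorem der_smul {n : ℕ} (c : ℂ) (A : Matrix (Fin n) (Fin n) ℂ) (x : Ext n) :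
    der (c • A) x = c • der A x := by
  simp only [der_apply, Matrix.smul_mulVec, map_smul, smul_mul_assoc, Finset.smul_sum]

theorem contr_tri_mul {n : ℕ} {u v w : Ext n} (hu : u ∈ ⋀[ℂ]^3 (Vec n))
    (hv : v ∈ ⋀[ℂ]^3 (Vec n)) (hw : w ∈ ⋀[ℂ]^3 (Vec n)) :
    contr w (u * v) = der (moment v w) u - der (moment u w) v
      + (pairing w u • v - pairing w v • u) := by
  induction hw using tri_induction with
  | hadd x _ z _ hx hz =>
    simp only [map_add, LinearMap.add_apply, hx, hz, moment_add_right, der_add, add_smul]; abel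
  | hm a b c =>
    have hw : vec a * (vec b * vec c) ∈ ⋀[ℂ]^3 (Vec n) := 
      mul_mem (vec_mem _) (mul_mem (vec_mem _) (vec_mem _))
    rw [der_moment_tri hv, der_moment_tri hu, Algebra.smul_def, Algebra.smul_def,
      algebraMap_pairing hw hu, algebraMap_pairing hw hv]
    have h2 : ∀ {x : Ext n} (p : Vec n), x ∈ ⋀[ℂ]^3 (Vec n) → contr (vec p) x ∈ ⋀[ℂ]^2 (Vec n) :=
      fun p hx => contr_vec_mem p hx
    have h1 : ∀ {x : Ext n} (p q : Vec n), x ∈ ⋀[ℂ]^3 (Vec n) →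
      contr (vec p) (contr (vec q) x) ∈ ⋀[ℂ]^1 (Vec n) :=
      fun p q hx => contr_vec_mem p (h2 q hx)
    have i3 : ∀ {x : Ext n}, x ∈ ⋀[ℂ]^3 (Vec n) → CliffordAlgebra.involute x = -x := by
      intro x hx; rw [involute_mem hx]; norm_num
    have i2 : ∀ {x : Ext n}, x ∈ ⋀[ℂ]^2 (Vec n) → CliffordAlgebra.involute x = x := by
      intro x hx; rw [involute_mem hx]; norm_num
    have i1 : ∀ {x : Ext n}, x ∈ ⋀[ℂ]^1 (Vec n) → CliffordAlgebra.involute x = -x := by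
      intro x hx; rw [involute_mem hx]; norm_num
    have c12 : ∀ {x y : Ext n}, x ∈ ⋀[ℂ]^2 (Vec n) → y ∈ ⋀[ℂ]^1 (Vec n) → x * y = y * x := by
      intro x y hx hy; rw [mul_comm_mem hx hy]; norm_num
    have c03 : ∀ {x y : Ext n}, x ∈ ⋀[ℂ]^3 (Vec n) → y ∈ ⋀[ℂ]^0 (Vec n) → x * y = y * x := by
      intro x y hx hy; rw [mul_comm_mem hx hy]; norm_num
    simp only [contr_mul, contr_vec_prod, map_add, map_neg, i3 hu, i2 (h2 c hu),
      i2 (h2 b hu), i1 (h1 _ _ hu), neg_mul]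
    rw [c12 (h2 a hu) (h1 b c hv), c12 (h2 b hu) (h1 a c hv), c12 (h2 c hu) (h1 a b hv),
      c03 hu (contr_vec_mem a (h1 b c hv))]
    abel

theorem moment_transpose {n : ℕ} {u w : Ext n} (hu : u ∈ ⋀[ℂ]^3 (Vec n))
    (hw : w ∈ ⋀[ℂ]^3 (Vec n)) : (moment u w)ᵀ = moment w u := by
  ext a b
  simp only [moment, Matrix.transpose_apply, Matrix.of_apply, pairing_apply]
  congr 1
  rw [pairing_symm hw (mul_mem (vec_mem _) (contr_vec_mem _ hu))]
  have h0 : contr u (contr (vec (e a)) w) = 0 := contr_lt hu (contr_vec_mem _ hw)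
  have := contr_contr_vec (e b) u (contr (vec (e a)) w)
  have i3 : CliffordAlgebra.involute u = -u := by
    rw [involute_mem hu]; norm_num
  rw [h0, i3, mul_zero, zero_sub, map_neg, LinearMap.neg_apply, neg_neg] at this
  rw [← this, ← contr_mul, mul_comm_mem (vec_mem _) (contr_vec_mem _ hu)]
  norm_num

theorem der_id {n k : ℕ} {x : Ext n} (hx : x ∈ ⋀[ℂ]^k (Vec n)) :
    der 1 x = (k : ℂ) • x := by
  induction k generalizing x with
  | zero =>
    rw [ExteriorAlgebra.exteriorPower, pow_zero, Submodule.mem_one] at hx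
    obtain ⟨c, rfl⟩ := hx
    rw [Algebra.algebraMap_eq_smul_one, map_smul, der_one]
    simp
  | succ k ih =>
    induction hx using power_induction with
    | hadd x _ y _ hx hy => rw [map_add, hx, hy, smul_add]
    | hm v x hx =>
      rw [der_vec_mul, ih hx, Matrix.one_mulVec, mul_smul_comm]
      push_cast
      module

theorem trace_moment {n : ℕ} {u w : Ext n} (_hu : u ∈ ⋀[ℂ]^3 (Vec n))
    (hw : w ∈ ⋀[ℂ]^3 (Vec n)) : (moment u w).trace = 3 * pairing u w := by
  have h : ∑ a, vec (e a) * contr (vec (e a)) w = (3 : ℂ) • w := by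
    have := der_apply (1 : Matrix (Fin n) (Fin n) ℂ) w
    simp only [Matrix.one_mulVec] at this
    rw [← this]
    exact_mod_cast der_id hw
  simp only [Matrix.trace, Matrix.diag, moment, Matrix.of_apply]
  rw [← map_sum, h, map_smul, smul_eq_mul]


/-- The equivariant map `∧³ V₉ × ∧³ V₉ → ∧⁶ V₉ ≅ ∧³ V₉^∨`, `(u, v) ↦ (u ∧ v) ⌋ vol` (and the same
with `V₉` and `V₉^∨` exchanged). -/
def star3 (u v : Ext 9) : Ext 9 := contr u (contr v (vol 9))

theorem star3_mem {u v : Ext 9} (hu : u ∈ ⋀[ℂ]^3 (Vec 9)) (hv : v ∈ ⋀[ℂ]^3 (Vec 9)) :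
    star3 u v ∈ ⋀[ℂ]^3 (Vec 9) :=
  contr_mem hu (contr_mem (k := 6) hv (vol_mem 9))

theorem star3_anti {u v : Ext 9} (hu : u ∈ ⋀[ℂ]^3 (Vec 9)) (hv : v ∈ ⋀[ℂ]^3 (Vec 9)) :
    star3 u v = - star3 v u := by
  rw [star3, star3, ← contr_mul, ← contr_mul, tri_anti hu hv, map_neg, LinearMap.neg_apply]

theorem contr_vol_vol : contr (vol 9) (vol 9) = 1 := by
  have h : ∀ i j : Fin 9, (e i : Vec 9) ⬝ᵥ e j = if i = j then 1 else 0 := fun i j => by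
    simp [Pi.single_apply, eq_comm]
  have hv : vol 9 = vec (e 0) * (vec (e 1) * (vec (e 2) * (vec (e 3) * (vec (e 4) *
      (vec (e 5) * (vec (e 6) * (vec (e 7) * (vec (e 8) * 1)))))))) := by
    rw [vol, ExteriorAlgebra.ιMulti_apply]
    simp only [List.ofFn_succ, List.ofFn_zero, List.prod_cons, List.prod_nil]
    rfl
  rw [hv]
  simp only [contr_mul, contr_vec_mul, contr_vec_one, h, Fin.reduceEq, if_true, if_false, one_smul,
    zero_smul, map_one, mul_zero, zero_sub, sub_zero, mul_neg, map_neg, neg_neg,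
    Module.End.one_apply]

theorem contr_contr_vol (y : Ext 9) : contr (contr y (vol 9)) (vol 9) = y := by
  induction y using ext_induction with
  | h1 => simp [contr_vol_vol]
  | hadd x y hx hy => simp only [map_add, LinearMap.add_apply, hx, hy]
  | hs c x hx => simp only [map_smul, LinearMap.smul_apply, hx]
  | hm v x hx =>
    rw [contr_mul, contr_contr_vec, hx, vec_mul_vol, map_zero, sub_zero]

theorem star3_star3 {u v w : Ext 9} (hu : u ∈ ⋀[ℂ]^3 (Vec 9)) (hv : v ∈ ⋀[ℂ]^3 (Vec 9))
    (hw : w ∈ ⋀[ℂ]^3 (Vec 9)) : star3 (star3 u v) w = - contr w (u * v) := by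
  rw [star3_anti (star3_mem hu hv) hw]
  conv_lhs => rw [star3, star3, ← contr_mul u v, contr_contr_vol]

/-- The traceless part of `moment u w`. -/
def moment0 (u w : Ext 9) : Matrix (Fin 9) (Fin 9) ℂ := moment u w - (pairing u w / 3) • 1

theorem pairing_comm {n : ℕ} {u w : Ext n} (hu : u ∈ ⋀[ℂ]^3 (Vec n)) (hw : w ∈ ⋀[ℂ]^3 (Vec n)) :
    pairing u w = pairing w u := by
  rw [pairing_apply, pairing_apply, pairing_symm hu hw]

theorem moment0_transpose {u w : Ext 9} (hu : u ∈ ⋀[ℂ]^3 (Vec 9)) (hw : w ∈ ⋀[ℂ]^3 (Vec 9)) :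
    (moment0 u w)ᵀ = moment0 w u := by
  rw [moment0, moment0, Matrix.transpose_sub, moment_transpose hu hw, pairing_comm hu hw,
    Matrix.transpose_smul, Matrix.transpose_one]

theorem trace_moment0 {u w : Ext 9} (hu : u ∈ ⋀[ℂ]^3 (Vec 9)) (hw : w ∈ ⋀[ℂ]^3 (Vec 9)) :
    (moment0 u w).trace = 0 := by
  rw [moment0, Matrix.trace_sub, trace_moment hu hw, Matrix.trace_smul, Matrix.trace_one]
  simp
  ring

theorem der_sub {n : ℕ} (A B : Matrix (Fin n) (Fin n) ℂ) (x : Ext n) :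
    der (A - B) x = der A x - der B x := by
  rw [sub_eq_add_neg, ← neg_one_smul ℂ B, der_add, der_smul]; simp [sub_eq_add_neg]

theorem jacobi_uvw {u v w : Ext 9} (hu : u ∈ ⋀[ℂ]^3 (Vec 9)) (hv : v ∈ ⋀[ℂ]^3 (Vec 9))
    (hw : w ∈ ⋀[ℂ]^3 (Vec 9)) :
    star3 (star3 u v) w + der (moment0 v w) u - der (moment0 u w) v = 0 := by
  rw [star3_star3 hu hv hw, contr_tri_mul hu hv hw, moment0, moment0, der_sub, der_sub, der_smul,
    der_smul, der_id hu, der_id hv, pairing_comm hv hw, pairing_comm hu hw]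
  push_cast
  module

theorem vec_mul_contr_vol (φ : Vec 9) (η : Ext 9) :
    vec φ * contr η (vol 9) = contr (contr (vec φ) η) (vol 9) := by
  rw [contr_contr_vec, vec_mul_vol, map_zero, sub_zero]

theorem moment_star {u v t : Ext 9} (hu : u ∈ ⋀[ℂ]^3 (Vec 9)) (φ x : Vec 9) :
    contr u (vec φ * contr (vec x) (star3 v t))
      = (φ ⬝ᵥ x) • contr (u * (v * t)) (vol 9)
        + contr (vec x * (u * contr (vec φ) (v * t))) (vol 9) := by
  rw [star3, ← contr_mul, ← contr_mul, vec_mul_contr_vol, mul_assoc, contr_vec_mul, map_sub, map_smul,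
    LinearMap.sub_apply, LinearMap.smul_apply, map_sub, map_smul, ← contr_mul, ← contr_mul,
    ← mul_assoc u (vec x), mul_comm_mem hu (vec_mem x)]
  norm_num [mul_assoc]

theorem moment_cyc {u v t : Ext 9} (hu : u ∈ ⋀[ℂ]^3 (Vec 9)) (hv : v ∈ ⋀[ℂ]^3 (Vec 9))
    (ht : t ∈ ⋀[ℂ]^3 (Vec 9)) :
    moment u (star3 v t) + moment v (star3 t u) + moment t (star3 u v)
      = (pairing (u * (v * t)) (vol 9)) • 1 := by
  have c26 : ∀ {x y : Ext 9}, x ∈ ⋀[ℂ]^3 (Vec 9) → y ∈ ⋀[ℂ]^2 (Vec 9) → x * y = y * x := by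
    intro x y hx hy; rw [mul_comm_mem hx hy]; norm_num
  have i3 : ∀ {x : Ext 9}, x ∈ ⋀[ℂ]^3 (Vec 9) → CliffordAlgebra.involute x = -x := by
    intro x hx; rw [involute_mem hx]; norm_num
  have e1 : v * (t * u) = u * (v * t) := by
    rw [tri_anti ht hu, mul_neg, ← mul_assoc, tri_anti hv hu]; simp [mul_assoc]
  have e2 : t * (u * v) = u * (v * t) := by
    rw [← mul_assoc, tri_anti ht hu, neg_mul, mul_assoc, tri_anti ht hv]; simp
  ext a b
  simp only [moment, Matrix.add_apply, Matrix.of_apply, pairing_apply, Matrix.smul_apply,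
    ← map_add]
  rw [moment_star hu, moment_star hv, moment_star ht, e1, e2]
  set C := contr (u * (v * t)) (vol 9) with hC
  have hC0 : C ∈ ⋀[ℂ]^0 (Vec 9) :=
    contr_mem (mul_mem hu (mul_mem hv ht)) (vol_mem 9)
  have hs : u * contr (vec (e a)) (v * t) + v * contr (vec (e a)) (t * u)
      + t * contr (vec (e a)) (u * v) = (-2 : ℂ) • contr (vec (e a)) (u * (v * t)) := by
    have h2 : ∀ {x : Ext 9}, x ∈ ⋀[ℂ]^3 (Vec 9) → contr (vec (e a)) x ∈ ⋀[ℂ]^2 (Vec 9) :=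
      fun hx => contr_vec_mem _ hx
    have m1 : ∀ {x y z : Ext 9}, x ∈ ⋀[ℂ]^3 (Vec 9) → y ∈ ⋀[ℂ]^2 (Vec 9) →
        x * (y * z) = y * (x * z) := by
      intro x y z hx hy; rw [← mul_assoc, c26 hx hy, mul_assoc]
    have m2 : ∀ {x y z : Ext 9}, x ∈ ⋀[ℂ]^3 (Vec 9) → z ∈ ⋀[ℂ]^3 (Vec 9) →
        y ∈ ⋀[ℂ]^2 (Vec 9) → x * (z * y) = y * (x * z) := by
      intro x y z hx hz hy; rw [c26 hz hy, m1 hx hy]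
    simp only [contr_vec_prod, i3 hu, i3 hv, i3 ht, neg_mul, mul_add, mul_neg, neg_neg]
    rw [m1 hu (h2 hv), m2 hu hv (h2 ht), m1 hv (h2 ht), m2 hv ht (h2 hu), m1 ht (h2 hu),
      m2 ht hu (h2 hv), tri_anti hv hu, tri_anti ht hv, tri_anti ht hu]
    simp only [mul_neg]
    module
  have hx : contr (vec (e b) * (u * contr (vec (e a)) (v * t))) (vol 9)
      + contr (vec (e b) * (v * contr (vec (e a)) (t * u))) (vol 9)
      + contr (vec (e b) * (t * contr (vec (e a)) (u * v))) (vol 9)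
      = (-2 : ℂ) • ((e a ⬝ᵥ e b) • C) := by
    rw [← LinearMap.add_apply, ← map_add, ← LinearMap.add_apply, ← map_add, ← mul_add, ← mul_add,
      hs, mul_smul_comm, map_smul, LinearMap.smul_apply, contr_mul, ← vec_mul_contr_vol, ← hC,
      contr_vec_mul, contr_vec_mem_zero _ hC0, mul_zero, sub_zero, dotProduct_comm]
  have hfin : ∀ X Y Z D : Ext 9, D + X + (D + Y) + (D + Z) = (3 : ℂ) • D + (X + Y + Z) := by
    intros; module
  rw [hfin, hx]
  simp only [← add_smul, map_smul, Matrix.one_apply]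
  simp [Pi.single_apply, eq_comm]
  ring_nf

theorem moment0_cyc {u v t : Ext 9} (hu : u ∈ ⋀[ℂ]^3 (Vec 9)) (hv : v ∈ ⋀[ℂ]^3 (Vec 9))
    (ht : t ∈ ⋀[ℂ]^3 (Vec 9)) :
    moment0 u (star3 v t) + moment0 v (star3 t u) + moment0 t (star3 u v) = 0 := by
  have h := moment_cyc hu hv ht
  have h3 := congrArg Matrix.trace h
  rw [Matrix.trace_add, Matrix.trace_add, trace_moment hu (star3_mem hv ht),
    trace_moment hv (star3_mem ht hu), trace_moment ht (star3_mem hu hv), Matrix.trace_smul,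
    Matrix.trace_one] at h3
  simp only [Fintype.card_fin, smul_eq_mul] at h3
  push_cast at h3
  simp only [moment0]
  have h4 : pairing u (star3 v t) + pairing v (star3 t u) + pairing t (star3 u v)
    = 3 * pairing (u * (v * t)) (vol 9) := by linear_combination h3 / 3
  have h5 : pairing (u * (v * t)) (vol 9) = pairing u (star3 v t) / 3 + pairing v (star3 t u) / 3
    + pairing t (star3 u v) / 3 := by linear_combination -h4 / 3
  rw [h5, add_smul, add_smul] at h
  linear_combination (norm := abel) h

theorem der_star3 {A : Matrix (Fin 9) (Fin 9) ℂ} (hA : A.trace = 0) (p q : Ext 9) :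
    der A (star3 p q) = - star3 (der Aᵀ p) q - star3 p (der Aᵀ q) := by
  simp only [star3]
  rw [der_contr, der_contr, der_vol, hA, zero_smul, map_zero, zero_sub, map_neg]
  abel

theorem algebraMapInv_vec_mul {n : ℕ} (v : Vec n) (x : Ext n) :
    ExteriorAlgebra.algebraMapInv (vec v * x) = 0 := by
  rw [map_mul]
  simp [ExteriorAlgebra.algebraMapInv]

theorem pairing_der {n : ℕ} (A : Matrix (Fin n) (Fin n) ℂ) (u y : Ext n) :
    pairing (der A u) y = pairing u (der Aᵀ y) := by
  have h := congrArg (ExteriorAlgebra.algebraMapInv (R := ℂ) (M := Vec n)) (der_contr Aᵀ u y)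
  rw [der_apply, map_sum, Finset.sum_eq_zero fun i _ => algebraMapInv_vec_mul _ _, map_sub,
    Matrix.transpose_transpose] at h
  rw [pairing_apply, pairing_apply]
  exact (sub_eq_zero.mp h.symm).symm

theorem moment_equiv {n : ℕ} (A : Matrix (Fin n) (Fin n) ℂ) (u w : Ext n) :
    A * moment u w - moment u w * A = moment (der A u) w - moment u (der Aᵀ w) := by
  ext a b
  have h1 : (A * moment u w) a b = pairing u (vec (Aᵀ *ᵥ e a) * contr (vec (e b)) w) := by
    rw [Matrix.mul_apply, ← sum_e (Aᵀ *ᵥ e a)]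
    simp [moment, Finset.sum_mul]
  have h2 : (moment u w * A) a b = pairing u (vec (e a) * contr (vec (A *ᵥ e b)) w) := by
    rw [Matrix.mul_apply, ← sum_e (A *ᵥ e b)]
    simp [moment, Finset.mul_sum, mul_comm]
  rw [Matrix.sub_apply, Matrix.sub_apply, h1, h2]
  simp only [moment, Matrix.of_apply]
  rw [pairing_der, der_vec_mul, der_contr_vec, Matrix.transpose_transpose]
  simp only [mul_sub, map_add, map_sub]
  ring

theorem moment0_equiv (A : Matrix (Fin 9) (Fin 9) ℂ) (u w : Ext 9) :
    A * moment0 u w - moment0 u w * A = moment0 (der A u) w - moment0 u (der Aᵀ w) := by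
  have h := moment_equiv A u w
  simp only [moment0, pairing_der, mul_sub, sub_mul, Matrix.mul_smul, Matrix.smul_mul, mul_one,
    one_mul]
  linear_combination (norm := abel) h


/-- The space `slₙ` of traceless matrices. -/
abbrev Sl (n : ℕ) : Submodule ℂ (Matrix (Fin n) (Fin n) ℂ) :=
  LinearMap.ker (Matrix.traceLinearMap (Fin n) ℂ ℂ)

/-- The exceptional Lie algebra `e₈ = sl(V₉) ⊕ ∧³ V₉ ⊕ ∧³ V₉^∨` over `ℂ`, of dimension
`80 + 84 + 84 = 248`, in the standard model given by its maximal rank subalgebra `sl(V₉)`. -/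
def E8 : Type :=
  Sl 9 × ⋀[ℂ]^3 (Vec 9) × ⋀[ℂ]^3 (Vec 9)

namespace E8

instance : AddCommGroup E8 :=
  inferInstanceAs (AddCommGroup
    (Sl 9 × ⋀[ℂ]^3 (Vec 9) × ⋀[ℂ]^3 (Vec 9)))

instance : Module ℂ E8 :=
  inferInstanceAs (Module ℂ
    (Sl 9 × ⋀[ℂ]^3 (Vec 9) × ⋀[ℂ]^3 (Vec 9)))

/-- The `sl₉`-component. -/
def mat : E8 →ₗ[ℂ] Matrix (Fin 9) (Fin 9) ℂ :=
  (Sl 9).subtype ∘ₗ LinearMap.fst ℂ _ _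

/-- The component in `∧³ V₉`. -/
def tri : E8 →ₗ[ℂ] Ext 9 :=
  (⋀[ℂ]^3 (Vec 9)).subtype ∘ₗ LinearMap.fst ℂ _ _ ∘ₗ LinearMap.snd ℂ _ _

/-- The component in `∧³ V₉^∨`. -/
def cotri : E8 →ₗ[ℂ] Ext 9 :=
  (⋀[ℂ]^3 (Vec 9)).subtype ∘ₗ LinearMap.snd ℂ _ _ ∘ₗ LinearMap.snd ℂ _ _

theorem tri_mem (x : E8) : tri x ∈ ⋀[ℂ]^3 (Vec 9) := x.2.1.2
theorem cotri_mem (x : E8) : cotri x ∈ ⋀[ℂ]^3 (Vec 9) := x.2.2.2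
theorem trace_mat (x : E8) : (mat x).trace = 0 := x.1.2

/-- The element with given components. -/
def mk (A : Matrix (Fin 9) (Fin 9) ℂ) (u w : Ext 9) (hA : A.trace = 0)
    (hu : u ∈ ⋀[ℂ]^3 (Vec 9)) (hw : w ∈ ⋀[ℂ]^3 (Vec 9)) : E8 :=
  (⟨A, hA⟩, ⟨u, hu⟩, ⟨w, hw⟩)

@[simp] theorem mat_mk (A u w hA hu hw) : mat (mk A u w hA hu hw) = A := rfl
@[simp] theorem tri_mk (A u w hA hu hw) : tri (mk A u w hA hu hw) = u := rfl
@[simp] theorem cotri_mk (A u w hA hu hw) : cotri (mk A u w hA hu hw) = w := rfl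

@[ext] theorem ext {x y : E8} (h1 : mat x = mat y) (h2 : tri x = tri y)
    (h3 : cotri x = cotri y) : x = y :=
  Prod.ext (Subtype.ext h1) (Prod.ext (Subtype.ext h2) (Subtype.ext h3))

/-- The bracket of `e₈`: `sl(V₉)` acts on itself, on `∧³ V₉` and on `∧³ V₉^∨` in the natural way
(`A` acts on `V₉^∨` by `-Aᵀ`), the bracket of `∧³ V₉` with `∧³ V₉^∨` is the traceless equivariant map
to `sl(V₉)`, and that of `∧³ V₉` (or `∧³ V₉^∨`) with itself is the wedge product, with values in
`∧⁶ V₉ ≅ ∧³ V₉^∨` (or in `∧⁶ V₉^∨ ≅ ∧³ V₉`). -/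
instance : Bracket E8 E8 where
  bracket x y := mk
    (mat x * mat y - mat y * mat x + moment0 (tri x) (cotri y) - moment0 (tri y) (cotri x))
    (der (mat x) (tri y) - der (mat y) (tri x) + star3 (cotri x) (cotri y))
    (der (mat y)ᵀ (cotri x) - der (mat x)ᵀ (cotri y) + star3 (tri x) (tri y))
    (by
      rw [Matrix.trace_sub, Matrix.trace_add, Matrix.trace_sub, Matrix.trace_mul_comm,
        trace_moment0 (tri_mem x) (cotri_mem y), trace_moment0 (tri_mem y) (cotri_mem x)]
      simp)
    (add_mem (sub_mem (der_mem _ (tri_mem y)) (der_mem _ (tri_mem x)))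
      (star3_mem (cotri_mem x) (cotri_mem y)))
    (add_mem (sub_mem (der_mem _ (cotri_mem x)) (der_mem _ (cotri_mem y)))
      (star3_mem (tri_mem x) (tri_mem y)))

theorem mat_lie (x y : E8) : mat ⁅x, y⁆ =
    mat x * mat y - mat y * mat x + moment0 (tri x) (cotri y) - moment0 (tri y) (cotri x) := rfl
theorem tri_lie (x y : E8) : tri ⁅x, y⁆ =
    der (mat x) (tri y) - der (mat y) (tri x) + star3 (cotri x) (cotri y) := rfl
theorem cotri_lie (x y : E8) : cotri ⁅x, y⁆ =
    der (mat y)ᵀ (cotri x) - der (mat x)ᵀ (cotri y) + star3 (tri x) (tri y) := rfl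

theorem moment0_add_left (u u' w : Ext 9) :
    moment0 (u + u') w = moment0 u w + moment0 u' w := by
  simp only [moment0, moment_add_left, map_add, LinearMap.add_apply, add_div, add_smul]; abel

theorem moment0_add_right (u w w' : Ext 9) :
    moment0 u (w + w') = moment0 u w + moment0 u w' := by
  simp only [moment0, moment_add_right, map_add, add_div, add_smul]; abel

theorem moment0_smul_left (c : ℂ) (u w : Ext 9) : moment0 (c • u) w = c • moment0 u w := by
  simp only [moment0, moment_smul_left, map_smul, LinearMap.smul_apply, smul_sub, smul_smul,
    smul_eq_mul, mul_div_assoc]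

theorem moment0_smul_right (c : ℂ) (u w : Ext 9) : moment0 u (c • w) = c • moment0 u w := by
  simp only [moment0, moment_smul_right, map_smul, smul_sub, smul_smul, smul_eq_mul, mul_div_assoc]

theorem moment0_sub_left (u u' w : Ext 9) :
    moment0 (u - u') w = moment0 u w - moment0 u' w := by
  rw [sub_eq_add_neg, ← neg_one_smul ℂ u', moment0_add_left, moment0_smul_left]
  simp [sub_eq_add_neg]

theorem moment0_sub_right (u w w' : Ext 9) :
    moment0 u (w - w') = moment0 u w - moment0 u w' := by
  rw [sub_eq_add_neg, ← neg_one_smul ℂ w', moment0_add_right, moment0_smul_right]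
  simp [sub_eq_add_neg]

theorem star3_add_left (u u' w : Ext 9) : star3 (u + u') w = star3 u w + star3 u' w := by
  simp [star3]
theorem star3_add_right (u w w' : Ext 9) : star3 u (w + w') = star3 u w + star3 u w' := by
  simp [star3]
theorem star3_sub_left (u u' w : Ext 9) : star3 (u - u') w = star3 u w - star3 u' w := by
  simp [star3]
theorem star3_sub_right (u w w' : Ext 9) : star3 u (w - w') = star3 u w - star3 u w' := by
  simp [star3]
theorem star3_smul_right (c : ℂ) (u w : Ext 9) : star3 u (c • w) = c • star3 u w := by
  simp [star3]
theorem star3_self {u : Ext 9} (hu : u ∈ ⋀[ℂ]^3 (Vec 9)) : star3 u u = 0 := by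
  rw [star3, ← contr_mul, tri_sq hu, map_zero, LinearMap.zero_apply]

theorem mat_jacobi (x y z : E8) : mat ⁅x, ⁅y, z⁆⁆ = mat ⁅⁅x, y⁆, z⁆ + mat ⁅y, ⁅x, z⁆⁆ := by
  have hx := tri_mem x; have hy := tri_mem y; have hz := tri_mem z
  have kx := cotri_mem x; have ky := cotri_mem y; have kz := cotri_mem z
  simp only [mat_lie, tri_lie, cotri_lie]
  have E := fun (A u w) => moment0_equiv A u w
  have t1 := moment0_cyc hx hy hz
  have t2 := congrArg Matrix.transpose (moment0_cyc kx ky kz)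
  simp only [Matrix.transpose_add, Matrix.transpose_zero] at t2
  rw [moment0_transpose kx (star3_mem ky kz), moment0_transpose ky (star3_mem kz kx),
    moment0_transpose kz (star3_mem kx ky), star3_anti kz kx] at t2
  rw [star3_anti hz hx] at t1
  simp only [moment0_add_left, moment0_add_right, moment0_sub_left, moment0_sub_right, mul_add,
    mul_sub, add_mul, sub_mul, mul_assoc]
  have n1 : ∀ u w, moment0 (-u) w = - moment0 u w := fun u w => by
    rw [← neg_one_smul ℂ u, moment0_smul_left, neg_one_smul]
  have n2 : ∀ u w, moment0 u (-w) = - moment0 u w := fun u w => by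
    rw [← neg_one_smul ℂ w, moment0_smul_right, neg_one_smul]
  rw [n1] at t2; rw [n2] at t1
  linear_combination (norm := abel) t1 - t2 + E (mat x) (tri y) (cotri z) - E (mat x) (tri z) (cotri y)
    - E (mat y) (tri x) (cotri z) + E (mat y) (tri z) (cotri x)
    + E (mat z) (tri x) (cotri y) - E (mat z) (tri y) (cotri x)

theorem tri_jacobi (x y z : E8) : tri ⁅x, ⁅y, z⁆⁆ = tri ⁅⁅x, y⁆, z⁆ + tri ⁅y, ⁅x, z⁆⁆ := by
  have hx := tri_mem x; have hy := tri_mem y; have hz := tri_mem z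
  have kx := cotri_mem x; have ky := cotri_mem y; have kz := cotri_mem z
  simp only [mat_lie, tri_lie, cotri_lie]
  simp only [star3_add_left, star3_add_right, star3_sub_left, star3_sub_right, der_add, der_sub,
    map_add, map_sub, der_star3 (trace_mat _)]
  have D := fun (A B u) => der_comm (n := 9) A B u
  simp only [der_sub] at D
  have J1 := jacobi_uvw hx hy kz
  have J2 := jacobi_uvw hx hz ky
  have J3 := jacobi_uvw hy hz kx
  have s2 := star3_anti (star3_mem hx hz) ky
  have s3 := star3_anti (star3_mem hy hz) kx
  have a1 := star3_anti ky (der_mem (mat z)ᵀ kx)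
  linear_combination (norm := abel) D (mat x) (mat y) (tri z) - D (mat x) (mat z) (tri y)
    + D (mat y) (mat z) (tri x) - J1 + s3 - J3 - s2 + J2 - a1

theorem cotri_jacobi (x y z : E8) :
    cotri ⁅x, ⁅y, z⁆⁆ = cotri ⁅⁅x, y⁆, z⁆ + cotri ⁅y, ⁅x, z⁆⁆ := by
  have hx := tri_mem x; have hy := tri_mem y; have hz := tri_mem z
  have kx := cotri_mem x; have ky := cotri_mem y; have kz := cotri_mem z
  have tr : ∀ x : E8, (mat x)ᵀ.trace = 0 := fun x => by rw [Matrix.trace_transpose, trace_mat]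
  simp only [mat_lie, tri_lie, cotri_lie, Matrix.transpose_add, Matrix.transpose_sub,
    Matrix.transpose_mul, moment0_transpose (tri_mem _) (cotri_mem _)]
  simp only [star3_add_left, star3_add_right, star3_sub_left, star3_sub_right, der_add, der_sub,
    map_add, map_sub, der_star3 (tr _), Matrix.transpose_transpose]
  have D := fun (A B u) => der_comm (n := 9) A B u
  simp only [der_sub] at D
  have J1 := jacobi_uvw kx ky hz
  have J2 := jacobi_uvw kx kz hy
  have J3 := jacobi_uvw ky kz hx
  have s2 := star3_anti (star3_mem kx kz) hy
  have s3 := star3_anti (star3_mem ky kz) hx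
  have a1 := star3_anti hy (der_mem (mat z) hx)
  linear_combination (norm := abel) D (mat x)ᵀ (mat y)ᵀ (cotri z)
    - D (mat x)ᵀ (mat z)ᵀ (cotri y)
    + D (mat y)ᵀ (mat z)ᵀ (cotri x) - J1 + s3 - J3 - s2 + J2 + a1

instance : LieRing E8 where
  add_lie x y z := by
    apply E8.ext
    · simp only [mat_lie, map_add, moment0_add_left, moment0_add_right, add_mul, mul_add]; abel
    · simp only [tri_lie, map_add, der_add, star3_add_left]; abel
    · simp only [cotri_lie, map_add, der_add, star3_add_left, Matrix.transpose_add]; abel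
  lie_add x y z := by
    apply E8.ext
    · simp only [mat_lie, map_add, moment0_add_left, moment0_add_right, add_mul, mul_add]; abel
    · simp only [tri_lie, map_add, der_add, star3_add_right]; abel
    · simp only [cotri_lie, map_add, der_add, star3_add_right, Matrix.transpose_add]; abel
  lie_self x := by
    apply E8.ext
    · simp [mat_lie]
    · simp [tri_lie, star3_self (cotri_mem x)]
    · simp [cotri_lie, star3_self (tri_mem x)]
  leibniz_lie x y z := E8.ext
    (by rw [map_add, mat_jacobi]) (by rw [map_add, tri_jacobi]) (by rw [map_add, cotri_jacobi])

instance : LieAlgebra ℂ E8 where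
  lie_smul c x y := by
    apply E8.ext
    · simp only [mat_lie, map_smul, moment0_smul_left, moment0_smul_right, smul_sub, smul_add,
        Matrix.mul_smul, Matrix.smul_mul]
    · simp only [tri_lie, map_smul, der_smul, star3_smul_right, smul_sub, smul_add]
    · simp only [cotri_lie, map_smul, der_smul, star3_smul_right, smul_sub, smul_add,
        Matrix.transpose_smul]

end E8

namespace E8

/-- The inclusion of `sl₉` in `e₈`. -/
def ofMat : Sl 9 →ₗ[ℂ] E8 := LinearMap.inl ℂ _ _

/-- The inclusion of `∧³ V₉` in `e₈`. -/
def ofTri : ⋀[ℂ]^3 (Vec 9) →ₗ[ℂ] E8 := LinearMap.inr ℂ _ _ ∘ₗ LinearMap.inl ℂ _ _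

/-- The inclusion of `∧³ V₉^∨` in `e₈`. -/
def ofCotri : ⋀[ℂ]^3 (Vec 9) →ₗ[ℂ] E8 := LinearMap.inr ℂ _ _ ∘ₗ LinearMap.inr ℂ _ _

@[simp] theorem mat_ofMat (A) : mat (ofMat A) = A := rfl
@[simp] theorem tri_ofMat (A) : tri (ofMat A) = 0 := rfl
@[simp] theorem cotri_ofMat (A) : cotri (ofMat A) = 0 := rfl
@[simp] theorem mat_ofTri (u) : mat (ofTri u) = 0 := rfl
@[simp] theorem tri_ofTri (u) : tri (ofTri u) = u := rfl
@[simp] theorem cotri_ofTri (u) : cotri (ofTri u) = 0 := rfl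
@[simp] theorem mat_ofCotri (u) : mat (ofCotri u) = 0 := rfl
@[simp] theorem tri_ofCotri (u) : tri (ofCotri u) = 0 := rfl
@[simp] theorem cotri_ofCotri (u) : cotri (ofCotri u) = u := rfl

end E8

/-! ### The grading of length seven

The pieces of degree `3, 2, 1, 0, -1, -2, -3` of `e₈` are `V₈`, `∧² V₈^∨`, `∧³ V₈`, `gl(V₈)`,
`∧³ V₈^∨`, `∧² V₈` and `V₈^∨`. Below they are embedded in the model, and each of them is shown to
be the corresponding eigenspace of the grading element. -/

/-- The last basis vector `e₉` of `V₉ = V₈ ⊕ ℂ e₉` (and of the dual space). -/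
abbrev eLast : Vec 9 := e 8

/-- The inclusion `V₈ ⊂ V₉` (and `V₈^∨ ⊂ V₉^∨`), extending a vector by zero. -/
def incl : Vec 8 →ₗ[ℂ] Vec 9 where
  toFun v i := if h : (i : ℕ) < 8 then v ⟨i, h⟩ else 0
  map_add' v w := by
    ext i; by_cases h : (i : ℕ) < 8 <;> simp [h]
  map_smul' c v := by
    ext i; by_cases h : (i : ℕ) < 8 <;> simp [h]

/-- The projection `V₉ → V₈` (and `V₉^∨ → V₈^∨`) forgetting the last coordinate. -/
def proj : Vec 9 →ₗ[ℂ] Vec 8 := LinearMap.funLeft ℂ ℂ Fin.castSucc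

theorem incl_apply (v : Vec 8) (i : Fin 9) :
    incl v i = if h : (i : ℕ) < 8 then v ⟨i, h⟩ else 0 := rfl

theorem incl_last (v : Vec 8) : incl v 8 = 0 := rfl

theorem incl_castSucc (v : Vec 8) (i : Fin 8) : incl v i.castSucc = v i := by
  simp [incl_apply]

theorem proj_apply (v : Vec 9) (i : Fin 8) : proj v i = v i.castSucc := rfl

theorem proj_incl (v : Vec 8) : proj (incl v) = v := by
  ext i; rw [proj_apply, incl_castSucc]

theorem incl_proj (v : Vec 9) : incl (proj v) = v - v 8 • eLast := by
  ext i
  rw [incl_apply]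
  by_cases h : (i : ℕ) < 8
  · have h8 : i ≠ 8 := fun h' => by simp [h'] at h
    simp [h, proj_apply, h8]
  · have h8 : i = 8 := Fin.ext (by simp; omega)
    subst h8
    simp

/-- `x ↦ x ∧ e₉`, from `∧² V₉` to `∧³ V₉` (and the same for `V₉^∨`). -/
def wedgeLast : ⋀[ℂ]^2 (Vec 9) →ₗ[ℂ] ⋀[ℂ]^3 (Vec 9) :=
  (LinearMap.mulRight ℂ (vec eLast) ∘ₗ (⋀[ℂ]^2 (Vec 9)).subtype).codRestrict _
    fun x => mul_mem x.2 (vec_mem eLast)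

/-- `x ↦ e₉ ⌋ x`, from `∧³ V₉` to `∧² V₉` (and the same for `V₉^∨`). -/
def contrLast : ⋀[ℂ]^3 (Vec 9) →ₗ[ℂ] ⋀[ℂ]^2 (Vec 9) :=
  (contr (vec eLast) ∘ₗ (⋀[ℂ]^3 (Vec 9)).subtype).codRestrict _
    fun x => contr_vec_mem eLast x.2

/-- The degree `3` piece `V₈`: `v ↦ v ⊗ e₉^∨ ∈ sl₉`. -/
def g3 : Vec 8 →ₗ[ℂ] E8 :=
  E8.ofMat ∘ₗ
    { toFun := fun v => ⟨Matrix.vecMulVec (incl v) eLast, by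
        simp [Matrix.trace_vecMulVec, incl_last]⟩
      map_add' := fun v w => Subtype.ext (by simp [Matrix.add_vecMulVec])
      map_smul' := fun c v => Subtype.ext (by simp [Matrix.smul_vecMulVec]) }

/-- The degree `2` piece `∧² V₈^∨`: `y ↦ y ∧ e₉^∨ ∈ ∧³ V₉^∨`. -/
def g2 : ⋀[ℂ]^2 (Vec 8) →ₗ[ℂ] E8 := E8.ofCotri ∘ₗ wedgeLast ∘ₗ exteriorPower.map 2 incl

/-- The degree `1` piece `∧³ V₈ ⊂ ∧³ V₉`. -/
def g1 : ⋀[ℂ]^3 (Vec 8) →ₗ[ℂ] E8 := E8.ofTri ∘ₗ exteriorPower.map 3 incl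

/-- The degree `0` piece `gl(V₈)`: the block matrices `diag(A, - tr A)` in `sl₉`. -/
def g0 : Matrix (Fin 8) (Fin 8) ℂ →ₗ[ℂ] E8 :=
  E8.ofMat ∘ₗ
    { toFun := fun A => ⟨LinearMap.toMatrix' (incl ∘ₗ Matrix.toLin' A ∘ₗ proj)
          - A.trace • Matrix.single 8 8 1, by
        have h : proj ∘ₗ incl = LinearMap.id := LinearMap.ext proj_incl
        simp only [LinearMap.mem_ker, Matrix.traceLinearMap_apply, Matrix.trace_sub,
          LinearMap.toMatrix'_comp, LinearMap.toMatrix'_toLin', Matrix.trace_smul]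
        rw [Matrix.trace_mul_comm, Matrix.mul_assoc, ← LinearMap.toMatrix'_comp, h]
        simp⟩
      map_add' := fun A B => Subtype.ext (by
        simp [LinearMap.comp_add, LinearMap.add_comp, add_smul]; abel)
      map_smul' := fun c A => Subtype.ext (by
        simp [LinearMap.comp_smul, LinearMap.smul_comp, smul_sub]) }

/-- The degree `-1` piece `∧³ V₈^∨ ⊂ ∧³ V₉^∨`. -/
def gNeg1 : ⋀[ℂ]^3 (Vec 8) →ₗ[ℂ] E8 := E8.ofCotri ∘ₗ exteriorPower.map 3 incl

/-- The degree `-2` piece `∧² V₈`: `x ↦ x ∧ e₉ ∈ ∧³ V₉`. -/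
def gNeg2 : ⋀[ℂ]^2 (Vec 8) →ₗ[ℂ] E8 := E8.ofTri ∘ₗ wedgeLast ∘ₗ exteriorPower.map 2 incl

/-- The degree `-3` piece `V₈^∨`: `φ ↦ e₉ ⊗ φ ∈ sl₉`. -/
def gNeg3 : Vec 8 →ₗ[ℂ] E8 :=
  E8.ofMat ∘ₗ
    { toFun := fun v => ⟨Matrix.vecMulVec eLast (incl v), by
        simp [Matrix.trace_vecMulVec, incl_last]⟩
      map_add' := fun v w => Subtype.ext (by simp [Matrix.vecMulVec_add])
      map_smul' := fun c v => Subtype.ext (by simp [Matrix.vecMulVec_smul]) }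

/-- The grading element `diag(1/3, …, 1/3, -8/3)` of the Cartan subalgebra: the simple root at the
short end of the Dynkin diagram takes the value `1` on it, and the simple roots of `gl(V₈)` take
the value `0`. -/
def gradingElement : E8 :=
  E8.ofMat ⟨(1 / 3 : ℂ) • 1 - (3 : ℂ) • Matrix.single 8 8 1, by
    simp; norm_num⟩

/-- The degree `k` piece of the grading of `e₈`, the eigenspace of `ad(gradingElement)` for the
eigenvalue `k`. -/
def grade (k : ℤ) : Submodule ℂ E8 :=
  Module.End.eigenspace (LieAlgebra.ad ℂ E8 gradingElement) (k : ℂ)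

theorem mem_grade {k : ℤ} {x : E8} : x ∈ grade k ↔ ⁅gradingElement, x⁆ = (k : ℂ) • x := by
  rw [grade, Module.End.mem_eigenspace_iff, LieAlgebra.ad_apply]

theorem lie_mem_grade {j k : ℤ} {x y : E8} (hx : x ∈ grade j) (hy : y ∈ grade k) :
    ⁅x, y⁆ ∈ grade (j + k) := by
  rw [mem_grade] at *
  rw [leibniz_lie, hx, hy, smul_lie, lie_smul, ← add_smul]
  push_cast
  rfl

theorem ad_pow_mem_grade {k : ℤ} {x y : E8} (hx : x ∈ grade 1) (hy : y ∈ grade k) (n : ℕ) :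
    ((LieAlgebra.ad ℂ E8 x) ^ n) y ∈ grade (k + n) := by
  induction n with
  | zero => simpa using hy
  | succ n ih =>
    rw [pow_succ', Module.End.mul_apply, LieAlgebra.ad_apply]
    have := lie_mem_grade hx ih
    convert this using 2
    push_cast; ring

theorem der_single {n : ℕ} (i j : Fin n) (x : Ext n) :
    der (Matrix.single i j 1) x = vec (e i) * contr (vec (e j)) x := by
  rw [der_apply, Finset.sum_eq_single j]
  · congr 2
    ext k
    simp [Matrix.single_apply, Pi.single_apply, eq_comm]
  · intro k _ hk
    have : (Matrix.single i j (1 : ℂ)) *ᵥ e k = 0 := by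
      ext l
      simp [hk.symm]
    rw [this, map_zero, zero_mul]
  · simp

/-- The projector `x ↦ e₉ ∧ (e₉ ⌋ x)`. -/
def lastPart (x : Ext 9) : Ext 9 := vec eLast * contr (vec eLast) x

theorem lastPart_lastPart (x : Ext 9) : lastPart (lastPart x) = lastPart x := by
  rw [lastPart, lastPart, contr_vec_mul, ← contr_mul, ExteriorAlgebra.ι_sq_zero]
  simp [eLast]

theorem lastPart_eq_zero {x : Ext 9} {c : ℂ} (h : lastPart x = c • x) (hc : c ≠ 1) (h0 : c ≠ 0) :
    x = 0 := by
  have h1 := lastPart_lastPart x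
  rw [h, lastPart, map_smul, mul_smul_comm, ← lastPart, h, smul_smul, ← sub_eq_zero, ← sub_smul]
    at h1
  rcases smul_eq_zero.mp h1 with h2 | h2
  · exact absurd h2 (by
      have : c * c - c = c * (c - 1) := by ring
      rw [this]; exact mul_ne_zero h0 (sub_ne_zero.mpr hc))
  · exact h2

theorem map_incl_proj (x : Ext 9) :
    ExteriorAlgebra.map (incl ∘ₗ proj) x = x - lastPart x := by
  induction x using ext_induction with
  | h1 => simp [lastPart, contr_vec_one]
  | hadd x y hx hy => simp only [map_add, hx, hy, lastPart, mul_add]; abel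
  | hs c x hx => simp only [map_smul, hx, lastPart, mul_smul_comm, smul_sub]
  | hm v x hx =>
    rw [map_mul, hx, ExteriorAlgebra.map_apply_ι, LinearMap.comp_apply, incl_proj]
    simp only [lastPart, contr_vec_mul, single_one_dotProduct, map_sub, map_smul, sub_mul, mul_sub,
      smul_mul_assoc, mul_smul_comm]
    rw [← mul_assoc (vec eLast) (vec eLast), ExteriorAlgebra.ι_sq_zero, zero_mul, smul_zero,
      vec_swap eLast v]
    abel

theorem coe_map {k : ℕ} {m n : ℕ} (f : Vec m →ₗ[ℂ] Vec n) (x : ⋀[ℂ]^k (Vec m)) :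
    (exteriorPower.map k f x : Ext n) = ExteriorAlgebra.map f (x : Ext m) := by
  have : (⋀[ℂ]^k (Vec n)).subtype ∘ₗ exteriorPower.map k f
      = (ExteriorAlgebra.map f).toLinearMap ∘ₗ (⋀[ℂ]^k (Vec m)).subtype := by
    ext v
    simp [exteriorPower.map_apply_ιMulti, ExteriorAlgebra.map_apply_ιMulti]
  exact LinearMap.congr_fun this x

theorem contr_last_map_incl (x : Ext 8) :
    contr (vec eLast) (ExteriorAlgebra.map incl x) = 0 := by
  induction x using ext_induction with
  | h1 => simp [contr_vec_one]
  | hadd x y hx hy => simp only [map_add, hx, hy, add_zero]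
  | hs c x hx => simp only [map_smul, hx, smul_zero]
  | hm v x hx =>
    rw [map_mul, ExteriorAlgebra.map_apply_ι, contr_vec_mul, hx, single_one_dotProduct, incl_last]
    simp

theorem der_gradingElement {x : Ext 9} (hx : x ∈ ⋀[ℂ]^3 (Vec 9)) :
    der (E8.mat gradingElement) x = x - (3 : ℂ) • lastPart x := by
  rw [gradingElement, E8.mat_ofMat, der_sub, der_smul, der_smul, der_id hx, der_single, lastPart]
  norm_num [smul_smul]

theorem gradingElement_transpose : (E8.mat gradingElement)ᵀ = E8.mat gradingElement := by
  rw [gradingElement, E8.mat_ofMat]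
  simp [Matrix.transpose_sub, Matrix.transpose_smul]

theorem mat_lie_gradingElement (x : E8) (i j : Fin 9) :
    E8.mat ⁅gradingElement, x⁆ i j
      = ((if j = 8 then 3 else 0) - (if i = 8 then 3 else 0)) * E8.mat x i j := by
  rw [E8.mat_lie]
  simp only [gradingElement, E8.tri_ofMat, E8.cotri_ofMat, E8.mat_ofMat]
  have h1 : moment0 0 (E8.cotri x) = 0 := by
    simpa using E8.moment0_smul_left 0 0 (E8.cotri x)
  have h2 : moment0 (E8.tri x) 0 = 0 := by
    simpa using E8.moment0_smul_right 0 (E8.tri x) 0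
  rw [h1, h2]
  by_cases hi : i = 8 <;> by_cases hj : j = 8 <;>
    simp [sub_mul, mul_sub, hi, hj] <;> ring


theorem tri_lie_gradingElement (x : E8) :
    E8.tri ⁅gradingElement, x⁆ = E8.tri x - (3 : ℂ) • lastPart (E8.tri x) := by
  rw [E8.tri_lie, der_gradingElement (E8.tri_mem x)]
  simp [gradingElement, star3]

theorem cotri_lie_gradingElement (x : E8) :
    E8.cotri ⁅gradingElement, x⁆ = (3 : ℂ) • lastPart (E8.cotri x) - E8.cotri x := by
  rw [E8.cotri_lie, gradingElement_transpose, der_gradingElement (E8.cotri_mem x)]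
  simp [gradingElement, star3]

theorem mem_grade_iff {k : ℤ} {x : E8} : x ∈ grade k ↔
    (∀ i j, ((if j = 8 then 3 else 0) - (if i = 8 then 3 else 0))
      * E8.mat x i j = (k : ℂ) * E8.mat x i j) ∧
    E8.tri x - (3 : ℂ) • lastPart (E8.tri x) = (k : ℂ) • E8.tri x ∧
    (3 : ℂ) • lastPart (E8.cotri x) - E8.cotri x = (k : ℂ) • E8.cotri x := by
  rw [mem_grade]
  constructor
  · intro h
    refine ⟨fun i j => ?_, ?_, ?_⟩
    · rw [← mat_lie_gradingElement, h]; simp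
    · rw [← tri_lie_gradingElement, h, map_smul]
    · rw [← cotri_lie_gradingElement, h, map_smul]
  · rintro ⟨h1, h2, h3⟩
    apply E8.ext
    · ext i j; rw [mat_lie_gradingElement, h1]; simp
    · rw [tri_lie_gradingElement, h2, map_smul]
    · rw [cotri_lie_gradingElement, h3, map_smul]

/-- The coordinate of `x` in the degree `3` piece `V₈`. -/
def coord3 : E8 →ₗ[ℂ] Vec 8 :=
  proj ∘ₗ LinearMap.proj 8 ∘ₗ (Matrix.transposeLinearEquiv (Fin 9) (Fin 9) ℂ ℂ).toLinearMap
    ∘ₗ E8.mat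

/-- The coordinate of `x` in the degree `2` piece `∧² V₈^∨`. -/
def coord2 : E8 →ₗ[ℂ] ⋀[ℂ]^2 (Vec 8) :=
  exteriorPower.map 2 proj ∘ₗ contrLast ∘ₗ LinearMap.snd ℂ _ _ ∘ₗ LinearMap.snd ℂ (Sl 9) _

theorem coord3_apply (x : E8) (i : Fin 8) : coord3 x i = E8.mat x i.castSucc 8 := rfl

theorem map_incl_map_proj {k : ℕ} (u : ⋀[ℂ]^k (Vec 9)) (hu : lastPart (u : Ext 9) = 0) :
    exteriorPower.map k incl (exteriorPower.map k proj u) = u := by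
  apply Subtype.ext
  rw [← LinearMap.comp_apply, ← exteriorPower.map_comp, coe_map, map_incl_proj, hu, sub_zero]

theorem wedgeLast_contrLast (w : ⋀[ℂ]^3 (Vec 9)) (hw : lastPart (w : Ext 9) = w) :
    wedgeLast (exteriorPower.map 2 incl (exteriorPower.map 2 proj (contrLast w))) = w := by
  rw [map_incl_map_proj]
  · apply Subtype.ext
    change contr (vec eLast) (w : Ext 9) * vec eLast = w
    have := vec_mul_mem eLast (contr_vec_mem eLast w.2)
    norm_num at this
    rw [← this]
    exact hw
  · change vec eLast * contr (vec eLast) (contr (vec eLast) (w : Ext 9)) = 0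
    rw [← contr_mul, ExteriorAlgebra.ι_sq_zero, map_zero, LinearMap.zero_apply, mul_zero]

theorem lastPart_map_incl (x : Ext 8) : lastPart (ExteriorAlgebra.map incl x) = 0 := by
  rw [lastPart, contr_last_map_incl, mul_zero]

theorem lastPart_wedgeLast (x : ⋀[ℂ]^2 (Vec 8)) :
    lastPart (wedgeLast (exteriorPower.map 2 incl x) : Ext 9)
      = wedgeLast (exteriorPower.map 2 incl x) := by
  change vec eLast * contr (vec eLast) ((exteriorPower.map 2 incl x : Ext 9) * vec eLast)
    = (exteriorPower.map 2 incl x : Ext 9) * vec eLast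
  have := vec_mul_mem eLast (exteriorPower.map 2 incl x).2
  norm_num at this
  rw [← this, contr_vec_mul, coe_map, contr_last_map_incl]
  simp [eLast]

/-- Eigenvectors, componentwise. -/
theorem mem_grade_iff' {k : ℤ} {x : E8} : x ∈ grade k ↔
    (∀ i j, ((if j = 8 then 3 else 0) - (if i = 8 then 3 else 0) - (k : ℂ)) * E8.mat x i j = 0) ∧
    lastPart (E8.tri x) = ((1 - k : ℂ) / 3) • E8.tri x ∧
    lastPart (E8.cotri x) = ((1 + k : ℂ) / 3) • E8.cotri x := by
  rw [mem_grade_iff]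
  refine and_congr (forall_congr' fun i => forall_congr' fun j => ?_) (and_congr ?_ ?_)
  · rw [sub_mul _ (k : ℂ), sub_eq_zero]
  · constructor <;> intro h
    · linear_combination (norm := module) (-1 / 3 : ℂ) • h
    · linear_combination (norm := module) (-3 : ℂ) • h
  · constructor <;> intro h
    · linear_combination (norm := module) (1 / 3 : ℂ) • h
    · linear_combination (norm := module) (3 : ℂ) • h

theorem mat_g3_coord3 {x : E8} (h1 : ∀ i j, ((if j = 8 then 3 else 0) - (if i = 8 then 3 else 0)
    - ((3 : ℤ) : ℂ)) * E8.mat x i j = 0) (i j : Fin 9) :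
    E8.mat (g3 (coord3 x)) i j = E8.mat x i j := by
  have h := h1 i j
  have hg : E8.mat (g3 (coord3 x)) i j = incl (coord3 x) i * eLast j := rfl
  rw [hg]
  by_cases hj : j = 8
  · subst hj
    by_cases hi : i = 8
    · subst hi
      have : E8.mat x 8 8 = 0 := by simpa using h
      simp [incl_last, this]
    · obtain ⟨i, rfl⟩ : ∃ k : Fin 8, i = k.castSucc :=
        ⟨i.castPred (by simpa using hi), by simp⟩
      rw [incl_castSucc, coord3_apply]; simp
  · have hc : ((if j = 8 then 3 else 0) - (if i = 8 then 3 else 0) - ((3 : ℤ) : ℂ)) ≠ 0 := by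
      by_cases hi : i = 8 <;> simp [hi, hj]; norm_num
    rw [(mul_eq_zero.mp h).resolve_left hc]
    simp [hj]

theorem range_g3 : LinearMap.range g3 = grade 3 := by
  apply le_antisymm
  · rintro _ ⟨v, rfl⟩
    rw [mem_grade_iff']
    refine ⟨fun i j => ?_, by simp [g3, lastPart], by simp [g3, lastPart]⟩
    by_cases hi : i = 8 <;> by_cases hj : j = 8 <;>
      simp [g3, hi, hj, Matrix.vecMulVec_apply, incl_last]
  · intro x hx
    obtain ⟨h1, h2, h3⟩ := mem_grade_iff'.mp hx
    refine ⟨coord3 x, E8.ext ?_ ?_ ?_⟩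
    · ext i j
      exact (mat_g3_coord3 h1 i j)
    · exact (lastPart_eq_zero h2 (by norm_num) (by norm_num)).symm
    · exact (lastPart_eq_zero h3 (by norm_num) (by norm_num)).symm

theorem range_g2 : LinearMap.range g2 = grade 2 := by
  apply le_antisymm
  · rintro _ ⟨v, rfl⟩
    rw [mem_grade_iff']
    refine ⟨fun i j => ?_, ?_, ?_⟩
    · simp [g2]
    · simp [g2, lastPart]
    · simp only [g2, LinearMap.comp_apply, E8.cotri_ofCotri]
      rw [lastPart_wedgeLast]; norm_num
  · intro x hx
    obtain ⟨h1, h2, h3⟩ := mem_grade_iff'.mp hx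
    refine ⟨coord2 x, E8.ext ?_ ?_ ?_⟩
    · ext i j
      have h := h1 i j
      have hc : ((if j = 8 then 3 else 0) - (if i = 8 then 3 else 0) - ((2 : ℤ) : ℂ)) ≠ 0 := by
        by_cases hi : i = 8 <;> by_cases hj : j = 8 <;> simp [hi, hj] <;> norm_num
      simpa [g2] using ((mul_eq_zero.mp h).resolve_left hc).symm
    · exact (lastPart_eq_zero h2 (by norm_num) (by norm_num)).symm
    · exact congrArg Subtype.val (wedgeLast_contrLast x.2.2 (h3.trans (by norm_num; rfl)))


theorem g1_mem (z : ⋀[ℂ]^3 (Vec 8)) : g1 z ∈ grade 1 := by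
  rw [mem_grade_iff']
  refine ⟨fun i j => by simp [g1], ?_, by simp [g1, lastPart]⟩
  simp only [g1, LinearMap.comp_apply, E8.tri_ofTri, coe_map, lastPart_map_incl]
  norm_num

theorem gNeg2_mem (x : ⋀[ℂ]^2 (Vec 8)) : gNeg2 x ∈ grade (-2) := by
  rw [mem_grade_iff']
  refine ⟨fun i j => by simp [gNeg2], ?_, by simp [gNeg2, lastPart]⟩
  simp only [gNeg2, LinearMap.comp_apply, E8.tri_ofTri]
  rw [lastPart_wedgeLast]; norm_num

theorem gNeg3_mem (φ : Vec 8) : gNeg3 φ ∈ grade (-3) := by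
  rw [mem_grade_iff']
  refine ⟨fun i j => ?_, by simp [gNeg3, lastPart], by simp [gNeg3, lastPart]⟩
  by_cases hi : i = 8 <;> by_cases hj : j = 8 <;>
    simp [gNeg3, hi, hj, Matrix.vecMulVec_apply, incl_last]

theorem coord3_g3 (v : Vec 8) : coord3 (g3 v) = v := by
  ext i
  rw [coord3_apply]
  change incl v i.castSucc * eLast 8 = v i
  rw [incl_castSucc]; simp

theorem coord2_g2 (y : ⋀[ℂ]^2 (Vec 8)) : coord2 (g2 y) = y := by
  have h : proj ∘ₗ incl = LinearMap.id := LinearMap.ext proj_incl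
  have h2 : contrLast (wedgeLast (exteriorPower.map 2 incl y)) = exteriorPower.map 2 incl y := by
    apply Subtype.ext
    change contr (vec eLast) ((exteriorPower.map 2 incl y : Ext 9) * vec eLast)
      = (exteriorPower.map 2 incl y : Ext 9)
    have := vec_mul_mem eLast (exteriorPower.map 2 incl y).2
    norm_num at this
    rw [← this, contr_vec_mul, coe_map, contr_last_map_incl]
    simp [eLast]
  change exteriorPower.map 2 proj (contrLast (wedgeLast (exteriorPower.map 2 incl y))) = y
  rw [h2, ← LinearMap.comp_apply, ← exteriorPower.map_comp, h, exteriorPower.map_id]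
  rfl

theorem mat_eq_zero {k : ℤ} (hk : k ≠ 3) (hk0 : k ≠ 0) (hk3 : k ≠ -3) {x : E8} (hx : x ∈ grade k) :
    E8.mat x = 0 := by
  ext i j
  have h := (mem_grade_iff'.mp hx).1 i j
  have h3 : (k : ℂ) ≠ 3 := by exact_mod_cast hk
  have h0 : (k : ℂ) ≠ 0 := by exact_mod_cast hk0
  have hm3 : (k : ℂ) ≠ -3 := by exact_mod_cast hk3
  refine (mul_eq_zero.mp h).resolve_left ?_
  by_cases hi : i = 8 <;> by_cases hj : j = 8 <;> simp [hi, hj, h0, sub_eq_zero, h3.symm, hm3.symm]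

theorem range_g1 : LinearMap.range g1 = grade 1 := by
  apply le_antisymm
  · rintro _ ⟨z, rfl⟩
    exact g1_mem z
  · intro x hx
    obtain ⟨h1, h2, h3⟩ := mem_grade_iff'.mp hx
    refine ⟨exteriorPower.map 3 proj x.2.1, E8.ext ?_ ?_ ?_⟩
    · rw [mat_eq_zero (by norm_num) (by norm_num) (by norm_num) hx]; rfl
    · exact congrArg Subtype.val (map_incl_map_proj x.2.1 (h2.trans (by simp)))
    · exact (lastPart_eq_zero h3 (by norm_num) (by norm_num)).symm

theorem range_gNeg1 : LinearMap.range gNeg1 = grade (-1) := by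
  apply le_antisymm
  · rintro _ ⟨z, rfl⟩
    rw [mem_grade_iff']
    refine ⟨fun i j => by simp [gNeg1], by simp [gNeg1, lastPart], ?_⟩
    simp only [gNeg1, LinearMap.comp_apply, E8.cotri_ofCotri, coe_map, lastPart_map_incl]
    norm_num
  · intro x hx
    obtain ⟨h1, h2, h3⟩ := mem_grade_iff'.mp hx
    refine ⟨exteriorPower.map 3 proj x.2.2, E8.ext ?_ ?_ ?_⟩
    · rw [mat_eq_zero (by norm_num) (by norm_num) (by norm_num) hx]; rfl
    · exact (lastPart_eq_zero h2 (by norm_num) (by norm_num)).symm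
    · exact congrArg Subtype.val (map_incl_map_proj x.2.2 (h3.trans (by simp)))

theorem range_gNeg2 : LinearMap.range gNeg2 = grade (-2) := by
  apply le_antisymm
  · rintro _ ⟨z, rfl⟩
    exact gNeg2_mem z
  · intro x hx
    obtain ⟨h1, h2, h3⟩ := mem_grade_iff'.mp hx
    refine ⟨exteriorPower.map 2 proj (contrLast x.2.1), E8.ext ?_ ?_ ?_⟩
    · rw [mat_eq_zero (by norm_num) (by norm_num) (by norm_num) hx]; rfl
    · exact congrArg Subtype.val (wedgeLast_contrLast x.2.1 (h2.trans (by norm_num; rfl)))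
    · exact (lastPart_eq_zero h3 (by norm_num) (by norm_num)).symm

theorem range_gNeg3 : LinearMap.range gNeg3 = grade (-3) := by
  apply le_antisymm
  · rintro _ ⟨φ, rfl⟩
    exact gNeg3_mem φ
  · intro x hx
    obtain ⟨h1, h2, h3⟩ := mem_grade_iff'.mp hx
    refine ⟨proj (E8.mat x 8), E8.ext ?_ ?_ ?_⟩
    · ext i j
      have h := h1 i j
      have hg : E8.mat (gNeg3 (proj (E8.mat x 8))) i j
        = (eLast : Vec 9) i * incl (proj (E8.mat x 8)) j := rfl
      rw [hg, incl_proj]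
      by_cases hi : i = 8
      · subst hi
        by_cases hj : j = 8
        · subst hj
          have : E8.mat x 8 8 = 0 := by simpa using h
          simp [this]
        · simp [hj]
      · have hc : ((if j = 8 then 3 else 0) - (if i = 8 then 3 else 0) - ((-3 : ℤ) : ℂ)) ≠ 0 := by
          by_cases hj : j = 8 <;> simp [hi, hj]
        rw [(mul_eq_zero.mp h).resolve_left hc]
        simp [hi]
    · exact (lastPart_eq_zero h2 (by norm_num) (by norm_num)).symm
    · exact (lastPart_eq_zero h3 (by norm_num) (by norm_num)).symm

theorem range_g0 : LinearMap.range g0 = grade 0 := by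
  have hm : ∀ (A : Matrix (Fin 8) (Fin 8) ℂ) (i j : Fin 9), E8.mat (g0 A) i j
      = incl (A *ᵥ proj (e j)) i - A.trace * Matrix.single 8 8 1 i j := fun A i j => rfl
  have hp : proj (e 8) = 0 := by
    ext k
    have : (8 : Fin 9) ≠ k.castSucc := (Fin.castSucc_lt_last k).ne'
    simp [proj_apply, this.symm]
  have hs : ∀ i j : Fin 9, ¬ (i = 8 ∧ j = 8) → Matrix.single 8 8 (1 : ℂ) i j = 0 := by
    intro i j h
    rw [Matrix.single_apply, if_neg]
    rintro ⟨rfl, rfl⟩; exact h ⟨rfl, rfl⟩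
  apply le_antisymm
  · rintro _ ⟨A, rfl⟩
    rw [mem_grade_iff']
    refine ⟨fun i j => ?_, by simp [g0, lastPart], by simp [g0, lastPart]⟩
    rw [hm]
    by_cases hi : i = 8 <;> by_cases hj : j = 8 <;>
      simp [hi, hj, incl_last, hp, hs]
  · intro x hx
    obtain ⟨h1, h2, h3⟩ := mem_grade_iff'.mp hx
    refine ⟨(E8.mat x).submatrix Fin.castSucc Fin.castSucc, E8.ext ?_ ?_ ?_⟩
    · ext i j
      rw [hm]
      have h := h1 i j
      have ht : ((E8.mat x).submatrix Fin.castSucc Fin.castSucc).trace = - E8.mat x 8 8 := by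
        have := E8.trace_mat x
        rw [Matrix.trace, Fin.sum_univ_castSucc] at this
        exact eq_neg_of_add_eq_zero_left this
      rw [ht]
      by_cases hi : i = 8 <;> by_cases hj : j = 8
      · subst hi hj; simp [incl_last]
      · simp only [hi, hj, if_true, if_false] at h
        have h0 : E8.mat x 8 j = 0 := by simpa using h
        rw [hs i j (fun h => hj h.2), hi, h0]; simp [incl_last]
      · simp only [hi, hj, if_true, if_false] at h
        have h0 : E8.mat x i 8 = 0 := by simpa using h
        rw [hs i j (fun h => hi h.1), hj, h0, hp]; simp
      · rw [hs i j (fun h => hi h.1)]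
        obtain ⟨i, rfl⟩ : ∃ k : Fin 8, i = k.castSucc :=
          ⟨i.castPred (by simpa using hi), by simp⟩
        obtain ⟨j, rfl⟩ : ∃ k : Fin 8, j = k.castSucc :=
          ⟨j.castPred (by simpa using hj), by simp⟩
        have : proj (e j.castSucc) = e j := by
          ext k; simp [proj_apply, Pi.single_apply]
        rw [incl_castSucc, this]; simp
    · exact (lastPart_eq_zero h2 (by norm_num) (by norm_num)).symm
    · exact (lastPart_eq_zero h3 (by norm_num) (by norm_num)).symm

/-- The map `P(z) : ∧² V₈ → ∧² V₈^∨`, quartic in `z`: the restriction of `ad(z)⁴` to the degree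
`-2` piece, with values in the degree `2` piece. -/
def PMap (z : ⋀[ℂ]^3 (Vec 8)) : ⋀[ℂ]^2 (Vec 8) →ₗ[ℂ] ⋀[ℂ]^2 (Vec 8) :=
  coord2 ∘ₗ ((LieAlgebra.ad ℂ E8 (g1 z)) ^ 4) ∘ₗ gNeg2

/-- The map `Q(z) : V₈^∨ → V₈`, sextic in `z`: the restriction of `ad(z)⁶` to the degree
`-3` piece, with values in the degree `3` piece. -/
def QMap (z : ⋀[ℂ]^3 (Vec 8)) : Vec 8 →ₗ[ℂ] Vec 8 :=
  coord3 ∘ₗ ((LieAlgebra.ad ℂ E8 (g1 z)) ^ 6) ∘ₗ gNeg3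

/-- `P(z)` is `ad(z)⁴ : g₋₂ → g₂`; taking the coordinate loses nothing. -/
theorem g2_PMap (z : ⋀[ℂ]^3 (Vec 8)) (x : ⋀[ℂ]^2 (Vec 8)) :
    g2 (PMap z x) = ((LieAlgebra.ad ℂ E8 (g1 z)) ^ 4) (gNeg2 x) := by
  have h : ((LieAlgebra.ad ℂ E8 (g1 z)) ^ 4) (gNeg2 x) ∈ grade 2 := by
    simpa using ad_pow_mem_grade (g1_mem z) (gNeg2_mem x) 4
  rw [← range_g2] at h
  obtain ⟨y, hy⟩ := h
  rw [PMap, LinearMap.comp_apply, LinearMap.comp_apply, ← hy, coord2_g2]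

/-- `Q(z)` is `ad(z)⁶ : g₋₃ → g₃`; taking the coordinate loses nothing. -/
theorem g3_QMap (z : ⋀[ℂ]^3 (Vec 8)) (φ : Vec 8) :
    g3 (QMap z φ) = ((LieAlgebra.ad ℂ E8 (g1 z)) ^ 6) (gNeg3 φ) := by
  have h : ((LieAlgebra.ad ℂ E8 (g1 z)) ^ 6) (gNeg3 φ) ∈ grade 3 := by
    simpa using ad_pow_mem_grade (g1_mem z) (gNeg3_mem φ) 6
  rw [← range_g3] at h
  obtain ⟨y, hy⟩ := h
  rw [QMap, LinearMap.comp_apply, LinearMap.comp_apply, ← hy, coord3_g3]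

open scoped TensorProduct

/-- The contraction `∧² V₈^∨ ⊗ V₈ → V₈^∨`, `y ⊗ w ↦ w ⌋ y = y(w, ·)`. -/
def contraction : ⋀[ℂ]^2 (Vec 8) ⊗[ℂ] Vec 8 →ₗ[ℂ] Vec 8 :=
  TensorProduct.lift
    ((LinearMap.compr₂ (contr.toLinearMap ∘ₗ vec) ExteriorAlgebra.ιInv).flip
      ∘ₗ (⋀[ℂ]^2 (Vec 8)).subtype)

/-- `v ↦ a ∧ v`, from `V₈` to `∧² V₈`. -/
def wedgeBy (a : Vec 8) : Vec 8 →ₗ[ℂ] ⋀[ℂ]^2 (Vec 8) :=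
  (LinearMap.mulLeft ℂ (vec a) ∘ₗ vec).codRestrict _ fun v => mul_mem (vec_mem a) (vec_mem v)

/-- The dual `V₈ → ∧² V₈ ⊗ V₈^∨` of the contraction, `v ↦ ∑ₐ (eₐ ∧ v) ⊗ eₐ^∨`. -/
def cocontraction : Vec 8 →ₗ[ℂ] ⋀[ℂ]^2 (Vec 8) ⊗[ℂ] Vec 8 :=
  ∑ a : Fin 8, (TensorProduct.mk ℂ (⋀[ℂ]^2 (Vec 8)) (Vec 8)).flip (e a) ∘ₗ wedgeBy (e a)

/-- The map `R(z) : V₈ → V₈^∨`, of degree `10` in `z`: the composition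
`V₈ → ∧² V₈ ⊗ V₈^∨ → ∧² V₈^∨ ⊗ V₈ → V₈^∨` of the dual of the contraction, of `P(z) ⊗ Q(z)`, and of
the contraction. -/
def RMap (z : ⋀[ℂ]^3 (Vec 8)) : Vec 8 →ₗ[ℂ] Vec 8 :=
  contraction ∘ₗ TensorProduct.map (PMap z) (QMap z) ∘ₗ cocontraction

theorem contraction_tmul (y : ⋀[ℂ]^2 (Vec 8)) (w : Vec 8) :
    vec (contraction (y ⊗ₜ w)) = contr (vec w) (y : Ext 8) := by
  have h : contraction (y ⊗ₜ w) = ExteriorAlgebra.ιInv (contr (vec w) (y : Ext 8)) := rfl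
  obtain ⟨v, hv⟩ := vec_rep (contr_vec_mem w y.2)
  rw [h, hv]
  congr 1
  exact ExteriorAlgebra.ι_leftInverse v

theorem RMap_apply (z : ⋀[ℂ]^3 (Vec 8)) (v : Vec 8) :
    vec (RMap z v) = ∑ a, contr (vec (QMap z (e a))) (PMap z (wedgeBy (e a) v) : Ext 8) := by
  simp [RMap, cocontraction, contraction_tmul]

/-- The contraction and `cocontraction` are dual to each other: `⟨y(w, ·), v⟩ = ⟨y ⊗ w, c(v)⟩`,
where `⟨y, a ∧ v⟩ = v ⌋ (a ⌋ y)`. -/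
theorem contraction_dual (y : ⋀[ℂ]^2 (Vec 8)) (w v : Vec 8) :
    algebraMap ℂ (Ext 8) (v ⬝ᵥ contraction (y ⊗ₜ w))
      = ∑ a, (w ⬝ᵥ e a) • contr (vec v) (contr (vec (e a)) (y : Ext 8)) := by
  rw [← contr_vec_vec, contraction_tmul]
  have : ∑ a, (w ⬝ᵥ e a) • contr (vec v) (contr (vec (e a)) (y : Ext 8))
      = contr (vec v) (contr (vec (∑ a, w a • e a)) (y : Ext 8)) := by
    simp [map_sum]
  rw [this, sum_e]

/-- The matrix of `Q(z) : V₈^∨ → V₈` in the dual and the standard basis; `Q(z)` is symmetric as a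
morphism when this matrix is. -/
def Q (z : ⋀[ℂ]^3 (Vec 8)) : Matrix (Fin 8) (Fin 8) ℂ := LinearMap.toMatrix' (QMap z)

/-- The matrix of `R(z) : V₈ → V₈^∨` in the standard and the dual basis. -/
def R (z : ⋀[ℂ]^3 (Vec 8)) : Matrix (Fin 8) (Fin 8) ℂ := LinearMap.toMatrix' (RMap z)

/-- `f` is a homogeneous polynomial of degree `d` in the coordinates of `∧³ V₈` in the standard
basis `eᵢ ∧ eⱼ ∧ eₖ`, `i < j < k`. -/
def IsForm (d : ℕ) (f : ⋀[ℂ]^3 (Vec 8) → ℂ) : Prop :=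
  ∃ p : MvPolynomial (Set.powersetCard (Fin 8) 3) ℂ, p.IsHomogeneous d ∧
    ∀ z, f z = MvPolynomial.eval (fun s => ((Pi.basisFun ℂ (Fin 8)).exteriorPower 3).repr z s) p

/-- `J` is an `SL(V₈)`-invariant homogeneous polynomial of degree `d` on `∧³ V₈`. -/
def IsInvariantForm (d : ℕ) (J : ⋀[ℂ]^3 (Vec 8) → ℂ) : Prop :=
  IsForm d J ∧ ∀ (g : Matrix.SpecialLinearGroup (Fin 8) ℂ) (z : ⋀[ℂ]^3 (Vec 8)),
    J (exteriorPower.map 3 (Matrix.toLin' (g : Matrix (Fin 8) (Fin 8) ℂ)) z) = J z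

/-- `(A, B)` is a matrix factorization of the polynomial `W` on `∧³ V₈`: the entries of the square
matrices `A` and `B` are homogeneous polynomials of degrees `a` and `b`, and
`A B = B A = W · 1`. -/
structure IsMatrixFactorization {N : ℕ} (a b : ℕ) (W : ⋀[ℂ]^3 (Vec 8) → ℂ)
    (A B : ⋀[ℂ]^3 (Vec 8) → Matrix (Fin N) (Fin N) ℂ) : Prop where
  left_form : ∀ i j, IsForm a fun z => A z i j
  right_form : ∀ i j, IsForm b fun z => B z i j
  mul_eq : ∀ z, A z * B z = W z • (1 : Matrix (Fin N) (Fin N) ℂ)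
  mul_eq_symm : ∀ z, B z * A z = W z • (1 : Matrix (Fin N) (Fin N) ℂ)

end E8Model

end

noncomputable section
namespace E8Model
open scoped Matrix TensorProduct

/-! ### Explicit formulas for `P` and `Q` in the exterior algebra of `V₈` -/

/-! The proof rests on the dense orbit of `GL(V₈)` in `∧³V₈`. All the assertions are polynomial
identities compatible with the group action, so they hold everywhere as soon as they hold at one
point of that orbit.

Unwinding the brackets of the model gives formulas inside `∧V₈`. For a two-vector `x`, put `w = (z ∧
x) ⌋ vol`, and let the matrix `moment z w` act on `z` as a derivation. Wedging the result with `z`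
and contracting into `vol` gives `P(z) x` up to sign (`PMap_eq`). Then `Q(z) φ = -P(z)(φ ⌋ z) ⌋ z`
(`QMap_eq`). These formulas show the degrees in `z`. They also show the equivariance: everything is
natural except `vol`, which scales by the determinant. As `vol` occurs twice in `P`, once `P` in
`Q`, and `P` and `Q` once each in `R`, this gives `Q(gz) = det(g)² g Q(z) gᵀ` and `R(gz) = det(g)⁴
g⁻ᵀ R(z) g⁻¹` (`Q_map`, `R_map`). Hence symmetry is preserved along orbits, and `Q R` is conjugated
by `g` and multiplied by `det(g)⁶`.

The base point is the invariant three-form of `sl₃`. Conceptually, its isotropy contains `SL₃`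
acting on `V₈ = sl₃` by the irreducible adjoint representation, so `Q` and `R` must be multiples of
the inverse Killing form and of the Killing form, and their product must be a scalar. The proof uses
a direct computation instead: integer arithmetic on lists of monomials, with a proof that it
computes correctly in the exterior algebra, gives both matrices, and `Q R = 9000`
(`Q_mul_R_generic`).

The orbit is open near the base point because `A ↦ A z` maps `gl₈` onto `∧³V₈`
(`exists_der_generic`, from an explicit table), so that the orbit map is a submersion at the
identity. A polynomial that vanishes on the orbit vanishes on a polydisc, hence is zero
(`IsForm.eq_zero`).

For uniqueness, write `g = t s` with `det s = 1` and `t⁸ = det g`. An invariant form of degree `d`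
is multiplied by `t^(3d)` under `g`, so it is determined by its value at the base point. -/

theorem incl_dotProduct_incl (v w : Vec 8) : incl v ⬝ᵥ incl w = v ⬝ᵥ w := by
  simp only [dotProduct]
  rw [Fin.sum_univ_castSucc]
  simp only [incl_castSucc]
  simp [show Fin.last 8 = (8 : Fin 9) from rfl, incl_last]

/-- Contraction depends only on the dot product, which `incl` preserves. -/
theorem contr_map_incl (η x : Ext 8) :
    contr (ExteriorAlgebra.map incl η) (ExteriorAlgebra.map incl x)
      = ExteriorAlgebra.map incl (contr η x) := by
  have hv : ∀ (φ : Vec 8) (x : Ext 8), contr (vec (incl φ)) (ExteriorAlgebra.map incl x)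
      = ExteriorAlgebra.map incl (contr (vec φ) x) := by
    intro φ x
    induction x using ext_induction with
    | h1 => simp [contr_vec_one]
    | hadd x y hx hy => simp only [map_add, hx, hy]
    | hs c x hx => simp only [map_smul, hx]
    | hm v x hx =>
      rw [map_mul, ExteriorAlgebra.map_apply_ι, contr_vec_mul, hx, contr_vec_mul,
        incl_dotProduct_incl, map_sub, map_mul, map_smul, ExteriorAlgebra.map_apply_ι]
  induction η using ext_induction generalizing x with
  | h1 => simp
  | hadd y z hy hz => simp only [map_add, LinearMap.add_apply, hy, hz]
  | hs c y hy => simp only [map_smul, LinearMap.smul_apply, hy]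
  | hm v y hy => rw [map_mul, ExteriorAlgebra.map_apply_ι, contr_mul, contr_mul, hy, hv]

/-- Forms on `V₈` vanish on `e₉`, so contraction by them leaves a right factor `e₉` alone. -/
theorem contr_map_incl_mul_last (η x : Ext 8) :
    contr (ExteriorAlgebra.map incl η) (ExteriorAlgebra.map incl x * vec eLast)
      = ExteriorAlgebra.map incl (contr η x) * vec eLast := by
  induction η using ext_induction generalizing x with
  | h1 => simp
  | hadd y z hy hz => simp only [map_add, LinearMap.add_apply, hy, hz, add_mul]
  | hs c y hy => simp only [map_smul, LinearMap.smul_apply, hy, smul_mul_assoc]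
  | hm v y hy =>
    have h0 : (incl v : Vec 9) ⬝ᵥ eLast = 0 := by simp [eLast, incl_last]
    rw [map_mul (ExteriorAlgebra.map incl), ExteriorAlgebra.map_apply_ι, contr_mul, contr_mul, hy,
      contr_vec_prod, contr_vec_vec, h0, map_zero, mul_zero, add_zero]
    rw [← ExteriorAlgebra.map_apply_ι incl v, contr_map_incl]

theorem mem_map_incl {k : ℕ} {x : Ext 8} (hx : x ∈ ⋀[ℂ]^k (Vec 8)) :
    ExteriorAlgebra.map incl x ∈ ⋀[ℂ]^k (Vec 9) := by
  have := (exteriorPower.map k incl ⟨x, hx⟩).2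
  rwa [coe_map] at this

theorem contr_last_map_incl_mul {k : ℕ} {x : Ext 8} (hx : x ∈ ⋀[ℂ]^k (Vec 8)) :
    contr (vec eLast) (ExteriorAlgebra.map incl x * vec eLast)
      = (-1 : ℂ) ^ k • ExteriorAlgebra.map incl x := by
  rw [contr_vec_prod, contr_last_map_incl, zero_mul, zero_add, contr_vec_vec, involute_mem (mem_map_incl hx)]
  simp [eLast]

/-- With the contraction rules above, this turns each `star3` of `V₉` into a contraction with the
volume element of `V₈`. -/
theorem vol_nine : vol 9 = ExteriorAlgebra.map incl (vol 8) * vec eLast := by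
  rw [vol, vol, ExteriorAlgebra.map_apply_ιMulti, ExteriorAlgebra.ιMulti_apply,
    ExteriorAlgebra.ιMulti_apply, List.ofFn_succ', List.concat_eq_append, List.prod_append]
  congr 1
  · congr 2
    funext i
    congr 1
    ext j
    simp only [Function.comp, incl_apply]
    by_cases h : (j : ℕ) < 8
    · simp [h, Pi.single_apply, Fin.ext_iff]
    · simp only [h, dif_neg, not_false_eq_true, Pi.single_apply]
      rw [if_neg]
      rintro rfl
      exact h i.2
  · simp only [List.prod_cons, List.prod_nil, mul_one]; rfl

theorem incl_e (i : Fin 8) : incl (e i) = e i.castSucc := by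
  ext j
  simp only [incl_apply]
  by_cases h : (j : ℕ) < 8
  · simp [h, Pi.single_apply, Fin.ext_iff]
  · simp only [h, dif_neg, not_false_eq_true, Pi.single_apply]
    rw [if_neg]
    rintro rfl
    exact h i.2

/-- In the sum over a basis of `V₉`, the ninth term drops out because contraction by `e₉` kills
`∧V₈`. -/
theorem der_moment_map_incl {u v w : Ext 8} (hv : v ∈ ⋀[ℂ]^3 (Vec 8))
    (hw : w ∈ ⋀[ℂ]^3 (Vec 8)) :
    der (moment (ExteriorAlgebra.map incl v) (ExteriorAlgebra.map incl w))
        (ExteriorAlgebra.map incl u)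
      = ExteriorAlgebra.map incl (der (moment v w) u) := by
  rw [der_moment (mem_map_incl hv) (mem_map_incl hw), der_moment hv hw, Fin.sum_univ_castSucc, map_sum]
  have hl : (e (Fin.last 8) : Vec 9) = eLast := rfl
  rw [hl, contr_last_map_incl, contr_last_map_incl, mul_zero, add_zero]
  refine Finset.sum_congr rfl fun i _ => ?_
  rw [map_mul, ← incl_e, ← ExteriorAlgebra.map_apply_ι incl, contr_map_incl, contr_map_incl,
    contr_map_incl]

/-- The three-form `(z ∧ x) ⌋ vol` on `V₈`, for a two-vector `x`. -/
def coTri (z x : Ext 8) : Ext 8 := contr (z * x) (vol 8)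

/-- The quartic operator `x ↦ P(z) x`, on the exterior algebra of `V₈`. -/
def quartic (z x : Ext 8) : Ext 8 := - contr (z * der (moment z (coTri z x)) z) (vol 8)

theorem coTri_mem {z x : Ext 8} (hz : z ∈ ⋀[ℂ]^3 (Vec 8)) (hx : x ∈ ⋀[ℂ]^2 (Vec 8)) :
    coTri z x ∈ ⋀[ℂ]^3 (Vec 8) :=
  contr_mem (k := 3) (mul_mem hz hx) (vol_mem 8)

theorem quartic_mem {z x : Ext 8} (hz : z ∈ ⋀[ℂ]^3 (Vec 8)) :
    quartic z x ∈ ⋀[ℂ]^2 (Vec 8) :=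
  neg_mem (contr_mem (k := 2) (mul_mem hz (der_mem _ hz)) (vol_mem 8))

/-- The reason is `z ∧ z = 0`, the degree of `z` being odd. It removes the scalar correction that
distinguishes `moment0` from `moment`, which is why `quartic` can be written with `moment`. -/
theorem pairing_coTri {z x : Ext 8} (hz : z ∈ ⋀[ℂ]^3 (Vec 8)) : pairing z (coTri z x) = 0 := by
  rw [pairing_apply, coTri, ← contr_mul, ← mul_assoc, tri_sq hz, zero_mul, map_zero,
    LinearMap.zero_apply, map_zero]

theorem tri_g1 (z : ⋀[ℂ]^3 (Vec 8)) : E8.tri (g1 z) = ExteriorAlgebra.map incl (z : Ext 8) := by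
  rw [g1, LinearMap.comp_apply, E8.tri_ofTri, coe_map]
theorem mat_g1 (z : ⋀[ℂ]^3 (Vec 8)) : E8.mat (g1 z) = 0 := rfl
theorem cotri_g1 (z : ⋀[ℂ]^3 (Vec 8)) : E8.cotri (g1 z) = 0 := rfl

theorem tri_gNeg2 (x : ⋀[ℂ]^2 (Vec 8)) :
    E8.tri (gNeg2 x) = ExteriorAlgebra.map incl (x : Ext 8) * vec eLast := by
  change (exteriorPower.map 2 incl x : Ext 9) * vec eLast = _
  rw [coe_map]
theorem mat_gNeg2 (x : ⋀[ℂ]^2 (Vec 8)) : E8.mat (gNeg2 x) = 0 := rfl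
theorem cotri_gNeg2 (x : ⋀[ℂ]^2 (Vec 8)) : E8.cotri (gNeg2 x) = 0 := rfl

theorem cotri_g2 (x : ⋀[ℂ]^2 (Vec 8)) :
    E8.cotri (g2 x) = ExteriorAlgebra.map incl (x : Ext 8) * vec eLast := by
  change (exteriorPower.map 2 incl x : Ext 9) * vec eLast = _
  rw [coe_map]
theorem mat_g2 (x : ⋀[ℂ]^2 (Vec 8)) : E8.mat (g2 x) = 0 := rfl
theorem tri_g2 (x : ⋀[ℂ]^2 (Vec 8)) : E8.tri (g2 x) = 0 := rfl

theorem cotri_gNeg1 (w : ⋀[ℂ]^3 (Vec 8)) :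
    E8.cotri (gNeg1 w) = ExteriorAlgebra.map incl (w : Ext 8) := by
  rw [gNeg1, LinearMap.comp_apply, E8.cotri_ofCotri, coe_map]
theorem mat_gNeg1 (z : ⋀[ℂ]^3 (Vec 8)) : E8.mat (gNeg1 z) = 0 := rfl
theorem tri_gNeg1 (z : ⋀[ℂ]^3 (Vec 8)) : E8.tri (gNeg1 z) = 0 := rfl

theorem moment0_zero_left (w : Ext 9) : moment0 0 w = 0 := by
  simpa using E8.moment0_smul_left 0 0 w
theorem moment0_zero_right (w : Ext 9) : moment0 w 0 = 0 := by
  simpa using E8.moment0_smul_right 0 w 0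
theorem der_zero_left {n : ℕ} (x : Ext n) : der 0 x = 0 := by
  simpa using der_smul 0 (0 : Matrix (Fin n) (Fin n) ℂ) x
theorem star3_zero_left (w : Ext 9) : star3 0 w = 0 := by simp [star3]
theorem star3_zero_right (w : Ext 9) : star3 w 0 = 0 := by simp [star3]

theorem star3_incl_incl_mul_last (z x : Ext 8) :
    star3 (ExteriorAlgebra.map incl z) (ExteriorAlgebra.map incl x * vec eLast)
      = ExteriorAlgebra.map incl (coTri z x) := by
  -- The contraction by `e₉` acts first; moving it past the eight factors of `vol 8` costs the sign
  -- `(-1)⁸ = 1`.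
  rw [star3, contr_mul, vol_nine, contr_last_map_incl_mul (vol_mem 8), map_smul, map_smul,
    contr_map_incl, contr_map_incl, coTri, contr_mul]
  norm_num

theorem star3_incl_incl (z u : Ext 8) :
    star3 (ExteriorAlgebra.map incl z) (ExteriorAlgebra.map incl u)
      = ExteriorAlgebra.map incl (contr (z * u) (vol 8)) * vec eLast := by
  rw [star3, vol_nine, contr_map_incl_mul_last, contr_map_incl_mul_last, contr_mul]

/-! ### The brackets with the degree `1` piece that make up `ad(z)⁴` and `ad(z)⁶` -/

theorem lie_g1_gNeg2 (z : ⋀[ℂ]^3 (Vec 8)) (x : ⋀[ℂ]^2 (Vec 8)) :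
    ⁅g1 z, gNeg2 x⁆ = gNeg1 ⟨coTri z x, coTri_mem z.2 x.2⟩ := by
  apply E8.ext
  · rw [E8.mat_lie, mat_g1, mat_gNeg2, cotri_gNeg2, cotri_g1, mat_gNeg1]
    simp [moment0_zero_right]
  · rw [E8.tri_lie, mat_g1, mat_gNeg2, cotri_gNeg2, tri_gNeg1]
    simp [der_zero_left, star3_zero_right]
  · rw [E8.cotri_lie, mat_g1, mat_gNeg2, tri_g1, tri_gNeg2, star3_incl_incl_mul_last,
      cotri_gNeg1]
    simp [der_zero_left]

theorem pairing_incl {u w : Ext 8} (hu : u ∈ ⋀[ℂ]^3 (Vec 8)) (hw : w ∈ ⋀[ℂ]^3 (Vec 8)) :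
    pairing (ExteriorAlgebra.map incl u) (ExteriorAlgebra.map incl w) = pairing u w := by
  apply FaithfulSMul.algebraMap_injective ℂ (Ext 9)
  rw [algebraMap_pairing (mem_map_incl hu) (mem_map_incl hw), contr_map_incl,
    ← algebraMap_pairing hu hw, AlgHom.commutes]

/-- The inner bracket lies in `sl₉` and is the traceless moment matrix of `z` and `w`; the second
bracket makes it act on `z`, with a sign. The hypothesis kills its scalar correction. -/
theorem lie_g1_lie_g1_gNeg1 (z w : ⋀[ℂ]^3 (Vec 8)) (h : pairing (z : Ext 8) (w : Ext 8) = 0) :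
    ⁅g1 z, ⁅g1 z, gNeg1 w⁆⁆
      = - g1 ⟨der (moment z w) z, der_mem _ z.2⟩ := by
  apply E8.ext
  · rw [map_neg, E8.mat_lie, E8.cotri_lie, E8.tri_lie, mat_g1, mat_g1, cotri_g1, mat_gNeg1,
      tri_gNeg1]
    simp [der_zero_left, star3_zero_left, star3_zero_right, moment0_zero_right]
  · rw [map_neg, E8.tri_lie, E8.mat_lie, E8.tri_lie, mat_g1, cotri_g1, mat_gNeg1, tri_gNeg1,
      cotri_gNeg1, tri_g1, tri_g1, moment0, pairing_incl z.2 w.2, h]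
    simp [der_zero_left, star3_zero_left, moment0_zero_left,
      der_moment_map_incl z.2 w.2]
  · rw [map_neg, E8.cotri_lie, E8.mat_lie, E8.tri_lie, mat_g1, cotri_g1, cotri_g1, mat_gNeg1,
      tri_gNeg1]
    simp [der_zero_left, star3_zero_left, star3_zero_right]

theorem lie_g1_g1 (z u : ⋀[ℂ]^3 (Vec 8)) :
    ⁅g1 z, g1 u⁆ = g2 ⟨contr ((z : Ext 8) * (u : Ext 8)) (vol 8),
      contr_mem (mul_mem z.2 u.2) (vol_mem 8)⟩ := by
  apply E8.ext
  · rw [E8.mat_lie, mat_g1, mat_g1, cotri_g1, cotri_g1, mat_g2]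
    simp [moment0_zero_right]
  · rw [E8.tri_lie, mat_g1, mat_g1, cotri_g1, tri_g2]
    simp [der_zero_left, star3_zero_left]
  · rw [E8.cotri_lie, mat_g1, mat_g1, tri_g1, tri_g1, star3_incl_incl, cotri_g2]
    simp [der_zero_left]

/-- The four brackets pass through the degrees `-2, -1, 0, 1, 2`; the middle two are taken together
in `lie_g1_lie_g1_gNeg1`. -/
theorem PMap_eq (z : ⋀[ℂ]^3 (Vec 8)) (x : ⋀[ℂ]^2 (Vec 8)) :
    (PMap z x : Ext 8) = quartic z x := by
  have h : ((LieAlgebra.ad ℂ E8 (g1 z)) ^ 4) (gNeg2 x) = g2 ⟨quartic z x, quartic_mem z.2⟩ := by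
    have h4 : ((LieAlgebra.ad ℂ E8 (g1 z)) ^ 4) (gNeg2 x)
      = ⁅g1 z, ⁅g1 z, ⁅g1 z, ⁅g1 z, gNeg2 x⁆⁆⁆⁆ := by
      simp only [pow_succ, pow_zero, one_mul, Module.End.mul_apply, LieAlgebra.ad_apply]
    rw [h4, lie_g1_gNeg2, lie_g1_lie_g1_gNeg1 _ _ (pairing_coTri z.2), lie_neg, lie_g1_g1, ← map_neg]
    rfl
  rw [← g2_PMap] at h
  have := congrArg coord2 h
  rw [coord2_g2, coord2_g2] at this
  rw [this]

/-- The matrix `e₉ ⊗ φ` acts on `z` as `e₉ ∧ (φ ⌋ z)`. Moving `e₉` to the right past a two-vector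
costs no sign; the minus sign is that of `[z, A] = -A z`. -/
theorem lie_g1_gNeg3 (z : ⋀[ℂ]^3 (Vec 8)) (φ : Vec 8) :
    ⁅g1 z, gNeg3 φ⁆ = - gNeg2 ⟨contr (vec φ) (z : Ext 8), contr_vec_mem φ z.2⟩ := by
  have ht : E8.tri (gNeg3 φ) = 0 := rfl
  have hc : E8.cotri (gNeg3 φ) = 0 := rfl
  have hm : E8.mat (gNeg3 φ) = Matrix.vecMulVec eLast (incl φ) := rfl
  apply E8.ext
  · rw [map_neg, E8.mat_lie, mat_g1, cotri_g1, hc, mat_gNeg2]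
    simp [moment0_zero_right]
  · rw [map_neg, E8.tri_lie, ht, hc, hm, tri_g1, tri_gNeg2, mat_g1, der_zero_left,
      der_apply]
    have : ∀ i, vec (Matrix.vecMulVec eLast (incl φ) *ᵥ e i)
        * contr (vec (e i)) (ExteriorAlgebra.map incl (z : Ext 8))
      = vec eLast * (incl φ i • contr (vec (e i)) (ExteriorAlgebra.map incl (z : Ext 8))) := by
      intro i
      rw [Matrix.vecMulVec_mulVec]
      simp
    rw [Finset.sum_congr rfl fun i _ => this i, ← Finset.mul_sum, sum_contr,
      ← ExteriorAlgebra.map_apply_ι incl, contr_map_incl,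
      vec_mul_mem eLast (mem_map_incl (contr_vec_mem (k := 2) φ z.2))]
    simp [star3_zero_right]
  · rw [map_neg, E8.cotri_lie, ht, hc, cotri_g1, cotri_gNeg2]
    simp [star3_zero_right]

/-- The coordinate is the last column of the moment matrix of `z` and `y ∧ e₉`. Its entry in row `i`
pairs `z` with `eᵢ ∧ y`, so the column is `y ⌋ z` by `sum_pairing`. The scalar correction is
diagonal and does not meet this column in its first eight rows. -/
theorem coord3_lie_g1_g2 (z : ⋀[ℂ]^3 (Vec 8)) (y : ⋀[ℂ]^2 (Vec 8)) :
    vec (coord3 ⁅g1 z, g2 y⁆) = contr (y : Ext 8) (z : Ext 8) := by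
  rw [← sum_pairing z.2 y.2]
  conv_lhs => rw [← sum_e (coord3 ⁅g1 z, g2 y⁆)]
  simp only [map_sum, map_smul]
  refine Finset.sum_congr rfl fun i _ => ?_
  congr 1
  rw [coord3_apply, E8.mat_lie, mat_g1, mat_g2, tri_g2, cotri_g2, tri_g1, moment0_zero_left]
  have h8 : i.castSucc ≠ 8 := i.castSucc_lt_last.ne
  simp only [zero_mul, sub_zero, zero_add, moment0, Matrix.sub_apply, Matrix.smul_apply,
    Matrix.one_apply_ne h8, smul_zero, moment, Matrix.of_apply]
  have := contr_last_map_incl_mul y.2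
  rw [this, ← incl_e]
  norm_num
  rw [← ExteriorAlgebra.map_apply_ι incl, ← map_mul, pairing_incl z.2 (mul_mem (vec_mem _) y.2)]

/-- Splitting `ad(z)⁶` as `ad(z) ad(z)⁴ ad(z)` on degree `-3`, the outer factors are `φ ↦ -φ ⌋ z`
and `y ↦ y ⌋ z`, and the middle one is `P(z)`. -/
theorem QMap_eq (z : ⋀[ℂ]^3 (Vec 8)) (φ : Vec 8) :
    vec (QMap z φ) = - contr (quartic z (contr (vec φ) (z : Ext 8))) (z : Ext 8) := by
  have h : ((LieAlgebra.ad ℂ E8 (g1 z)) ^ 6) (gNeg3 φ)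
      = - ⁅g1 z, g2 (PMap z ⟨contr (vec φ) (z : Ext 8), contr_vec_mem φ z.2⟩)⁆ := by
    have h6 : ((LieAlgebra.ad ℂ E8 (g1 z)) ^ 6) (gNeg3 φ)
      = ⁅g1 z, ((LieAlgebra.ad ℂ E8 (g1 z)) ^ 4) ⁅g1 z, gNeg3 φ⁆⁆ := by
      simp only [pow_succ, pow_zero, one_mul, Module.End.mul_apply, LieAlgebra.ad_apply]
    rw [h6, lie_g1_gNeg3, map_neg, ← g2_PMap, lie_neg]
  rw [QMap, LinearMap.comp_apply, LinearMap.comp_apply, h, map_neg, map_neg, coord3_lie_g1_g2,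
    PMap_eq]

/-! ### Equivariance under `GL(V₈)` -/

/-- The algebra automorphism of the exterior algebra induced by a matrix. -/
abbrev mapMatrix {n : ℕ} (g : Matrix (Fin n) (Fin n) ℂ) : Ext n →ₐ[ℂ] Ext n :=
  ExteriorAlgebra.map (Matrix.toLin' g)

theorem vec_injective {n : ℕ} : Function.Injective (vec : Vec n →ₗ[ℂ] Ext n) :=
  (ExteriorAlgebra.ι_leftInverse (R := ℂ) (M := Vec n)).injective

theorem mapMatrix_vec {n : ℕ} (g : Matrix (Fin n) (Fin n) ℂ) (v : Vec n) :
    mapMatrix g (vec v) = vec (g *ᵥ v) := by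
  rw [mapMatrix, ExteriorAlgebra.map_apply_ι, Matrix.toLin'_apply]

theorem mapMatrix_vec_mul {n : ℕ} (g : Matrix (Fin n) (Fin n) ℂ) (v : Vec n) (x : Ext n) :
    mapMatrix g (vec v * x) = vec (g *ᵥ v) * mapMatrix g x := by
  rw [map_mul, mapMatrix_vec]

theorem coe_map_toLin' {n k : ℕ} (g : Matrix (Fin n) (Fin n) ℂ) (x : ⋀[ℂ]^k (Vec n)) :
    (exteriorPower.map k (Matrix.toLin' g) x : Ext n) = mapMatrix g (x : Ext n) :=
  coe_map _ _

/-! ### Natural operations under `g` and its contragredient `h`, where `hᵀ * g = 1` -/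

section Contragredient

variable {n : ℕ} {g h : Matrix (Fin n) (Fin n) ℂ}

theorem contragredient_symm (hgh : hᵀ * g = 1) : gᵀ * h = 1 := by
  rw [← Matrix.transpose_one, ← hgh, Matrix.transpose_mul, Matrix.transpose_transpose]

theorem dotProduct_contragredient (hgh : hᵀ * g = 1) (φ v : Vec n) :
    (h *ᵥ φ) ⬝ᵥ (g *ᵥ v) = φ ⬝ᵥ v := by
  rw [Matrix.dotProduct_mulVec, ← Matrix.mulVec_transpose, Matrix.mulVec_mulVec,
    contragredient_symm hgh, Matrix.one_mulVec]

theorem contr_mapMatrix (hgh : hᵀ * g = 1) (η x : Ext n) :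
    contr (mapMatrix h η) (mapMatrix g x) = mapMatrix g (contr η x) := by
  have hv : ∀ (φ : Vec n) (x : Ext n), contr (vec (h *ᵥ φ)) (mapMatrix g x)
      = mapMatrix g (contr (vec φ) x) := by
    intro φ x
    induction x using ext_induction with
    | h1 => simp [contr_vec_one]
    | hadd x y hx hy => simp only [map_add, hx, hy]
    | hs c x hx => simp only [map_smul, hx]
    | hm v x hx =>
      rw [mapMatrix_vec_mul, contr_vec_mul, hx, contr_vec_mul, dotProduct_contragredient hgh,
        map_sub, map_smul, mapMatrix_vec_mul]
  induction η using ext_induction generalizing x with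
  | h1 => simp
  | hadd y z hy hz => simp only [map_add, LinearMap.add_apply, hy, hz]
  | hs c y hy => simp only [map_smul, LinearMap.smul_apply, hy]
  | hm v y hy => rw [mapMatrix_vec_mul, contr_mul, contr_mul, hy, hv]

theorem contr_vec_mapMatrix (hgh : hᵀ * g = 1) (φ : Vec n) (x : Ext n) :
    contr (vec φ) (mapMatrix g x) = mapMatrix g (contr (vec (gᵀ *ᵥ φ)) x) := by
  have : h * gᵀ = 1 := mul_eq_one_comm.mp (contragredient_symm hgh)
  rw [← contr_mapMatrix hgh, mapMatrix_vec, Matrix.mulVec_mulVec, this, Matrix.one_mulVec]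

theorem der_mapMatrix (hgh : hᵀ * g = 1) (A : Matrix (Fin n) (Fin n) ℂ) (x : Ext n) :
    der (g * A * hᵀ) (mapMatrix g x) = mapMatrix g (der A x) := by
  induction x using ext_induction with
  | h1 => simp [der_one]
  | hadd x y hx hy => simp only [map_add, hx, hy]
  | hs c x hx => simp only [map_smul, hx]
  | hm v x hx =>
    rw [mapMatrix_vec_mul, der_vec_mul, der_vec_mul, hx, map_add, mapMatrix_vec_mul,
      mapMatrix_vec_mul, Matrix.mulVec_mulVec, Matrix.mul_assoc, hgh, Matrix.mul_one,
      Matrix.mulVec_mulVec]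

theorem algebraMapInv_mapMatrix (g : Matrix (Fin n) (Fin n) ℂ) (x : Ext n) :
    ExteriorAlgebra.algebraMapInv (mapMatrix g x) = ExteriorAlgebra.algebraMapInv x := by
  induction x using ext_induction with
  | h1 => simp
  | hadd x y hx hy => simp only [map_add, hx, hy]
  | hs c x hx => simp only [map_smul, hx]
  | hm v x hx => rw [mapMatrix_vec_mul, algebraMapInv_vec_mul, algebraMapInv_vec_mul]

/-- By naturality of contraction, `g` and `h` can be moved from `u` and `w` to the basis vectors
that define the entries; expanding these gives the conjugation by `g`, since `hᵀ = g⁻¹`. -/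
theorem moment_mapMatrix (hgh : hᵀ * g = 1) (u w : Ext n) :
    moment (mapMatrix g u) (mapMatrix h w) = g * moment u w * hᵀ := by
  have hc := contragredient_symm hgh
  have hl : ∀ a b, moment (mapMatrix g u) (mapMatrix h w) a b
      = pairing u (vec (gᵀ *ᵥ e a) * contr (vec (hᵀ *ᵥ e b)) w) := by
    intro a b
    have h1 : h * gᵀ = 1 := mul_eq_one_comm.mp hc
    have h2 : vec (e a) = mapMatrix h (vec (gᵀ *ᵥ e a)) := by
      rw [mapMatrix_vec, Matrix.mulVec_mulVec, h1, Matrix.one_mulVec]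
    rw [moment, Matrix.of_apply, pairing_apply, contr_vec_mapMatrix hc, h2, ← map_mul,
      contr_mapMatrix hc, algebraMapInv_mapMatrix, pairing_apply]
  ext a b
  have h2 : ∀ (M : Matrix (Fin n) (Fin n) ℂ) (j : Fin n), vec (Mᵀ *ᵥ e j) = ∑ k, M j k • vec (e k) := by
    intro M j
    conv_lhs => rw [← sum_e (Mᵀ *ᵥ e j)]
    simp
  rw [hl, h2, h2]
  simp only [moment, Matrix.mul_apply, Finset.sum_mul, Finset.mul_sum, map_sum, LinearMap.sum_apply,
    map_smul, LinearMap.smul_apply, smul_mul_assoc, mul_smul_comm, smul_eq_mul, Matrix.of_apply,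
    Matrix.transpose_apply]
  refine Finset.sum_congr rfl fun j _ => Finset.sum_congr rfl fun k _ => ?_
  ring

/-- The canonical tensor `∑ eᵢ ⊗ eᵢ` is fixed by a contragredient pair. This makes the sum in the
definition of `R` independent of the basis. -/
theorem sum_contragredient {W : Type*} [AddCommGroup W] [Module ℂ W] (hgh : hᵀ * g = 1)
    (B : Vec n →ₗ[ℂ] Vec n →ₗ[ℂ] W) :
    ∑ i, B (gᵀ *ᵥ e i) (hᵀ *ᵥ e i) = ∑ i, B (e i) (e i) := by
  have h1 : ∀ j k, ∑ i, g i j * h i k = (1 : Matrix (Fin n) (Fin n) ℂ) j k := by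
    intro j k
    rw [← contragredient_symm hgh]
    rfl
  have h2 : ∀ i, B (gᵀ *ᵥ e i) (hᵀ *ᵥ e i) = ∑ j, ∑ k, (g i j * h i k) • B (e j) (e k) := by
    intro i
    rw [← sum_e (gᵀ *ᵥ e i), ← sum_e (hᵀ *ᵥ e i)]
    simp only [map_sum, map_smul, LinearMap.sum_apply, LinearMap.smul_apply, Finset.smul_sum,
      smul_smul]
    rw [Finset.sum_comm]
    simp [mul_comm]
  simp only [h2]
  rw [Finset.sum_comm]
  refine Finset.sum_congr rfl fun j _ => ?_
  rw [Finset.sum_comm, Finset.sum_eq_single j]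
  · rw [← Finset.sum_smul, h1, Matrix.one_apply_eq, one_smul]
  · intro k _ hk
    rw [← Finset.sum_smul, h1, Matrix.one_apply_ne hk.symm, zero_smul]
  · simp

end Contragredient

/-- An alternating map in `n` vectors of `Vₙ` is determined by its value on the standard basis, so a
wedge of `n` vectors is their determinant times `vol n`. -/
theorem mapMatrix_vol {n : ℕ} (g : Matrix (Fin n) (Fin n) ℂ) :
    mapMatrix g (vol n) = g.det • vol n := by
  have key : ExteriorAlgebra.ιMulti ℂ n
      = (LinearMap.toSpanSingleton ℂ (Ext n) (vol n)).compAlternatingMap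
        (Pi.basisFun ℂ (Fin n)).det := by
    refine Module.Basis.ext_alternating (Pi.basisFun ℂ (Fin n)) fun v hv => ?_
    obtain ⟨σ, rfl⟩ : ∃ σ : Equiv.Perm (Fin n), v = σ :=
      ⟨Equiv.ofBijective v (Finite.injective_iff_bijective.mp hv), rfl⟩
    have h1 := (ExteriorAlgebra.ιMulti ℂ n (M := Vec n)).map_perm (Pi.basisFun ℂ (Fin n)) σ
    have h2 := ((LinearMap.toSpanSingleton ℂ (Ext n) (vol n)).compAlternatingMap
        (Pi.basisFun ℂ (Fin n)).det).map_perm (Pi.basisFun ℂ (Fin n)) σ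
    simp only [Function.comp_def] at h1 h2
    rw [h1, h2]
    congr 1
    simp only [LinearMap.compAlternatingMap_apply, Module.Basis.det_self,
      LinearMap.toSpanSingleton_apply, one_smul, vol]
    congr 1
    funext i
    simp
  rw [vol, ExteriorAlgebra.map_apply_ιMulti, ← vol]
  conv_lhs => rw [key]
  simp only [LinearMap.compAlternatingMap_apply, LinearMap.toSpanSingleton_apply]
  congr 1
  rw [← Matrix.det_transpose, Pi.basisFun_det]
  congr 1
  ext i j
  simp

/-- Since `vol = det(g) • h vol`, each contraction into `vol` contributes one factor `det g`, and
its result lives on the dual side. -/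
theorem contr_mapMatrix_vol {n : ℕ} {g h : Matrix (Fin n) (Fin n) ℂ} (hgh : hᵀ * g = 1)
    (η : Ext n) : contr (mapMatrix g η) (vol n) = g.det • mapMatrix h (contr η (vol n)) := by
  have hd : g.det * h.det = 1 := by
    rw [mul_comm, ← Matrix.det_transpose h, ← Matrix.det_mul, hgh, Matrix.det_one]
  rw [← contr_mapMatrix (contragredient_symm hgh), mapMatrix_vol, map_smul, smul_smul, hd, one_smul]

/-- The volume element enters twice, in `coTri` and in the outer contraction; the moment matrix and
its action are natural. -/
theorem quartic_mapMatrix {g h : Matrix (Fin 8) (Fin 8) ℂ} (hgh : hᵀ * g = 1) (z x : Ext 8) :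
    quartic (mapMatrix g z) (mapMatrix g x) = g.det ^ 2 • mapMatrix h (quartic z x) := by
  rw [quartic, coTri, ← map_mul, contr_mapMatrix_vol hgh, moment_smul_right, der_smul,
    moment_mapMatrix hgh, der_mapMatrix hgh, mul_smul_comm, ← map_mul, map_smul,
    LinearMap.smul_apply, contr_mapMatrix_vol hgh, quartic, map_neg, smul_neg, smul_smul, pow_two]
  rfl

theorem QMap_map {g h : Matrix (Fin 8) (Fin 8) ℂ} (hgh : hᵀ * g = 1) (z : ⋀[ℂ]^3 (Vec 8))
    (φ : Vec 8) : QMap (exteriorPower.map 3 (Matrix.toLin' g) z) φ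
      = g.det ^ 2 • g *ᵥ QMap z (gᵀ *ᵥ φ) := by
  apply vec_injective
  rw [QMap_eq, coe_map_toLin', contr_vec_mapMatrix hgh, quartic_mapMatrix hgh, map_smul,
    LinearMap.smul_apply, contr_mapMatrix hgh, map_smul, ← mapMatrix_vec g, QMap_eq, map_neg, smul_neg]

theorem vec_RMap (z : ⋀[ℂ]^3 (Vec 8)) (v : Vec 8) :
    vec (RMap z v)
      = ∑ a, contr (vec (QMap z (e a))) (quartic (z : Ext 8) (vec (e a) * vec v)) := by
  rw [RMap_apply]
  simp only [PMap_eq]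
  rfl

/-- One `P` and one `Q` contribute `det(g)²` each, and the summation over dual bases is handled by
`sum_contragredient`. -/
theorem RMap_map {g h : Matrix (Fin 8) (Fin 8) ℂ} (hgh : hᵀ * g = 1) (z : ⋀[ℂ]^3 (Vec 8))
    (v : Vec 8) : RMap (exteriorPower.map 3 (Matrix.toLin' g) z) v
      = g.det ^ 4 • h *ᵥ RMap z (hᵀ *ᵥ v) := by
  have hc := contragredient_symm hgh
  have hg : ∀ u, g *ᵥ (hᵀ *ᵥ u) = u := fun u => by
    rw [Matrix.mulVec_mulVec, mul_eq_one_comm.mp hgh, Matrix.one_mulVec]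
  have hB : ∀ φ u w, (contr.toLinearMap ∘ₗ vec ∘ₗ QMap z).compl₂
      ((⋀[ℂ]^2 (Vec 8)).subtype ∘ₗ PMap z ∘ₗ wedgeBy w) φ u
      = contr (vec (QMap z φ)) (quartic (z : Ext 8) (vec w * vec u)) := by
    intro φ u w
    rw [LinearMap.compl₂_apply, LinearMap.comp_apply, LinearMap.comp_apply, LinearMap.comp_apply,
      LinearMap.comp_apply, Submodule.subtype_apply, PMap_eq]
    rfl
  -- In the definition of `R` the summation vector is the first factor of the wedge, whereas in
  -- `wedgeBy w` the argument is the second. Antisymmetry exchanges them; the sign appears once on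
  -- each side of the final comparison.
  have hs : ∀ u w, quartic (z : Ext 8) (vec u * vec w) = - quartic z (vec w * vec u) := by
    intro u w
    have := congrArg (fun x => (PMap z x : Ext 8)) (show wedgeBy u w = - wedgeBy w u from
      Subtype.ext (vec_anti u w))
    simp only [map_neg, Submodule.coe_neg, PMap_eq] at this
    exact this
  have key := sum_contragredient hgh ((contr.toLinearMap ∘ₗ vec ∘ₗ QMap z).compl₂
      ((⋀[ℂ]^2 (Vec 8)).subtype ∘ₗ PMap z ∘ₗ wedgeBy (hᵀ *ᵥ v)))
  simp only [hB] at key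
  apply vec_injective
  have ht : ∀ a, contr (vec (QMap (exteriorPower.map 3 (Matrix.toLin' g) z) (e a)))
      (quartic (exteriorPower.map 3 (Matrix.toLin' g) z : Ext 8) (vec (e a) * vec v))
      = g.det ^ 4 • mapMatrix h (- contr (vec (QMap z (gᵀ *ᵥ e a)))
        (quartic (z : Ext 8) (vec (hᵀ *ᵥ v) * vec (hᵀ *ᵥ e a)))) := by
    intro a
    have hev : vec (e a) * vec v = mapMatrix g (vec (hᵀ *ᵥ e a) * vec (hᵀ *ᵥ v)) := by
      rw [map_mul, mapMatrix_vec, mapMatrix_vec, hg, hg]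
    rw [QMap_map hgh, coe_map_toLin', ← map_neg, ← hs, hev, quartic_mapMatrix hgh, map_smul,
      map_smul, map_smul, LinearMap.smul_apply, smul_smul, ← mapMatrix_vec g, contr_mapMatrix hc,
      ← pow_add]
  rw [vec_RMap, Finset.sum_congr rfl fun a _ => ht a, ← Finset.smul_sum, ← map_sum, map_smul,
    ← mapMatrix_vec h, vec_RMap, Finset.sum_neg_distrib, key, ← Finset.sum_neg_distrib]
  simp only [← map_neg, ← hs]

/-! ### Computation in the exterior algebra with integral coefficients

An integral combination of monomials is represented by a list of coefficients and monomials, a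
monomial by the list of its indices. -/

/-- Integral combinations of monomials in the exterior algebra of `Vₙ`. -/
abbrev Combo (n : ℕ) : Type := List (ℤ × List (Fin n))

namespace Combo

variable {n : ℕ}

/-- The monomial `e_{i₁} ∧ ⋯ ∧ e_{iₖ}`. -/
def evalMono : List (Fin n) → Ext n
  | [] => 1
  | i :: m => vec (e i) * evalMono m

/-- The element of the exterior algebra represented by a combination of monomials. -/
def eval (p : Combo n) : Ext n := (p.map fun t => (t.1 : ℂ) • evalMono t.2).sum

/-- Left multiplication of all monomials by `-e_j`. -/
def negCons (j : Fin n) (p : Combo n) : Combo n := p.map fun t => (-t.1, j :: t.2)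

/-- Scalar multiplication. -/
def scale (c : ℤ) (p : Combo n) : Combo n := p.map fun t => (c * t.1, t.2)

/-- Addition of a term, collecting equal monomials. -/
def addTerm (t : ℤ × List (Fin n)) : Combo n → Combo n
  | [] => [t]
  | s :: p => if t.2 = s.2 then (if t.1 + s.1 = 0 then p else (t.1 + s.1, s.2) :: p)
      else s :: addTerm t p

/-- Collecting equal monomials. -/
def collect (p : Combo n) : Combo n := p.foldr addTerm []

/-- The linear extension of a map defined on monomials. -/
def extend (f : List (Fin n) → Combo n) (p : Combo n) : Combo n :=
  collect (p.flatMap fun t => scale t.1 (f t.2))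

/-- The product of `e_i` with a monomial. -/
def insertMono (i : Fin n) : List (Fin n) → Combo n
  | [] => [(1, [i])]
  | j :: m => if i = j then [] else if i < j then [(1, i :: j :: m)] else negCons j (insertMono i m)

/-- The product of two combinations of monomials, the first one being a monomial. -/
def mulMono : List (Fin n) → Combo n → Combo n
  | [], p => p
  | i :: m, p => extend (insertMono i) (mulMono m p)

/-- The product. -/
def mul (p q : Combo n) : Combo n := extend (fun m => mulMono m q) p

/-- The contraction of a monomial by `e_i`. -/
def contrSingle (i : Fin n) : List (Fin n) → Combo n
  | [] => []
  | j :: m => (if i = j then [(1, m)] else []) ++ negCons j (contrSingle i m)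

/-- The contraction by a monomial. -/
def contrMono : List (Fin n) → Combo n → Combo n
  | [], p => p
  | i :: m, p => extend (contrSingle i) (contrMono m p)

/-- The contraction. -/
def contract (p q : Combo n) : Combo n := extend (fun m => contrMono m q) p

/-- The combination representing `der (moment z w) z`. -/
def derMoment (z w : Combo n) : Combo n :=
  collect ((List.finRange n).flatMap fun i =>
    mul (contract (contrMono [i] w) z) (contrMono [i] z))

/-- The combination representing the volume form. -/
def volume (n : ℕ) : Combo n := [(1, List.finRange n)]

/-- The combination representing `quartic z x`. -/
def quartic (z x : Combo 8) : Combo 8 :=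
  scale (-1) (contract (mul z (derMoment z (contract (mul z x) (volume 8)))) (volume 8))

/-- The combination representing a vector with integral coordinates. -/
def ofVec (v : Fin n → ℤ) : Combo n := (List.finRange n).map fun i => (v i, [i])

/-- Equality of combinations of monomials. -/
def same (p q : Combo n) : Bool := (collect (p ++ scale (-1) q)).all fun t => t.1 == 0

/-! ### Correctness of the integral arithmetic -/

@[simp] theorem eval_nil : eval ([] : Combo n) = 0 := rfl

@[simp] theorem eval_cons (t : ℤ × List (Fin n)) (p : Combo n) :
    eval (t :: p) = (t.1 : ℂ) • evalMono t.2 + eval p := by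
  simp [eval]

@[simp] theorem eval_append (p q : Combo n) : eval (p ++ q) = eval p + eval q := by
  simp [eval]

theorem eval_flatMap {α : Type*} (l : List α) (f : α → Combo n) :
    eval (l.flatMap f) = (l.map fun a => eval (f a)).sum := by
  induction l with
  | nil => rfl
  | cons a l ih => simp [ih]

@[simp] theorem eval_negCons (j : Fin n) (p : Combo n) :
    eval (negCons j p) = - (vec (e j) * eval p) := by
  induction p with
  | nil => simp [negCons]
  | cons t p ih =>
    rw [negCons] at ih
    simp only [negCons, List.map_cons, eval_cons, ih, evalMono]
    push_cast
    simp only [neg_smul, mul_add, mul_smul_comm]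
    abel

@[simp] theorem eval_scale (c : ℤ) (p : Combo n) : eval (scale c p) = (c : ℂ) • eval p := by
  induction p with
  | nil => simp [scale]
  | cons t p ih =>
    rw [scale] at ih
    simp only [scale, List.map_cons, eval_cons, ih, smul_add, smul_smul]
    push_cast
    rfl

theorem eval_addTerm (t : ℤ × List (Fin n)) (p : Combo n) :
    eval (addTerm t p) = (t.1 : ℂ) • evalMono t.2 + eval p := by
  induction p with
  | nil => simp [addTerm]
  | cons s p ih =>
    rw [addTerm]
    split_ifs with h h0
    · have : ((t.1 : ℂ) + s.1) = 0 := by exact_mod_cast h0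
      rw [eval_cons, h, ← add_assoc, ← add_smul, this, zero_smul, zero_add]
    · rw [eval_cons, eval_cons, h, ← add_assoc, ← add_smul]
      push_cast
      rfl
    · rw [eval_cons, eval_cons, ih]
      abel

@[simp] theorem eval_collect (p : Combo n) : eval (collect p) = eval p := by
  induction p with
  | nil => rfl
  | cons t p ih =>
    rw [collect] at ih
    rw [collect, List.foldr_cons, eval_addTerm, ih, eval_cons]

/-- By linearity an operation need only be checked on monomials; the products and contractions below
are all verified through this. -/
theorem eval_extend {f : List (Fin n) → Combo n} {L : Ext n →ₗ[ℂ] Ext n}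
    (h : ∀ m, eval (f m) = L (evalMono m)) (p : Combo n) : eval (extend f p) = L (eval p) := by
  rw [extend, eval_collect]
  induction p with
  | nil => simp
  | cons t p ih => simp [h, ih]

/-- Moving `eᵢ` past one smaller index changes the sign. The value is right even if `m` is not
sorted; sorting only lets `collect` recognize equal monomials. -/
theorem eval_insertMono (i : Fin n) (m : List (Fin n)) :
    eval (insertMono i m) = vec (e i) * evalMono m := by
  induction m with
  | nil => simp [insertMono, evalMono]
  | cons j m ih =>
    rw [insertMono]
    split_ifs with h h1
    · subst h
      rw [evalMono, ← mul_assoc, ExteriorAlgebra.ι_sq_zero, zero_mul, eval_nil]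
    · simp [evalMono]
    · rw [eval_negCons, ih, evalMono, vec_swap (e i)]

theorem eval_mulMono (m : List (Fin n)) (p : Combo n) :
    eval (mulMono m p) = evalMono m * eval p := by
  induction m with
  | nil => simp [mulMono, evalMono]
  | cons i m ih =>
    rw [mulMono, eval_extend (L := LinearMap.mulLeft ℂ (vec (e i)))
      (fun m => by rw [eval_insertMono]; rfl), ih, evalMono, mul_assoc]
    rfl

theorem eval_mul (p q : Combo n) : eval (mul p q) = eval p * eval q := by
  rw [mul, eval_extend (L := LinearMap.mulRight ℂ (eval q))
    (fun m => by rw [eval_mulMono]; rfl)]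
  rfl

theorem eval_contrSingle (i : Fin n) (m : List (Fin n)) :
    eval (contrSingle i m) = contr (vec (e i)) (evalMono m) := by
  induction m with
  | nil => simp [contrSingle, evalMono, contr_vec_one]
  | cons j m ih =>
    rw [contrSingle, eval_append, eval_negCons, ih, evalMono, contr_vec_mul, sub_eq_add_neg]
    congr 1
    by_cases h : i = j
    · subst h; simp
    · simp [h]

theorem eval_contrMono (m : List (Fin n)) (p : Combo n) :
    eval (contrMono m p) = contr (evalMono m) (eval p) := by
  induction m with
  | nil => simp [contrMono, evalMono]
  | cons i m ih =>
    rw [contrMono, eval_extend (L := contr (vec (e i))) (eval_contrSingle i), ih, evalMono, contr_mul]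

theorem eval_contract (p q : Combo n) : eval (contract p q) = contr (eval p) (eval q) := by
  rw [contract, eval_extend (L := contr.toLinearMap.flip (eval q))
    (fun m => by rw [eval_contrMono]; rfl)]
  rfl

/-- Through `der_moment` the action becomes a sum of products of contractions, so the entries of the
moment matrix are never computed. -/
theorem eval_derMoment {z w : Combo n} (hz : eval z ∈ ⋀[ℂ]^3 (Vec n))
    (hw : eval w ∈ ⋀[ℂ]^3 (Vec n)) :
    eval (derMoment z w) = der (moment (eval z) (eval w)) (eval z) := by
  rw [derMoment, eval_collect, eval_flatMap, der_moment hz hw, ← List.sum_ofFn, List.ofFn_eq_map]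
  simp only [eval_mul, eval_contract, eval_contrMono, evalMono, mul_one]

theorem eval_volume (n : ℕ) : eval (volume n) = vol n := by
  have h : ∀ l : List (Fin n), evalMono l = (l.map fun i => vec (e i)).prod := by
    intro l
    induction l with
    | nil => rfl
    | cons i l ih => rw [evalMono, ih, List.map_cons, List.prod_cons]
  rw [volume, vol, ExteriorAlgebra.ιMulti_apply, eval_cons, eval_nil, h, List.ofFn_eq_map]
  simp

theorem eval_quartic {z x : Combo 8} (hz : eval z ∈ ⋀[ℂ]^3 (Vec 8))
    (hx : eval x ∈ ⋀[ℂ]^2 (Vec 8)) : eval (quartic z x) = E8Model.quartic (eval z) (eval x) := by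
  have hc : eval (contract (mul z x) (volume 8)) = coTri (eval z) (eval x) := by
    rw [eval_contract, eval_mul, eval_volume, coTri]
  have hm : eval (contract (mul z x) (volume 8)) ∈ ⋀[ℂ]^3 (Vec 8) := by
    rw [hc]; exact coTri_mem hz hx
  rw [quartic, eval_scale, eval_contract, eval_mul, eval_derMoment hz hm, hc, eval_volume,
    E8Model.quartic]
  simp

theorem eval_ofVec (v : Fin n → ℤ) : eval (ofVec v) = vec (fun i => (v i : ℂ)) := by
  rw [← sum_e (fun i => (v i : ℂ)), map_sum, ← List.sum_ofFn, List.ofFn_eq_map, ofVec, eval,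
    List.map_map]
  congr 1
  refine List.map_congr_left fun i _ => ?_
  simp [evalMono]

/-- Only this direction is needed, so linear independence of the monomials plays no role: a
combination whose collected coefficients are all `0` evaluates to `0`. -/
theorem eval_eq_of_same {p q : Combo n} (h : same p q = true) : eval p = eval q := by
  have h0 : ∀ l : Combo n, (l.all fun t => t.1 == 0) = true → eval l = 0 := by
    intro l hl
    induction l with
    | nil => rfl
    | cons t l ih =>
      rw [List.all_cons, Bool.and_eq_true, beq_iff_eq] at hl
      rw [eval_cons, ih hl.2, hl.1]
      simp
  have := h0 _ h
  rw [eval_collect, eval_append, eval_scale] at this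
  rw [← sub_eq_zero, ← this]
  simp [sub_eq_add_neg]

theorem evalMono_mem (m : List (Fin n)) : evalMono m ∈ ⋀[ℂ]^m.length (Vec n) := by
  induction m with
  | nil =>
    rw [evalMono, List.length_nil, ExteriorAlgebra.exteriorPower, pow_zero]
    exact Submodule.mem_one.mpr ⟨1, map_one _⟩
  | cons i m ih => 
    rw [evalMono, List.length_cons, add_comm]
    exact mul_mem (vec_mem _) ih

theorem eval_mem {k : ℕ} {p : Combo n} (h : ∀ t ∈ p, t.2.length = k) :
    eval p ∈ ⋀[ℂ]^k (Vec n) := by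
  induction p with
  | nil => exact zero_mem _
  | cons t p ih =>
    rw [eval_cons]
    refine add_mem (Submodule.smul_mem _ _ ?_) (ih fun s hs => h s (List.mem_cons_of_mem _ hs))
    rw [← h t List.mem_cons_self]
    exact evalMono_mem _

end Combo

/-! ### The operators at a generic three-vector -/

/-- A generic three-vector, the invariant three-form on `sl₃` up to the normalization of a basis of
weight vectors. -/
def genericCombo : Combo 8 :=
  [(1, [0, 3, 6]), (1, [1, 4, 7]), (1, [2, 5, 6]), (1, [2, 5, 7]), (1, [0, 1, 2]), (1, [3, 4, 5])]

theorem eval_genericCombo_mem : Combo.eval genericCombo ∈ ⋀[ℂ]^3 (Vec 8) :=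
  Combo.eval_mem (by decide)

/-- The generic three-vector, as an element of `∧³ V₈`. -/
def generic : ⋀[ℂ]^3 (Vec 8) := ⟨Combo.eval genericCombo, eval_genericCombo_mem⟩

/-- The matrix of `Q` at the generic three-vector. -/
def genericQ : Matrix (Fin 8) (Fin 8) ℤ :=
  !![0, 0, 0, -30, 0, 0, 0, 0;
     0, 0, 0, 0, -30, 0, 0, 0;
     0, 0, 0, 0, 0, 30, 0, 0;
     -30, 0, 0, 0, 0, 0, 0, 0;
     0, -30, 0, 0, 0, 0, 0, 0;
     0, 0, 30, 0, 0, 0, 0, 0;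
     0, 0, 0, 0, 0, 0, -20, -10;
     0, 0, 0, 0, 0, 0, -10, -20]

/-- The matrix of `R` at the generic three-vector. -/
def genericR : Matrix (Fin 8) (Fin 8) ℤ :=
  !![0, 0, 0, -300, 0, 0, 0, 0;
     0, 0, 0, 0, -300, 0, 0, 0;
     0, 0, 0, 0, 0, 300, 0, 0;
     -300, 0, 0, 0, 0, 0, 0, 0;
     0, -300, 0, 0, 0, 0, 0, 0;
     0, 0, 300, 0, 0, 0, 0, 0;
     0, 0, 0, 0, 0, 0, -600, 300;
     0, 0, 0, 0, 0, 0, 300, -600]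

/-- Column `j` of the matrix, from the formula of `QMap_eq` evaluated on integer lists. -/
theorem same_genericQ (j : Fin 8) : Combo.same
    (Combo.scale (-1) (Combo.contract
      (Combo.quartic genericCombo (Combo.contrMono [j] genericCombo)) genericCombo))
    (Combo.ofVec fun i => genericQ i j) = true := by
  revert j
  decide +kernel

/-- Column `j` of the matrix, from the sum in `vec_RMap`. The columns of `genericQ` are inserted in
place of `Q`, so the sextic map is not evaluated again. -/
theorem same_genericR (j : Fin 8) : Combo.same
    ((List.finRange 8).flatMap fun a => Combo.contract (Combo.ofVec fun i => genericQ i a)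
      (Combo.quartic genericCombo (Combo.mulMono [a] [(1, [j])])))
    (Combo.ofVec fun i => genericR i j) = true := by
  revert j
  decide +kernel

theorem QMap_generic (j : Fin 8) : QMap generic (e j) = fun i => (genericQ i j : ℂ) := by
  apply vec_injective
  have hm : Combo.eval (Combo.contrMono [j] genericCombo)
      = contr (vec (e j)) (Combo.eval genericCombo) := by
    rw [Combo.eval_contrMono, Combo.evalMono, Combo.evalMono, mul_one]
  rw [QMap_eq, ← Combo.eval_ofVec, ← Combo.eval_eq_of_same (same_genericQ j), Combo.eval_scale,
    Combo.eval_contract, Combo.eval_quartic eval_genericCombo_mem, hm]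
  · simp [generic]
  · rw [hm]; exact contr_vec_mem _ eval_genericCombo_mem

theorem RMap_generic (j : Fin 8) : RMap generic (e j) = fun i => (genericR i j : ℂ) := by
  apply vec_injective
  have hm : ∀ a, Combo.eval (Combo.mulMono [a] [(1, [j])]) = vec (e a) * vec (e j) := by
    intro a
    rw [Combo.eval_mulMono]
    simp [Combo.evalMono]
  have hg : (generic : Ext 8) = Combo.eval genericCombo := rfl
  rw [vec_RMap, ← Combo.eval_ofVec, ← Combo.eval_eq_of_same (same_genericR j), Combo.eval_flatMap,
    ← List.ofFn_eq_map, List.sum_ofFn, hg]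
  refine Finset.sum_congr rfl fun a _ => ?_
  rw [Combo.eval_contract, Combo.eval_ofVec, QMap_generic, Combo.eval_quartic eval_genericCombo_mem,
    hm]
  rw [hm]
  exact mul_mem (vec_mem _) (vec_mem _)

theorem Q_generic : Q generic = genericQ.map (Int.cast : ℤ → ℂ) := by
  ext i j
  rw [Q, LinearMap.toMatrix'_apply, QMap_generic]
  rfl

theorem R_generic : R generic = genericR.map (Int.cast : ℤ → ℂ) := by
  ext i j
  rw [R, LinearMap.toMatrix'_apply, RMap_generic]
  rfl

theorem Q_generic_isSymm : (Q generic).IsSymm := by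
  rw [Q_generic]
  exact Matrix.IsSymm.map (by decide +kernel) _

theorem R_generic_isSymm : (R generic).IsSymm := by
  rw [R_generic]
  exact Matrix.IsSymm.map (by decide +kernel) _

/-- The root vectors give `30 · 300` and the Cartan block gives `20 · 600 - 10 · 300`, both `9000`,
with vanishing off-diagonal entries. -/
theorem Q_mul_R_generic : Q generic * R generic = (9000 : ℂ) • 1 := by
  have h : genericQ * genericR = (9000 : ℤ) • 1 := by decide +kernel
  have h' := congrArg (Int.castRingHom ℂ).mapMatrix h
  rw [map_mul, map_zsmul, map_one] at h'
  rw [Q_generic, R_generic]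
  refine h'.trans ?_
  rw [← Int.cast_smul_eq_zsmul ℂ]
  norm_num

/-! ### Homogeneous polynomial maps -/

/-- The infinitesimal action of matrices on the exterior algebra, as a linear map. -/
def derHom (n : ℕ) : Matrix (Fin n) (Fin n) ℂ →ₗ[ℂ] Module.End ℂ (Ext n) where
  toFun := der
  map_add' A B := LinearMap.ext (der_add A B)
  map_smul' c A := LinearMap.ext (der_smul c A)

/-- The map `moment`, as a bilinear map. -/
def momentHom (n : ℕ) : Ext n →ₗ[ℂ] Ext n →ₗ[ℂ] Matrix (Fin n) (Fin n) ℂ :=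
  LinearMap.mk₂ ℂ moment moment_add_left moment_smul_left moment_add_right
    fun c u w => moment_smul_right c u w

theorem IsForm.zero (d : ℕ) : IsForm d 0 :=
  ⟨0, MvPolynomial.isHomogeneous_zero _ _ _, fun z => by simp⟩

theorem IsForm.add {d : ℕ} {f f' : ⋀[ℂ]^3 (Vec 8) → ℂ} (hf : IsForm d f) (hf' : IsForm d f') :
    IsForm d (f + f') := by
  obtain ⟨p, hp, h⟩ := hf
  obtain ⟨p', hp', h'⟩ := hf'
  exact ⟨p + p', hp.add hp', fun z => by simp [h, h']⟩

theorem IsForm.mul {d d' : ℕ} {f f' : ⋀[ℂ]^3 (Vec 8) → ℂ} (hf : IsForm d f)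
    (hf' : IsForm d' f') : IsForm (d + d') (f * f') := by
  obtain ⟨p, hp, h⟩ := hf
  obtain ⟨p', hp', h'⟩ := hf'
  exact ⟨p * p', hp.mul hp', fun z => by simp [h, h']⟩

theorem IsForm.const (c : ℂ) : IsForm 0 fun _ => c :=
  ⟨MvPolynomial.C c, MvPolynomial.isHomogeneous_C _ _, fun z => by simp⟩

theorem IsForm.smul {d : ℕ} {f : ⋀[ℂ]^3 (Vec 8) → ℂ} (c : ℂ) (hf : IsForm d f) :
    IsForm d (c • f) := by
  have := (IsForm.const c).mul hf
  rwa [zero_add] at this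

theorem IsForm.sum {d : ℕ} {α : Type*} (s : Finset α) {f : α → ⋀[ℂ]^3 (Vec 8) → ℂ}
    (hf : ∀ a ∈ s, IsForm d (f a)) : IsForm d (∑ a ∈ s, f a) := by
  induction s using Finset.cons_induction with
  | empty => exact IsForm.zero d
  | cons a s ha ih =>
    rw [Finset.sum_cons]
    exact (hf a (Finset.mem_cons_self a s)).add (ih fun b hb => hf b (Finset.mem_cons_of_mem hb))

/-- The homogeneous polynomial maps of degree `d` from `∧³ V₈` to a vector space. -/
def polyMaps (d : ℕ) (W : Type*) [AddCommGroup W] [Module ℂ W] :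
    Submodule ℂ (⋀[ℂ]^3 (Vec 8) → W) :=
  Submodule.span ℂ {F | ∃ f w, IsForm d f ∧ F = fun z => f z • w}

section PolyMaps

variable {W W₁ W₂ : Type*} [AddCommGroup W] [Module ℂ W] [AddCommGroup W₁] [Module ℂ W₁]
  [AddCommGroup W₂] [Module ℂ W₂] {d d' : ℕ}

theorem IsForm.smul_mem_polyMaps {f : ⋀[ℂ]^3 (Vec 8) → ℂ} (hf : IsForm d f) (w : W) :
    (fun z => f z • w) ∈ polyMaps d W :=
  Submodule.subset_span ⟨f, w, hf, rfl⟩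

theorem polyMaps_linear (L : W →ₗ[ℂ] W₁) {F : ⋀[ℂ]^3 (Vec 8) → W} (hF : F ∈ polyMaps d W) :
    (fun z => L (F z)) ∈ polyMaps d W₁ := by
  induction hF using Submodule.span_induction with
  | mem F h =>
    obtain ⟨f, w, hf, rfl⟩ := h
    simpa only [map_smul] using hf.smul_mem_polyMaps (L w)
  | zero =>
    simp only [Pi.zero_apply, map_zero]
    exact zero_mem (polyMaps d W₁)
  | add F G _ _ hF hG =>
    simp only [Pi.add_apply, map_add]
    exact add_mem hF hG
  | smul c F _ hF =>
    simp only [Pi.smul_apply, map_smul]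
    exact Submodule.smul_mem _ c hF

/-- Together with `polyMaps_linear`, this lets the degree of a composite map be read off its
construction, without coordinates on the target. -/
theorem polyMaps_bilinear (B : W →ₗ[ℂ] W₁ →ₗ[ℂ] W₂) {F : ⋀[ℂ]^3 (Vec 8) → W}
    {G : ⋀[ℂ]^3 (Vec 8) → W₁} (hF : F ∈ polyMaps d W) (hG : G ∈ polyMaps d' W₁) :
    (fun z => B (F z) (G z)) ∈ polyMaps (d + d') W₂ := by
  induction hF using Submodule.span_induction with
  | mem F h =>
    obtain ⟨f, w, hf, rfl⟩ := h
    induction hG using Submodule.span_induction with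
    | mem G h =>
      obtain ⟨g, w', hg, rfl⟩ := h
      have h := (hf.mul hg).smul_mem_polyMaps (B w w')
      have e : ∀ z, B (f z • w) (g z • w') = (f * g) z • B w w' := fun z => by
        rw [map_smul, map_smul, LinearMap.smul_apply, smul_smul, mul_comm, Pi.mul_apply]
      simpa only [e] using h
    | zero =>
      simp only [Pi.zero_apply, map_zero]
      exact zero_mem (polyMaps (d + d') W₂)
    | add F G _ _ hF hG =>
      simp only [Pi.add_apply, map_add]
      exact add_mem hF hG
    | smul c F _ hF =>
      have h := Submodule.smul_mem _ c hF
      have e : ∀ z, B (f z • w) ((c • F) z) = c • B (f z • w) (F z) := fun z => by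
        rw [Pi.smul_apply, map_smul]
      simp only [e]
      exact h
  | zero =>
    simp only [Pi.zero_apply, map_zero, LinearMap.zero_apply]
    exact zero_mem (polyMaps (d + d') W₂)
  | add F G _ _ hF hG =>
    simp only [Pi.add_apply, map_add, LinearMap.add_apply]
    exact add_mem hF hG
  | smul c F _ hF =>
    simp only [Pi.smul_apply, map_smul, LinearMap.smul_apply]
    exact Submodule.smul_mem _ c hF

theorem const_mem_polyMaps (w : W) : (fun _ => w) ∈ polyMaps 0 W := by
  simpa using (IsForm.const 1).smul_mem_polyMaps w

theorem sum_mem_polyMaps {α : Type*} (s : Finset α) {F : α → ⋀[ℂ]^3 (Vec 8) → W}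
    (hF : ∀ a ∈ s, F a ∈ polyMaps d W) : (fun z => ∑ a ∈ s, F a z) ∈ polyMaps d W := by
  rw [← Finset.sum_fn]
  exact sum_mem hF

theorem isForm_of_mem_polyMaps {F : ⋀[ℂ]^3 (Vec 8) → ℂ} (hF : F ∈ polyMaps d ℂ) : IsForm d F := by
  induction hF using Submodule.span_induction with
  | mem F h =>
    obtain ⟨f, w, hf, rfl⟩ := h
    convert hf.smul w using 1
    funext z
    simp [mul_comm]
  | zero => exact IsForm.zero d
  | add F G _ _ hF hG => exact hF.add hG
  | smul c F _ hF => exact hF.smul c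

end PolyMaps

/-- The expansion of `z` in the standard basis has the coordinate functions, which are linear forms,
as coefficients. -/
theorem coe_mem_polyMaps : (fun z : ⋀[ℂ]^3 (Vec 8) => (z : Ext 8)) ∈ polyMaps 1 (Ext 8) := by
  have h : (fun z : ⋀[ℂ]^3 (Vec 8) => (z : Ext 8)) = ∑ s, fun z =>
      ((Pi.basisFun ℂ (Fin 8)).exteriorPower 3).repr z s
        • (((Pi.basisFun ℂ (Fin 8)).exteriorPower 3 s : ⋀[ℂ]^3 (Vec 8)) : Ext 8) := by
    funext z
    conv_lhs => rw [← ((Pi.basisFun ℂ (Fin 8)).exteriorPower 3).sum_repr z]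
    simp
  rw [h]
  refine sum_mem fun s _ => IsForm.smul_mem_polyMaps ?_ _
  exact ⟨MvPolynomial.X s, MvPolynomial.isHomogeneous_X _ _, fun z => by simp⟩

theorem quartic_mem_polyMaps {d k : ℕ} {X : ⋀[ℂ]^3 (Vec 8) → Ext 8} (hX : X ∈ polyMaps d (Ext 8))
    (hk : 4 + d = k) :
    (fun z : ⋀[ℂ]^3 (Vec 8) => quartic (z : Ext 8) (X z)) ∈ polyMaps k (Ext 8) := by
  have hm : ∀ {a b : ℕ} {F G : ⋀[ℂ]^3 (Vec 8) → Ext 8}, F ∈ polyMaps a (Ext 8) →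
      G ∈ polyMaps b (Ext 8) → (fun z => F z * G z) ∈ polyMaps (a + b) (Ext 8) :=
    fun hF hG => polyMaps_bilinear (LinearMap.mul ℂ (Ext 8)) hF hG
  have hv : ∀ {a : ℕ} {F : ⋀[ℂ]^3 (Vec 8) → Ext 8}, F ∈ polyMaps a (Ext 8) →
      (fun z => contr (F z) (vol 8)) ∈ polyMaps a (Ext 8) :=
    fun hF => polyMaps_linear (contr.toLinearMap.flip (vol 8)) hF
  have h1 := polyMaps_bilinear (momentHom 8) coe_mem_polyMaps (hv (hm coe_mem_polyMaps hX))
  have h2 := polyMaps_bilinear (derHom 8) h1 coe_mem_polyMaps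
  have h3 := neg_mem (hv (hm coe_mem_polyMaps h2))
  -- In order: the outer factor `z`, the first argument of `moment`, the factor `z` of `coTri` with
  -- `X` of degree `d`, and the `z` on which the matrix acts.
  have e : 1 + (1 + (1 + d) + 1) = k := by omega
  rw [e] at h3
  exact h3

theorem contr_mem_polyMaps {a b k : ℕ} {F G : ⋀[ℂ]^3 (Vec 8) → Ext 8}
    (hF : F ∈ polyMaps a (Ext 8)) (hG : G ∈ polyMaps b (Ext 8)) (hk : a + b = k) :
    (fun z => contr (F z) (G z)) ∈ polyMaps k (Ext 8) := by
  subst hk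
  exact polyMaps_bilinear contr.toLinearMap hF hG

/-- The degree is `1 + 4 + 1`: the inner contraction `φ ⌋ z`, the quartic, and the final contraction
into `z`. -/
theorem vec_QMap_mem_polyMaps (φ : Vec 8) : (fun z => vec (QMap z φ)) ∈ polyMaps 6 (Ext 8) := by
  have h1 := quartic_mem_polyMaps (polyMaps_linear (contr (vec φ)) coe_mem_polyMaps) rfl
  have h2 := neg_mem (contr_mem_polyMaps h1 coe_mem_polyMaps rfl)
  have e : (fun z => vec (QMap z φ))
      = -fun z : ⋀[ℂ]^3 (Vec 8) => contr (quartic z (contr (vec φ) (z : Ext 8))) (z : Ext 8) := by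
    funext z
    exact QMap_eq z φ
  rw [e]
  exact h2

/-- The quartic is applied here to a constant two-vector, so each term has degree `6 + 4`. -/
theorem vec_RMap_mem_polyMaps (v : Vec 8) : (fun z => vec (RMap z v)) ∈ polyMaps 10 (Ext 8) := by
  have h : ∀ a ∈ Finset.univ, (fun z : ⋀[ℂ]^3 (Vec 8) => contr (vec (QMap z (e a)))
      (quartic (z : Ext 8) (vec (e a) * vec v))) ∈ polyMaps 10 (Ext 8) := by
    intro a _
    have h1 := quartic_mem_polyMaps (const_mem_polyMaps (vec (e a) * vec v)) (add_zero 4)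
    have h2 := contr_mem_polyMaps (vec_QMap_mem_polyMaps (e a)) h1 (k := 10) (by norm_num)
    exact h2
  have h2 := sum_mem_polyMaps Finset.univ h
  simp only [vec_RMap]
  exact h2

theorem isForm_coord {d : ℕ} {F : ⋀[ℂ]^3 (Vec 8) → Vec 8}
    (hF : (fun z => vec (F z)) ∈ polyMaps d (Ext 8)) (i : Fin 8) : IsForm d fun z => F z i := by
  have h := polyMaps_linear (LinearMap.proj i ∘ₗ ExteriorAlgebra.ιInv) hF
  have e : ∀ z, (LinearMap.proj i ∘ₗ ExteriorAlgebra.ιInv) (vec (F z)) = F z i := fun z =>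
    congrFun (ExteriorAlgebra.ι_leftInverse (R := ℂ) (F z)) i
  simp only [e] at h
  exact isForm_of_mem_polyMaps h

theorem Q_apply (z : ⋀[ℂ]^3 (Vec 8)) (i j : Fin 8) : Q z i j = QMap z (e j) i := by
  rw [Q, LinearMap.toMatrix'_apply]

theorem R_apply (z : ⋀[ℂ]^3 (Vec 8)) (i j : Fin 8) : R z i j = RMap z (e j) i := by
  rw [R, LinearMap.toMatrix'_apply]

theorem isForm_Q (i j : Fin 8) : IsForm 6 fun z => Q z i j := by
  simp only [Q_apply]
  exact isForm_coord (vec_QMap_mem_polyMaps _) i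

theorem isForm_R (i j : Fin 8) : IsForm 10 fun z => R z i j := by
  simp only [R_apply]
  exact isForm_coord (vec_RMap_mem_polyMaps _) i

theorem isForm_Q_mul_R (i j : Fin 8) : IsForm 16 fun z => (Q z * R z) i j := by
  have h : (fun z => (Q z * R z) i j) = ∑ k, (fun z => Q z i k) * fun z => R z k j := by
    funext z
    simp [Matrix.mul_apply]
  rw [h]
  exact IsForm.sum _ fun k _ => (isForm_Q i k).mul (isForm_R k j)

/-! ### The tangent space of the orbit of the generic three-vector -/

/-- Combinations of the vectors `e_i ∧ (e_j ⌋ z)`, for the generic three-vector `z`. -/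
def tangentCombo (l : List (ℤ × Fin 8 × Fin 8)) : Combo 8 :=
  l.flatMap fun t =>
    Combo.scale t.1 (Combo.mulMono [t.2.1] (Combo.contrMono [t.2.2] genericCombo))

/-- The monomials `e_i ∧ e_j ∧ e_k`, multiplied by `3`, as tangent vectors to the orbit of the generic
three-vector. -/
def tangentTable : List (List (Fin 8) × List (ℤ × Fin 8 × Fin 8)) :=
  [
   ([0, 1, 2], [(1, 0, 0), (1, 1, 1), (1, 2, 2), (-1, 6, 6), (-1, 7, 7)]),
   ([0, 1, 3], [(-3, 1, 6), (3, 1, 7)]), ([0, 1, 4], [(-3, 0, 6), (3, 0, 7)]),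
   ([0, 1, 5], [(3, 5, 2)]), ([0, 1, 6], [(3, 1, 3), (-3, 5, 7)]),
   ([0, 1, 7], [(-3, 0, 4), (-3, 5, 6)]), ([0, 2, 3], [(-3, 2, 6)]), ([0, 2, 4], [(-3, 4, 1)]),
   ([0, 2, 5], [(3, 0, 6)]), ([0, 2, 6], [(3, 2, 3), (3, 4, 7)]), ([0, 2, 7], [(-3, 7, 1)]),
   ([0, 3, 4], [(3, 4, 6), (-3, 4, 7)]), ([0, 3, 5], [(3, 5, 6)]),
   ([0, 3, 6], [(2, 0, 0), (-1, 1, 1), (-1, 2, 2), (1, 6, 6), (1, 7, 7)]),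
   ([0, 3, 7], [(-1, 0, 0), (2, 1, 1), (-1, 2, 2), (1, 6, 6), (3, 7, 6), (-2, 7, 7)]),
   ([0, 4, 5], [(3, 0, 3)]), ([0, 4, 6], [(3, 4, 3)]), ([0, 4, 7], [(3, 0, 1)]),
   ([0, 5, 6], [(3, 5, 3)]), ([0, 5, 7], [(3, 0, 2), (-3, 5, 3)]),
   ([0, 6, 7], [(-3, 0, 6), (-3, 5, 1), (-3, 7, 3)]), ([1, 2, 3], [(3, 3, 0)]),
   ([1, 2, 4], [(-3, 2, 7)]), ([1, 2, 5], [(3, 1, 7)]), ([1, 2, 6], [(3, 6, 0)]),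
   ([1, 2, 7], [(3, 2, 4), (-3, 3, 6)]), ([1, 3, 4], [(3, 3, 6), (-3, 3, 7)]),
   ([1, 3, 5], [(-3, 1, 4)]), ([1, 3, 6], [(3, 1, 0)]), ([1, 3, 7], [(3, 3, 4)]),
   ([1, 4, 5], [(3, 5, 7)]),
   ([1, 4, 6], [(2, 0, 0), (-1, 1, 1), (-1, 2, 2), (-2, 6, 6), (3, 6, 7), (1, 7, 7)]),
   ([1, 4, 7], [(-1, 0, 0), (2, 1, 1), (-1, 2, 2), (1, 6, 6), (1, 7, 7)]),
   ([1, 5, 6], [(3, 1, 2), (-3, 5, 4)]), ([1, 5, 7], [(3, 5, 4)]),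
   ([1, 6, 7], [(3, 1, 7), (-3, 5, 0), (3, 6, 4)]), ([2, 3, 4], [(3, 2, 5)]),
   ([2, 3, 5], [(-3, 3, 6)]), ([2, 3, 6], [(3, 2, 0)]), ([2, 3, 7], [(-3, 2, 0), (3, 3, 5)]),
   ([2, 4, 5], [(-3, 4, 7)]), ([2, 4, 6], [(-3, 2, 1), (3, 4, 5)]), ([2, 4, 7], [(3, 2, 1)]),
   ([2, 5, 6], [(-2, 0, 0), (1, 1, 1), (1, 2, 2), (2, 6, 6), (-1, 7, 7)]),
   ([2, 5, 7], [(1, 0, 0), (-2, 1, 1), (1, 2, 2), (-1, 6, 6), (2, 7, 7)]),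
   ([2, 6, 7], [(-3, 2, 6), (3, 3, 1), (-3, 7, 5)]),
   ([3, 4, 5], [(-2, 0, 0), (1, 1, 1), (1, 2, 2), (3, 3, 3), (-1, 6, 6), (-1, 7, 7)]),
   ([3, 4, 6], [(-3, 2, 7), (-3, 4, 0)]), ([3, 4, 7], [(-3, 2, 6), (3, 3, 1)]),
   ([3, 5, 6], [(3, 1, 7), (-3, 5, 0)]), ([3, 5, 7], [(-3, 7, 4)]),
   ([3, 6, 7], [(-3, 2, 4), (3, 3, 6), (3, 7, 0)]), ([4, 5, 6], [(3, 6, 3)]),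
   ([4, 5, 7], [(-3, 0, 6), (-3, 5, 1)]), ([4, 6, 7], [(-3, 2, 3), (-3, 4, 7), (-3, 6, 1)]),
   ([5, 6, 7], [(3, 0, 4), (3, 5, 6), (3, 7, 2)])  ]

/-- The table is searched with default `[]`, which represents `0` and would fail the test; the check
therefore also shows that no triple is missing. The factor `3` clears the denominators of the
diagonal combinations. -/
theorem same_tangentCombo : ∀ i j k : Fin 8, i < j → j < k →
    Combo.same [(3, [i, j, k])] (tangentCombo ((tangentTable.lookup [i, j, k]).getD [])) = true := by
  decide +kernel

/-- Each `eᵢ ∧ (eⱼ ⌋ z)` is the action of an elementary matrix on `z`, by `der_single`. -/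
theorem eval_tangentCombo (l : List (ℤ × Fin 8 × Fin 8)) :
    ∃ A, Combo.eval (tangentCombo l) = der A (generic : Ext 8) := by
  induction l with
  | nil => exact ⟨0, by rw [der_zero_left]; rfl⟩
  | cons t l ih =>
    obtain ⟨A, hA⟩ := ih
    refine ⟨(t.1 : ℂ) • Matrix.single t.2.1 t.2.2 1 + A, ?_⟩
    rw [tangentCombo] at hA
    rw [tangentCombo, List.flatMap_cons, Combo.eval_append, hA, der_add, der_smul, der_single,
      Combo.eval_scale, Combo.eval_mulMono, Combo.eval_contrMono]
    simp [Combo.evalMono, generic]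

theorem basis_exteriorPower_apply (s : Set.powersetCard (Fin 8) 3) :
    ∃ i j k : Fin 8, i < j ∧ j < k ∧ ((Pi.basisFun ℂ (Fin 8)).exteriorPower 3 s : Ext 8)
      = vec (e i) * (vec (e j) * vec (e k)) := by
  refine ⟨Set.powersetCard.ofFinEmbEquiv.symm s 0, Set.powersetCard.ofFinEmbEquiv.symm s 1,
    Set.powersetCard.ofFinEmbEquiv.symm s 2, ?_, ?_, ?_⟩
  · simp
  · simp
  · rw [exteriorPower.basis_apply, exteriorPower.ιMulti_family_apply_coe]
    simp [ExteriorAlgebra.ιMulti_family, ExteriorAlgebra.ιMulti_apply, Matrix.vecTail]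

/-- The infinitesimal action at the generic three-vector maps the `64`-dimensional `gl₈` onto the
`56`-dimensional `∧³V₈`, because the table reaches every basis vector. Its kernel, of dimension `8`,
is the isotropy algebra. -/
theorem exists_der_generic (x : ⋀[ℂ]^3 (Vec 8)) : ∃ A, der A (generic : Ext 8) = x := by
  have hb : ∀ s, ∃ A, der A (generic : Ext 8)
      = ((Pi.basisFun ℂ (Fin 8)).exteriorPower 3 s : Ext 8) := by
    intro s
    obtain ⟨i, j, k, hij, hjk, h⟩ := basis_exteriorPower_apply s
    obtain ⟨A, hA⟩ := eval_tangentCombo ((tangentTable.lookup [i, j, k]).getD [])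
    rw [← Combo.eval_eq_of_same (same_tangentCombo i j k hij hjk)] at hA
    refine ⟨(3⁻¹ : ℂ) • A, ?_⟩
    rw [der_smul, ← hA, h]
    simp [Combo.evalMono]
  choose A hA using hb
  refine ⟨∑ s, ((Pi.basisFun ℂ (Fin 8)).exteriorPower 3).repr x s • A s, ?_⟩
  have := congrArg (Submodule.subtype _) (((Pi.basisFun ℂ (Fin 8)).exteriorPower 3).sum_repr x)
  rw [map_sum] at this
  refine Eq.trans ?_ this
  change derHom 8 _ _ = _
  rw [map_sum, LinearMap.sum_apply]
  refine Finset.sum_congr rfl fun s _ => ?_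
  rw [map_smul, map_smul, LinearMap.smul_apply, Submodule.subtype_apply, ← hA]
  rfl
open Filter Topology

/-! ### The orbit of the generic three-vector is Zariski dense -/

/-- The coordinates of a three-vector in the standard basis. -/
def triCoord : ⋀[ℂ]^3 (Vec 8) ≃ₗ[ℂ] (Set.powersetCard (Fin 8) 3 → ℂ) :=
  ((Pi.basisFun ℂ (Fin 8)).exteriorPower 3).equivFun

/-- The identity matrix, as a family of entries. -/
def identityEntries : Fin 8 → Fin 8 → ℂ := Matrix.of.symm 1

/-- The orbit map `g ↦ g z`, in coordinates. -/
def orbitMap (z : ⋀[ℂ]^3 (Vec 8)) (g : Fin 8 → Fin 8 → ℂ) : Set.powersetCard (Fin 8) 3 → ℂ :=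
  triCoord (exteriorPower.map 3 (Matrix.toLin' (Matrix.of g)) z)

/-- The infinitesimal orbit map `A ↦ A z`, with values in the third exterior power. -/
def derTri (z : ⋀[ℂ]^3 (Vec 8)) : Matrix (Fin 8) (Fin 8) ℂ →ₗ[ℂ] ⋀[ℂ]^3 (Vec 8) :=
  ((derHom 8).flip (z : Ext 8)).codRestrict _ fun A => der_mem A z.2

theorem coe_derTri (z : ⋀[ℂ]^3 (Vec 8)) (A : Matrix (Fin 8) (Fin 8) ℂ) :
    (derTri z A : Ext 8) = der A (z : Ext 8) := rfl

/-- The derivative of the orbit map at the identity. -/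
def orbitDeriv (z : ⋀[ℂ]^3 (Vec 8)) :
    (Fin 8 → Fin 8 → ℂ) →L[ℂ] (Set.powersetCard (Fin 8) 3 → ℂ) :=
  LinearMap.toContinuousLinearMap
    (triCoord.toLinearMap ∘ₗ derTri z ∘ₗ (Matrix.ofLinearEquiv ℂ).toLinearMap)

theorem orbitDeriv_apply (z : ⋀[ℂ]^3 (Vec 8)) (A : Fin 8 → Fin 8 → ℂ) :
    orbitDeriv z A = triCoord (derTri z (Matrix.of A)) := rfl

/-- The coordinates of `v₁ ∧ v₂ ∧ v₃`. -/
def wedgeCoord : MultilinearMap ℂ (fun _ : Fin 3 => Vec 8) (Set.powersetCard (Fin 8) 3 → ℂ) :=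
  triCoord.toLinearMap.compMultilinearMap (exteriorPower.ιMulti ℂ 3).toMultilinearMap

/-- Expanding each vector in the standard basis shows that the coordinates of the wedge are
polynomials in the entries. -/
theorem continuous_wedgeCoord : Continuous wedgeCoord := by
  have h : ∀ v : Fin 3 → Vec 8,
      wedgeCoord v = ∑ r : Fin 3 → Fin 8, (∏ i, v i (r i)) • wedgeCoord fun i => e (r i) := by
    intro v
    conv_lhs => rw [show v = fun i => ∑ j, v i j • (e j : Vec 8) from funext fun i => (sum_e _).symm]
    rw [MultilinearMap.map_sum]
    exact Finset.sum_congr rfl fun r _ => MultilinearMap.map_smul_univ _ _ _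
  rw [show ⇑wedgeCoord = _ from funext h]
  fun_prop

/-- The Leibniz rule, in the shape of the derivative of a multilinear map, as needed for
`hasStrictFDerivAt_orbitMap`. -/
theorem der_ιMulti (A : Matrix (Fin 8) (Fin 8) ℂ) (v : Fin 3 → Vec 8) :
    derTri (exteriorPower.ιMulti ℂ 3 v) A
      = ∑ i, exteriorPower.ιMulti ℂ 3 (Function.update v i (A *ᵥ v i)) := by
  apply Subtype.ext
  rw [coe_derTri]
  simp only [Fin.sum_univ_three, Submodule.coe_add, exteriorPower.ιMulti_apply_coe,
    ExteriorAlgebra.ιMulti_apply, List.ofFn_succ, List.ofFn_zero, List.prod_cons, List.prod_nil,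
    der_vec_mul, der_one]
  simp [Function.update, mul_add]
  abel

/-- For a decomposable `z` the orbit map is a multilinear map composed with a linear one, and the
chain rule applies. Both the map and its proposed derivative are linear in `z`, and decomposable
vectors span. -/
theorem hasStrictFDerivAt_orbitMap (z : ⋀[ℂ]^3 (Vec 8)) :
    HasStrictFDerivAt (orbitMap z) (orbitDeriv z) identityEntries := by
  have hz : z ∈ Submodule.span ℂ (Set.range (exteriorPower.ιMulti ℂ 3 (M := Vec 8))) := by
    rw [exteriorPower.ιMulti_span]; trivial
  induction hz using Submodule.span_induction with
  | mem z hz =>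
    obtain ⟨v, rfl⟩ := hz
    let L : (Fin 8 → Fin 8 → ℂ) →ₗ[ℂ] (Fin 3 → Vec 8) :=
      LinearMap.pi fun i => (LinearMap.applyₗ (v i)) ∘ₗ Matrix.toLin'.toLinearMap
        ∘ₗ (Matrix.ofLinearEquiv ℂ).toLinearMap
    have hL : ∀ g i, L g i = Matrix.of g *ᵥ v i := fun g i => rfl
    have hL1 : L identityEntries = v := by
      funext i
      rw [hL]
      exact Matrix.one_mulVec _
    let W : ContinuousMultilinearMap ℂ (fun _ : Fin 3 => Vec 8) (Set.powersetCard (Fin 8) 3 → ℂ) :=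
      ⟨wedgeCoord, continuous_wedgeCoord⟩
    have h := (W.hasStrictFDerivAt (LinearMap.toContinuousLinearMap L identityEntries)).comp
      identityEntries
      (ContinuousLinearMap.hasStrictFDerivAt (x := identityEntries) (LinearMap.toContinuousLinearMap L))
    have e1 : orbitMap (exteriorPower.ιMulti ℂ 3 v) = W ∘ LinearMap.toContinuousLinearMap L := by
      funext g
      rw [orbitMap, exteriorPower.map_apply_ιMulti]
      rfl
    have e2 : orbitDeriv (exteriorPower.ιMulti ℂ 3 v)
        = (W.linearDeriv (LinearMap.toContinuousLinearMap L identityEntries)).comp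
          (LinearMap.toContinuousLinearMap L) := by
      ext1 A
      rw [orbitDeriv_apply, der_ιMulti, map_sum, LinearMap.coe_toContinuousLinearMap', hL1,
        ContinuousLinearMap.comp_apply, ContinuousMultilinearMap.linearDeriv_apply]
      rfl
    rw [e1, e2]
    exact h
  | zero =>
    have e1 : orbitMap 0 = fun _ => 0 := by
      funext g
      simp [orbitMap]
    have e2 : orbitDeriv 0 = 0 := by
      ext1 A
      rw [orbitDeriv_apply, show derTri 0 (Matrix.of A) = 0 from
        Subtype.ext (by rw [coe_derTri]; simp)]
      simp
    rw [e1, e2]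
    exact hasStrictFDerivAt_const _ _
  | add z w _ _ hz hw =>
    have e1 : orbitMap (z + w) = orbitMap z + orbitMap w := by
      funext g
      simp [orbitMap]
    have e2 : orbitDeriv (z + w) = orbitDeriv z + orbitDeriv w := by
      ext1 A
      simp only [orbitDeriv_apply, add_apply]
      rw [← map_add]
      congr 1
      exact Subtype.ext (by simp [coe_derTri])
    rw [e1, e2]
    exact hz.add hw
  | smul c z _ hz =>
    have e1 : orbitMap (c • z) = c • orbitMap z := by
      funext g
      simp [orbitMap]
    have e2 : orbitDeriv (c • z) = c • orbitDeriv z := by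
      ext1 A
      simp only [orbitDeriv_apply, smul_apply]
      rw [← map_smul]
      congr 1
      exact Subtype.ext (by simp [coe_derTri])
    rw [e1, e2]
    exact hz.const_smul c

theorem orbitDeriv_generic_range : (orbitDeriv generic).range = ⊤ := by
  rw [LinearMap.range_eq_top]
  intro x
  obtain ⟨A, hA⟩ := exists_der_generic (triCoord.symm x)
  refine ⟨A, ?_⟩
  change triCoord (derTri generic A) = x
  rw [show derTri generic A = triCoord.symm x from Subtype.ext hA, LinearEquiv.apply_symm_apply]

/-- A surjective strict derivative makes the orbit map send neighbourhoods of the identity onto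
neighbourhoods of the generic vector. The matrices near the identity are invertible, so `p` vanishes
on an open set. -/
theorem eq_zero_of_eval_orbitMap {p : MvPolynomial (Set.powersetCard (Fin 8) 3) ℂ}
    (hp : ∀ g : Matrix (Fin 8) (Fin 8) ℂ, g.det ≠ 0 →
      MvPolynomial.eval (orbitMap generic g) p = 0) : p = 0 := by
  have hmap := (hasStrictFDerivAt_orbitMap generic).map_nhds_eq_of_surj orbitDeriv_generic_range
  have hdet : {g : Fin 8 → Fin 8 → ℂ | (Matrix.of g).det ≠ 0}
      ∈ 𝓝 identityEntries := by
    refine (isOpen_ne_fun (Continuous.matrix_det continuous_id) continuous_const).mem_nhds ?_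
    change (1 : Matrix (Fin 8) (Fin 8) ℂ).det ≠ 0
    simp
  have hn : {w | MvPolynomial.eval w p = 0} ∈ 𝓝 (orbitMap generic identityEntries) := by
    rw [← hmap, mem_map]
    filter_upwards [hdet] with g hg
    exact hp g hg
  obtain ⟨ε, hε, hb⟩ := Metric.mem_nhds_iff.mp hn
  -- For the sup norm a ball is a product of discs, and a polynomial vanishing on a product of
  -- infinite sets is zero.
  rw [ball_pi _ hε] at hb
  refine MvPolynomial.funext_set
    (fun s => Metric.ball (orbitMap generic identityEntries s) ε)
    (fun s => infinite_of_mem_nhds _ (Metric.ball_mem_nhds _ hε)) fun x hx => ?_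
  rw [map_zero]
  exact hb hx

/-- A homogeneous polynomial vanishing on the orbit of the generic three-vector is zero. -/
theorem IsForm.eq_zero {d : ℕ} {f : ⋀[ℂ]^3 (Vec 8) → ℂ} (hf : IsForm d f)
    (h : ∀ g : Matrix (Fin 8) (Fin 8) ℂ, g.det ≠ 0 →
      f (exteriorPower.map 3 (Matrix.toLin' g) generic) = 0) : f = 0 := by
  obtain ⟨p, -, hp⟩ := hf
  have h0 : p = 0 := eq_zero_of_eval_orbitMap fun g hg => by
    rw [← h g hg, hp]
    rfl
  funext z
  rw [hp, h0, map_zero, Pi.zero_apply]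

/-! ### The matrix factorization -/

theorem contragredient_inv {g : Matrix (Fin 8) (Fin 8) ℂ} (hg : g.det ≠ 0) :
    (g⁻¹ᵀ)ᵀ * g = 1 := by
  rw [Matrix.transpose_transpose, Matrix.nonsing_inv_mul _ (isUnit_iff_ne_zero.mpr hg)]

theorem Q_map {g : Matrix (Fin 8) (Fin 8) ℂ} (hg : g.det ≠ 0) (z : ⋀[ℂ]^3 (Vec 8)) :
    Q (exteriorPower.map 3 (Matrix.toLin' g) z) = g.det ^ 2 • (g * Q z * gᵀ) := by
  have h : QMap (exteriorPower.map 3 (Matrix.toLin' g) z)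
      = g.det ^ 2 • (Matrix.toLin' g ∘ₗ QMap z ∘ₗ Matrix.toLin' gᵀ) :=
    LinearMap.ext fun φ => by
      rw [QMap_map (contragredient_inv hg)]
      simp only [LinearMap.smul_apply, LinearMap.comp_apply, Matrix.toLin'_apply]
  rw [Q, h, map_smul, LinearMap.toMatrix'_comp, LinearMap.toMatrix'_comp,
    LinearMap.toMatrix'_toLin', LinearMap.toMatrix'_toLin', Q, Matrix.mul_assoc]

theorem R_map {g : Matrix (Fin 8) (Fin 8) ℂ} (hg : g.det ≠ 0) (z : ⋀[ℂ]^3 (Vec 8)) :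
    R (exteriorPower.map 3 (Matrix.toLin' g) z) = g.det ^ 4 • (g⁻¹ᵀ * R z * g⁻¹) := by
  have h : RMap (exteriorPower.map 3 (Matrix.toLin' g) z)
      = g.det ^ 4 • (Matrix.toLin' g⁻¹ᵀ ∘ₗ RMap z ∘ₗ Matrix.toLin' (g⁻¹ᵀ)ᵀ) :=
    LinearMap.ext fun v => by
      rw [RMap_map (contragredient_inv hg)]
      simp only [LinearMap.smul_apply, LinearMap.comp_apply, Matrix.toLin'_apply]
  rw [R, h, map_smul, LinearMap.toMatrix'_comp, LinearMap.toMatrix'_comp,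
    LinearMap.toMatrix'_toLin', LinearMap.toMatrix'_toLin', R, Matrix.mul_assoc,
    Matrix.transpose_transpose]

/-- The factor `gᵀ` from `Q` cancels `g⁻ᵀ` from `R`, and the determinants combine as `2 + 4`. -/
theorem Q_mul_R_map {g : Matrix (Fin 8) (Fin 8) ℂ} (hg : g.det ≠ 0) (z : ⋀[ℂ]^3 (Vec 8)) :
    Q (exteriorPower.map 3 (Matrix.toLin' g) z) * R (exteriorPower.map 3 (Matrix.toLin' g) z)
      = g.det ^ 6 • (g * (Q z * R z) * g⁻¹) := by
  have h := contragredient_symm (contragredient_inv hg)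
  rw [Q_map hg, R_map hg, Matrix.smul_mul, Matrix.mul_smul, smul_smul, ← pow_add]
  congr 1
  simp only [Matrix.mul_assoc]
  rw [← Matrix.mul_assoc gᵀ, h, Matrix.one_mul]

theorem Q_mul_R_orbit {g : Matrix (Fin 8) (Fin 8) ℂ} (hg : g.det ≠ 0) :
    Q (exteriorPower.map 3 (Matrix.toLin' g) generic)
        * R (exteriorPower.map 3 (Matrix.toLin' g) generic)
      = (g.det ^ 6 * 9000) • 1 := by
  rw [Q_mul_R_map hg, Q_mul_R_generic, Matrix.mul_smul, Matrix.smul_mul, Matrix.mul_one,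
    Matrix.mul_nonsing_inv _ (isUnit_iff_ne_zero.mpr hg), smul_smul]

theorem IsForm.sub {d : ℕ} {f f' : ⋀[ℂ]^3 (Vec 8) → ℂ} (hf : IsForm d f) (hf' : IsForm d f') :
    IsForm d (f - f') := by
  have := hf.add (hf'.smul (-1))
  rwa [neg_one_smul, ← sub_eq_add_neg] at this

/-- The differences of transposed entries are forms that vanish on the dense orbit. -/
theorem isSymm_of_orbit {d : ℕ} {M : ⋀[ℂ]^3 (Vec 8) → Matrix (Fin 8) (Fin 8) ℂ}
    (hM : ∀ i j, IsForm d fun z => M z i j)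
    (h : ∀ g : Matrix (Fin 8) (Fin 8) ℂ, g.det ≠ 0 →
      (M (exteriorPower.map 3 (Matrix.toLin' g) generic)).IsSymm) (z : ⋀[ℂ]^3 (Vec 8)) :
    (M z).IsSymm := by
  refine Matrix.IsSymm.ext fun i j => ?_
  have h0 := ((hM j i).sub (hM i j)).eq_zero fun g hg => sub_eq_zero.mpr ((h g hg).apply i j)
  exact sub_eq_zero.mp (congrFun h0 z)

theorem Q_isSymm (z : ⋀[ℂ]^3 (Vec 8)) : (Q z).IsSymm := by
  refine isSymm_of_orbit isForm_Q (fun g hg => ?_) z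
  rw [Q_map hg]
  refine Matrix.IsSymm.smul ?_ _
  rw [Matrix.IsSymm, Matrix.transpose_mul, Matrix.transpose_mul, Matrix.transpose_transpose,
    Q_generic_isSymm, Matrix.mul_assoc]

theorem R_isSymm (z : ⋀[ℂ]^3 (Vec 8)) : (R z).IsSymm := by
  refine isSymm_of_orbit isForm_R (fun g hg => ?_) z
  rw [R_map hg]
  refine Matrix.IsSymm.smul ?_ _
  rw [Matrix.IsSymm, Matrix.transpose_mul, Matrix.transpose_mul, Matrix.transpose_transpose,
    R_generic_isSymm, Matrix.mul_assoc]

/-- The invariant of degree `16`. -/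
def J16 (z : ⋀[ℂ]^3 (Vec 8)) : ℂ := (Q z * R z) 0 0

theorem isForm_J16 : IsForm 16 J16 := isForm_Q_mul_R 0 0

theorem J16_generic : J16 generic = 9000 := by
  rw [J16, Q_mul_R_generic]
  simp

/-- On the orbit `Q R` is a scalar matrix. The off-diagonal entries and the differences of diagonal
entries are forms of degree `16`, so they vanish identically. -/
theorem Q_mul_R (z : ⋀[ℂ]^3 (Vec 8)) : Q z * R z = J16 z • 1 := by
  ext i j
  rw [Matrix.smul_apply, Matrix.one_apply]
  split_ifs with hij
  · subst hij
    have h0 := ((isForm_Q_mul_R i i).sub isForm_J16).eq_zero fun g hg => by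
      rw [Pi.sub_apply, J16, Q_mul_R_orbit hg]
      simp
    rw [smul_eq_mul, mul_one]
    exact sub_eq_zero.mp (congrFun h0 z)
  · have h0 := (isForm_Q_mul_R i j).eq_zero fun g hg => by
      rw [Q_mul_R_orbit hg]
      simp [hij]
    rw [smul_zero]
    exact congrFun h0 z

/-- This is the transpose of `Q_mul_R`, both factors being symmetric. -/
theorem R_mul_Q (z : ⋀[ℂ]^3 (Vec 8)) : R z * Q z = J16 z • 1 := by
  have h := congrArg Matrix.transpose (Q_mul_R z)
  rwa [Matrix.transpose_mul, Q_isSymm, R_isSymm, Matrix.transpose_smul, Matrix.transpose_one] at h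

theorem isInvariantForm_J16 : IsInvariantForm 16 J16 := by
  refine ⟨isForm_J16, fun g z => ?_⟩
  have hg : (g : Matrix (Fin 8) (Fin 8) ℂ).det = 1 := g.2
  have h0 : (g : Matrix (Fin 8) (Fin 8) ℂ).det ≠ 0 := by rw [hg]; exact one_ne_zero
  rw [J16, Q_mul_R_map h0, hg, Q_mul_R, Matrix.mul_smul, Matrix.smul_mul, Matrix.mul_one,
    Matrix.mul_nonsing_inv _ (isUnit_iff_ne_zero.mpr h0)]
  simp

/-! ### Uniqueness of the invariant of degree `16` -/

theorem IsForm.map_smul {d : ℕ} {f : ⋀[ℂ]^3 (Vec 8) → ℂ} (hf : IsForm d f) (c : ℂ)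
    (z : ⋀[ℂ]^3 (Vec 8)) : f (c • z) = c ^ d * f z := by
  obtain ⟨p, hp, h⟩ := hf
  rw [h, h, MvPolynomial.eval_eq, MvPolynomial.eval_eq, Finset.mul_sum]
  refine Finset.sum_congr rfl fun m hm => ?_
  have hd : ∑ i ∈ m.support, m i = d := by
    rw [← hp (MvPolynomial.mem_support_iff.mp hm), Finsupp.weight_apply]
    simp [Finsupp.sum]
  simp only [LinearEquiv.map_smul, Finsupp.smul_apply, smul_eq_mul, mul_pow, Finset.prod_mul_distrib,
    Finset.prod_pow_eq_pow_sum, hd]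
  ring

theorem map_smul_toLin' (t : ℂ) (g : Matrix (Fin 8) (Fin 8) ℂ) (z : ⋀[ℂ]^3 (Vec 8)) :
    exteriorPower.map 3 (Matrix.toLin' (t • g)) z
      = t ^ 3 • exteriorPower.map 3 (Matrix.toLin' g) z := by
  apply Subtype.ext
  rw [Submodule.coe_smul, coe_map_toLin', coe_map_toLin']
  obtain ⟨z, hz⟩ := z
  induction hz using tri_induction with
  | hadd x hx y hy ihx ihy => simp only [map_add, smul_add, ihx, ihy]
  | hm a b c =>
    simp only [map_mul, mapMatrix_vec, Matrix.smul_mulVec, LinearMap.map_smul, smul_mul_assoc,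
      mul_smul_comm, smul_smul]
    congr 1
    ring

/-- With `t` an eighth root of the determinant, `t⁻¹ g` is in `SL(V₈)`, and the scalar matrix `t`
multiplies three-vectors by `t³`. -/
theorem IsInvariantForm.map_orbit {d : ℕ} {f : ⋀[ℂ]^3 (Vec 8) → ℂ} (hf : IsInvariantForm d f)
    {g : Matrix (Fin 8) (Fin 8) ℂ} {t : ℂ} (ht : t ^ 8 = g.det) (hg : g.det ≠ 0)
    (z : ⋀[ℂ]^3 (Vec 8)) :
    f (exteriorPower.map 3 (Matrix.toLin' g) z) = (t ^ 3) ^ d * f z := by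
  have h0 : t ≠ 0 := by
    rintro rfl
    exact hg (by rw [← ht]; simp)
  have hs : (t⁻¹ • g).det = 1 := by
    rw [Matrix.det_smul, Fintype.card_fin, ← ht, inv_pow, inv_mul_cancel₀ (pow_ne_zero 8 h0)]
  have hgs : g = t • (t⁻¹ • g) := by rw [smul_smul, mul_inv_cancel₀ h0, one_smul]
  have h := hf.2 ⟨t⁻¹ • g, hs⟩ z
  rw [hgs, map_smul_toLin', hf.1.map_smul, ← h]

/-- Along the orbit both sides are multiplied by the same factor `(t³)¹⁶`, and the constant makes
them agree at the generic three-vector, where `J16` is `9000`. -/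
theorem IsInvariantForm.eq_smul_J16 {f : ⋀[ℂ]^3 (Vec 8) → ℂ} (hf : IsInvariantForm 16 f) :
    f = (f generic / 9000) • J16 := by
  refine sub_eq_zero.mp ((hf.1.sub (isForm_J16.smul (f generic / 9000))).eq_zero fun g hg => ?_)
  obtain ⟨t, ht⟩ := IsAlgClosed.exists_pow_nat_eq g.det (n := 8) (by norm_num)
  rw [Pi.sub_apply, Pi.smul_apply, hf.map_orbit ht hg, isInvariantForm_J16.map_orbit ht hg,
    J16_generic, smul_eq_mul]
  ring

end E8Model

end

theorem mainTheorem8 :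
    (∀ z, (E8Model.Q z).IsSymm) ∧ (∀ z, (E8Model.R z).IsSymm) ∧
    ∃ J : ⋀[ℂ]^3 (Fin 8 → ℂ) → ℂ, J ≠ 0 ∧ E8Model.IsInvariantForm 16 J ∧
      (∀ J', E8Model.IsInvariantForm 16 J' → ∃ c : ℂ, J' = c • J) ∧
      E8Model.IsMatrixFactorization 6 10 J E8Model.Q E8Model.R := by
  refine ⟨E8Model.Q_isSymm, E8Model.R_isSymm, E8Model.J16, ?_, E8Model.isInvariantForm_J16,
    fun J' hJ' => ⟨_, hJ'.eq_smul_J16⟩, E8Model.isForm_Q, E8Model.isForm_R, E8Model.Q_mul_R,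
    E8Model.R_mul_Q⟩
  intro h
  have h1 := E8Model.J16_generic
  rw [h, Pi.zero_apply] at h1
  norm_num at h1
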